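/- **Theorem 3 (on stability of the class of $\mathcal S$-functions).** Let $\mathbb S^2=\mathbb C\cup\{\infty\}$ be the Riemann sphere. A regular germ at $a\in\mathbb S^2$ is a germ at $a$ of a $\mathbb C$-valued holomorphic function. Two regular germs are equivalent if one is obtained from the other by analytic continuation along a path in $\mathbb S^2$; a multivalued analytic function is the set of all regular germs equivalent to a given regular germ (the function generated by that germ), and its elements are called its germs. A point $b\in\mathbb S^2$ is a singular point of a regular germ $f_a$ if there is a path $\gamma:[0,1]\to\mathbb S^2$ with $\gamma(0)=a$, $\gamma(1)=b$ such that $f_a$ has no analytic continuation along $\gamma$ but has one along $\gamma|_{[0,\tau]}$ for every $0\le\tau<1$. A multivalued analytic function is an $\mathcal S$-function if each of its germs has at most countably many singular points. Derivatives are taken with respect to the coordinate $x$ of $\mathbb C$. The class $\mathcal S$ of all $\mathcal S$-functions is stable under the following operations, where an operation on multivalued functions means: choose any point $a\in\mathbb S^2$ and any germs at $a$ of the given functions (in the case of composition $g\circ f$: a germ $f_a$ of $f$ at $a$ and a germ of $g$ at the point $f_a(a)$), apply the operation to these germs, and take the multivalued function generated by any resulting regular germ at $a$. 1. Differentiation: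 if $f\in\mathcal S$, then $f'\in\mathcal S$. 2. Integration: if $f\in\mathcal S$ and $g'=f$, then $g\in\mathcal S$. 3. Composition: if $g,f\in\mathcal S$, then $g\circ f\in\mathcal S$. 4. Meromorphic operations: if $f_1,\dots,f_n\in\mathcal S$, $F$ is a meromorphic function on $\mathbb C^n$ (locally a quotient of holomorphic functions, with denominator not identically zero), and $f=F(f_1,\dots,f_n)$, then $f\in\mathcal S$. Here $f=F(f_1,\dots,f_n)$ for germs at $a$ means that for all $z\ne a$ close to $a$ the function $F$ is holomorphic at $(f_1(z),\dots,f_n(z))$ and has the value $f(z)$ there. 5. Solving algebraic equations: if $f_1,\dots,f_n\in\mathcal S$ and $f^n+f_1f^{n-1}+\dots+f_n=0$, then $f\in\mathcal S$. 6. Solving linear differential equations: if $f_1,\dots,f_n\in\mathcal S$ and $f^{(n)}+f_1f^{(n-1)}+\dots+f_nf=0$, then $f\in\mathcal S$. -/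

import Mathlib

noncomputable section

open Filter Topology OnePoint

namespace SFun

/-- The Riemann sphere, as the one-point compactification of the complex line. -/
abbrev Sphere : Type := OnePoint ℂ

/-- The inverse `w ↦ 1 / w` of the local coordinate at infinity. -/
def inftyChart (w : ℂ) : Sphere :=
  if w = 0 then ∞ else ((w⁻¹ : ℂ) : Sphere)

/-- A `ℂ`-valued function is holomorphic at a point of the sphere: the coordinate is `z` at finite
points and `1 / z` at infinity. -/
def HolomorphicAt (F : Sphere → ℂ) : Sphere → Prop
  | ∞ => AnalyticAt ℂ (fun w : ℂ => F (inftyChart w)) 0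
  | (z : ℂ) => AnalyticAt ℂ (fun w : ℂ => F (w : Sphere)) z

theorem HolomorphicAt.continuousAt {F : Sphere → ℂ} {a : Sphere} (h : HolomorphicAt F a) :
    ContinuousAt F a := by
  induction a using OnePoint.rec with
  | infty =>
    have h0 : ContinuousAt (fun w : ℂ => F (inftyChart w)) 0 := AnalyticAt.continuousAt h
    rw [OnePoint.continuousAt_infty']
    have h1 : Tendsto (fun w : ℂ => w⁻¹) (coclosedCompact ℂ) (𝓝 0) := by
      rw [coclosedCompact_eq_cocompact, ← Metric.cobounded_eq_cocompact]
      exact Filter.tendsto_inv₀_cobounded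
    have h2 : Tendsto (fun z : ℂ => F (inftyChart z⁻¹)) (coclosedCompact ℂ) (𝓝 (F ∞)) := by
      have := h0.tendsto.comp h1
      simp only [inftyChart, if_pos] at this ⊢
      exact this
    refine h2.congr' ?_
    have h3 : ∀ᶠ z : ℂ in coclosedCompact ℂ, z ≠ 0 := by
      rw [coclosedCompact_eq_cocompact]
      exact (isCompact_singleton (x := (0 : ℂ))).compl_mem_cocompact
    filter_upwards [h3] with z hz
    simp [inftyChart, hz]
  | coe z =>
    rw [OnePoint.continuousAt_coe]
    exact AnalyticAt.continuousAt h

/-- The ring of regular germs at the point `a` of the sphere. -/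
def RegularGermAt (a : Sphere) : Subring ((𝓝 a).Germ ℂ) where
  carrier := {φ | ∃ F : Sphere → ℂ, HolomorphicAt F a ∧ φ = (F : (𝓝 a).Germ ℂ)}
  zero_mem' := ⟨fun _ => 0, by
    induction a using OnePoint.rec <;> exact analyticAt_const, rfl⟩
  one_mem' := ⟨fun _ => 1, by
    induction a using OnePoint.rec <;> exact analyticAt_const, rfl⟩
  add_mem' := by
    rintro _ _ ⟨F, hF, rfl⟩ ⟨G, hG, rfl⟩
    refine ⟨fun p => F p + G p, ?_, rfl⟩
    induction a using OnePoint.rec <;> exact AnalyticAt.fun_add hF hG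
  mul_mem' := by
    rintro _ _ ⟨F, hF, rfl⟩ ⟨G, hG, rfl⟩
    refine ⟨fun p => F p * G p, ?_, rfl⟩
    induction a using OnePoint.rec <;> exact AnalyticAt.fun_mul hF hG
  neg_mem' := by
    rintro _ ⟨F, hF, rfl⟩
    refine ⟨fun p => - F p, ?_, rfl⟩
    induction a using OnePoint.rec <;> exact AnalyticAt.fun_neg hF

/-- A regular germ at some point of the sphere. -/
abbrev RegularGerm : Type := Σ a : Sphere, RegularGermAt a

/-- `Φ` is an analytic continuation of the germ `φ` along the path `γ` restricted to `[0, τ]`: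
`Φ t` is a regular germ at `γ t`, and near each time all `Φ s` are germs of one function. -/
structure IsContinuation (φ : RegularGerm) (γ : unitInterval → Sphere) (τ : unitInterval)
    (Φ : unitInterval → RegularGerm) : Prop where
  start : Φ 0 = φ
  base : ∀ t ≤ τ, (Φ t).1 = γ t
  coherent : ∀ t ≤ τ, ∃ F : Sphere → ℂ, ∀ᶠ s in 𝓝[Set.Iic τ] t,
    ((Φ s).2 : (𝓝 (Φ s).1).Germ ℂ) = (F : (𝓝 (Φ s).1).Germ ℂ)

/-- `ψ` is obtained from `φ` by analytic continuation along some path. -/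
def Equivalent (φ ψ : RegularGerm) : Prop :=
  ∃ (γ : Path φ.1 ψ.1) (Φ : unitInterval → RegularGerm), IsContinuation φ γ 1 Φ ∧ Φ 1 = ψ

/-- The set of singular points of a regular germ. -/
def singularSet (φ : RegularGerm) : Set Sphere :=
  {b | ∃ γ : Path φ.1 b, (¬ ∃ Φ, IsContinuation φ γ 1 Φ) ∧
    ∀ τ : unitInterval, τ < 1 → ∃ Φ, IsContinuation φ γ τ Φ}

def IsSGerm (φ : RegularGerm) : Prop := (singularSet φ).Countable

/-- The set of all regular germs of the multivalued function generated by a germ. -/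
def germsGeneratedBy (φ : RegularGerm) : Set RegularGerm := {ψ | Equivalent φ ψ}

/-- A multivalued analytic function on the sphere: the set of all regular germs equivalent to one
regular germ. -/
structure MultivaluedFunction where
  germs : Set RegularGerm
  exists_generator : ∃ φ, germs = germsGeneratedBy φ

/-- The multivalued function generated by a germ. -/
def generatedBy {a : Sphere} (φ : RegularGermAt a) : MultivaluedFunction :=
  ⟨germsGeneratedBy ⟨a, φ⟩, ⟨a, φ⟩, rfl⟩

/-- `φ` is a regular germ of the multivalued function `f` at the point `a`. -/
def MultivaluedFunction.HasGerm (f : MultivaluedFunction) {a : Sphere} (φ : RegularGermAt a) :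
    Prop :=
  (⟨a, φ⟩ : RegularGerm) ∈ f.germs

def IsSFunction (f : MultivaluedFunction) : Prop := ∀ φ ∈ f.germs, IsSGerm φ

/-- The derivative with respect to the coordinate `z` of `ℂ`. At infinity, in the coordinate
`w = 1 / z`, it is `- w ^ 2 * (d / dw)`, so the derivative of a holomorphic function vanishes. -/
def sphereDeriv (F : Sphere → ℂ) : Sphere → ℂ
  | ∞ => 0
  | (z : ℂ) => deriv (fun w : ℂ => F (w : Sphere)) z

theorem sphereDeriv_congr {a : Sphere} {F G : Sphere → ℂ} (h : F =ᶠ[𝓝 a] G) :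
    sphereDeriv F =ᶠ[𝓝 a] sphereDeriv G := by
  filter_upwards [eventually_eventually_nhds.2 h] with p hp
  induction p using OnePoint.rec with
  | infty => rfl
  | coe z =>
    have h1 : ∀ᶠ w : ℂ in 𝓝 z, F (w : Sphere) = G (w : Sphere) :=
      (OnePoint.continuous_coe.tendsto z).eventually hp
    exact Filter.EventuallyEq.deriv_eq h1

theorem HolomorphicAt.sphereDeriv {F : Sphere → ℂ} {a : Sphere} (h : HolomorphicAt F a) :
    HolomorphicAt (sphereDeriv F) a := by
  induction a using OnePoint.rec with
  | coe z => exact AnalyticAt.deriv h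
  | infty =>
    have h0 : AnalyticAt ℂ (fun w : ℂ => F (inftyChart w)) 0 := h
    have h1 : AnalyticAt ℂ
        (fun w : ℂ => - w ^ 2 * deriv (fun u : ℂ => F (inftyChart u)) w) 0 :=
      ((analyticAt_id.pow 2).neg).mul h0.deriv
    refine AnalyticAt.congr h1 ?_
    filter_upwards [h0.eventually_analyticAt] with w hw
    by_cases hw0 : w = 0
    · subst hw0
      simp [inftyChart, SFun.sphereDeriv]
    · have hc : inftyChart w = ((w⁻¹ : ℂ) : Sphere) := if_neg hw0
      have hd : HasDerivAt (fun u : ℂ => F (inftyChart u))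
          (deriv (fun u : ℂ => F (inftyChart u)) w) (w⁻¹)⁻¹ := by
        rw [inv_inv]; exact hw.differentiableAt.hasDerivAt
      have hi := hasDerivAt_inv (inv_ne_zero hw0)
      have hcomp := hd.comp w⁻¹ hi
      have he : (fun u : ℂ => F (u : Sphere)) =ᶠ[𝓝 w⁻¹]
          ((fun u : ℂ => F (inftyChart u)) ∘ fun u => u⁻¹) := by
        filter_upwards [eventually_ne_nhds (inv_ne_zero hw0)] with u hu
        simp [inftyChart, hu]
      have hfin := (hcomp.congr_of_eventuallyEq he).deriv
      rw [hc]
      change _ = deriv (fun u : ℂ => F (u : Sphere)) w⁻¹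
      rw [hfin]
      field_simp

/-- The derivative of a germ. -/
def germDeriv {a : Sphere} (φ : (𝓝 a).Germ ℂ) : (𝓝 a).Germ ℂ :=
  Filter.Germ.map' sphereDeriv (fun _ _ h => sphereDeriv_congr h) φ

/-- The derivative of a regular germ, with respect to the coordinate of `ℂ`. -/
def derivGerm {a : Sphere} (φ : RegularGermAt a) : RegularGermAt a :=
  ⟨germDeriv φ.1, by
    obtain ⟨_, F, hF, rfl⟩ := φ
    exact ⟨_, hF.sphereDeriv, rfl⟩⟩

/-- The value of a regular germ at its base point. -/
def germValue {a : Sphere} (φ : RegularGermAt a) : ℂ :=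
  Filter.Germ.value φ.1

theorem tendsto_coe_germ {a : Sphere} (φ : RegularGermAt a) :
    (φ.1.map ((↑) : ℂ → Sphere)).Tendsto (𝓝 ((germValue φ : ℂ) : Sphere)) := by
  obtain ⟨_, F, hF, rfl⟩ := φ
  exact (OnePoint.continuous_coe.tendsto (F a)).comp hF.continuousAt

/-- The composition `ψ ∘ φ` of a regular germ `φ` at `a` with a regular germ `ψ` at the value of
`φ` at `a`. -/
def compGerm {a : Sphere} (φ : RegularGermAt a)
    (ψ : RegularGermAt ((germValue φ : ℂ) : Sphere)) : RegularGermAt a :=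
  ⟨ψ.1.compTendsto' (φ.1.map ((↑) : ℂ → Sphere)) (tendsto_coe_germ φ), by
    obtain ⟨_, F, hF, rfl⟩ := φ
    obtain ⟨_, G, hG, rfl⟩ := ψ
    refine ⟨fun p => G (F p : Sphere), ?_, rfl⟩
    have hG' : AnalyticAt ℂ (fun w : ℂ => G (w : Sphere)) (F a) := hG
    induction a using OnePoint.rec with
    | coe z => exact AnalyticAt.fun_comp (f := fun w : ℂ => F (w : Sphere)) hG' hF
    | infty =>
      have hF' : AnalyticAt ℂ (fun w : ℂ => F (inftyChart w)) 0 := hF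
      have hv : F (inftyChart 0) = F ∞ := by simp [inftyChart]
      rw [← hv] at hG'
      exact AnalyticAt.fun_comp (f := fun w : ℂ => F (inftyChart w)) hG' hF'⟩

/-- `F` represents a meromorphic function on `ℂⁿ`: near every point it is a quotient of two
holomorphic functions, the denominator not vanishing identically. Values of `F` on thin sets
where denominators vanish are irrelevant. -/
def IsMeromorphic {n : ℕ} (F : (Fin n → ℂ) → ℂ) : Prop :=
  ∀ p, ∃ G H : (Fin n → ℂ) → ℂ, AnalyticAt ℂ G p ∧ AnalyticAt ℂ H p ∧
    (¬ ∀ᶠ x in 𝓝 p, H x = 0) ∧ ∀ᶠ x in 𝓝 p, H x ≠ 0 → F x = G x / H x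

/-- The meromorphic function represented by `F` is holomorphic at `p` and has the value `c`
there: off the zero set of a nontrivial holomorphic function, `F` coincides near `p` with a
function `G` that is holomorphic at `p` with `G p = c`. -/
def HasMeromorphicValue {n : ℕ} (F : (Fin n → ℂ) → ℂ) (p : Fin n → ℂ) (c : ℂ) : Prop :=
  ∃ G H : (Fin n → ℂ) → ℂ, AnalyticAt ℂ G p ∧ AnalyticAt ℂ H p ∧
    (¬ ∀ᶠ x in 𝓝 p, H x = 0) ∧ (∀ᶠ x in 𝓝 p, H x ≠ 0 → F x = G x) ∧ G p = c

/-- The regular germ `χ` at `a` is `F(φ₁, …, φₙ)`: at every point `z ≠ a` close to `a`, the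
meromorphic function `F` is holomorphic at `(φ₁(z), …, φₙ(z))` and has the value `χ(z)` there. -/
def IsMeromorphicImage {n : ℕ} (F : (Fin n → ℂ) → ℂ) {a : Sphere}
    (φ : Fin n → RegularGermAt a) (χ : RegularGermAt a) : Prop :=
  ∃ (f : Fin n → Sphere → ℂ) (k : Sphere → ℂ),
    (∀ i, (φ i : (𝓝 a).Germ ℂ) = (f i : (𝓝 a).Germ ℂ)) ∧
    (χ : (𝓝 a).Germ ℂ) = (k : (𝓝 a).Germ ℂ) ∧
    ∀ᶠ z in 𝓝[≠] a, HasMeromorphicValue F (fun i => f i z) (k z)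

/-! Operations on multivalued functions. The result of an operation is a set of multivalued
functions: choose a point, choose germs of the given functions there, apply the operation to the
germs, and take the multivalued function generated by the resulting germ. -/

/-- `h` is a derivative of `f`. -/
def IsDerivativeOf (h f : MultivaluedFunction) : Prop :=
  ∃ (a : Sphere) (φ : RegularGermAt a), f.HasGerm φ ∧ h = generatedBy (derivGerm φ)

/-- `h` is an integral of `f`. -/
def IsIntegralOf (h f : MultivaluedFunction) : Prop :=
  ∃ (a : Sphere) (φ χ : RegularGermAt a), f.HasGerm φ ∧ derivGerm χ = φ ∧ h = generatedBy χ

/-- `h` is representable as the composition `g ∘ f`. -/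
def IsCompositionOf (h g f : MultivaluedFunction) : Prop :=
  ∃ (a : Sphere) (φ : RegularGermAt a) (ψ : RegularGermAt ((germValue φ : ℂ) : Sphere)),
    f.HasGerm φ ∧ g.HasGerm ψ ∧ h = generatedBy (compGerm φ ψ)

/-- `h` is representable as `F(f₁, …, fₙ)`. -/
def IsMeromorphicOperationOf {n : ℕ} (h : MultivaluedFunction) (F : (Fin n → ℂ) → ℂ)
    (f : Fin n → MultivaluedFunction) : Prop :=
  ∃ (a : Sphere) (φ : Fin n → RegularGermAt a) (χ : RegularGermAt a),
    (∀ i, (f i).HasGerm (φ i)) ∧ IsMeromorphicImage F φ χ ∧ h = generatedBy χ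

/-- `h` solves the equation `hⁿ + f₁ hⁿ⁻¹ + ⋯ + fₙ = 0`; here `fᵢ₊₁` is `f i`. -/
def IsAlgebraicSolutionOf {n : ℕ} (h : MultivaluedFunction)
    (f : Fin n → MultivaluedFunction) : Prop :=
  ∃ (a : Sphere) (φ : Fin n → RegularGermAt a) (χ : RegularGermAt a),
    (∀ i, (f i).HasGerm (φ i)) ∧
    χ ^ n + ∑ i : Fin n, φ i * χ ^ (n - (i + 1 : ℕ)) = 0 ∧ h = generatedBy χ

/-- `h` solves the equation `h⁽ⁿ⁾ + f₁ h⁽ⁿ⁻¹⁾ + ⋯ + fₙ h = 0`; here `fᵢ₊₁` is `f i`. -/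
def IsLinearODESolutionOf {n : ℕ} (h : MultivaluedFunction)
    (f : Fin n → MultivaluedFunction) : Prop :=
  ∃ (a : Sphere) (φ : Fin n → RegularGermAt a) (χ : RegularGermAt a),
    (∀ i, (f i).HasGerm (φ i)) ∧
    derivGerm^[n] χ +
      ∑ i : Fin n, φ i * derivGerm^[n - (i + 1 : ℕ)] χ = 0 ∧ h = generatedBy χ

end SFun

end

open SFun

noncomputable section

open Filter Topology OnePoint

namespace SFun

/-! ### Charts of the sphere -/

/-! Continuation is treated as path lifting. Regular germs form an étalé space over the sphere,
whose local sheets are the germs of one holomorphic function. A continuation of a germ along a path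
is exactly a continuous lift (`isContinuation_iff`), and lifts are unique (`lift_unique`).

The heart of the proof is a reformulation of the class. A germ continues along every path that
misses its singular set (`avoiding_singularSet`). Conversely, if a germ based outside a countable
set `A` continues along every path that misses `A`, then all its singular points lie in `A`
(`singularSet_subset_of_avoiding`). The converse is not formal: a path that ends at a bad point `b`
outside `A` may itself cross `A`. It is replaced by a path that misses `A` and reaches `b` through
the same nested connected sets of germs. This is possible because removing countably many fibres
does not disconnect a connected open set of germs (`joinedIn_diff_countable`). A base point in `A`
is moved to a generic nearby one (`isSGerm_of_eventually`). Each operation thus only needs a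
countable set off which its result continues.

New forbidden points are counted by the Poincaré–Volterra theorem (`exists_countable_reps`): the
continuations of one germ are germs of countably many functions, so a condition that is isolated on
each branch occurs at countably many points. Identities between germs survive continuation
(`permanence_eq`), and this gives the following. - A derivative of a lift is a lift. A primitive
extends wherever its derivative does, except perhaps to `∞`. - For a composition, one also forbids
the points where a branch of the inner function takes a value singular for the outer one. -
Solutions of a linear equation with holomorphic coefficients extend to a disc that does not depend
on the solution, by Picard iteration. - An algebraic germ is a root of a polynomial coprime to its
derivative. Off the zeros of the leading coefficient and of the Bezout constant all roots are
simple, hence locally finitely many analytic functions. - For a meromorphic `F`, the key is that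
along an analytic curve the points where `F` is not holomorphic are either isolated or fill a
punctured neighbourhood (`eventually_mem_regularSet_or`). A continuity principle with discs proves
this without any divisibility theory for power series. -/

@[simp] theorem inftyChart_zero : inftyChart 0 = ∞ := by simp [inftyChart]

theorem inftyChart_of_ne {w : ℂ} (h : w ≠ 0) : inftyChart w = ((w⁻¹ : ℂ) : Sphere) := by
  simp [inftyChart, h]

/-- The inversion `z ↦ 1 / z` of the sphere. -/
def sphereInv : Sphere → Sphere
  | ∞ => ((0 : ℂ) : Sphere)
  | (z : ℂ) => inftyChart z

@[simp] theorem sphereInv_infty : sphereInv ∞ = ((0 : ℂ) : Sphere) := rfl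

@[simp] theorem sphereInv_coe (z : ℂ) : sphereInv (z : Sphere) = inftyChart z := rfl

theorem sphereInv_involutive : Function.Involutive sphereInv := by
  intro p
  induction p using OnePoint.rec with
  | infty => simp
  | coe z =>
    by_cases hz : z = 0
    · simp [hz]
    · simp [inftyChart_of_ne hz, inftyChart_of_ne (inv_ne_zero hz)]

theorem tendsto_inv_coclosedCompact : Tendsto (fun w : ℂ => w⁻¹) (coclosedCompact ℂ) (𝓝 0) := by
  rw [coclosedCompact_eq_cocompact, ← Metric.cobounded_eq_cocompact]
  exact Filter.tendsto_inv₀_cobounded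

theorem continuous_sphereInv : Continuous sphereInv := by
  rw [continuous_iff_continuousAt]
  intro p
  induction p using OnePoint.rec with
  | infty =>
    rw [OnePoint.continuousAt_infty']
    have h := (OnePoint.continuous_coe.tendsto (0 : ℂ)).comp tendsto_inv_coclosedCompact
    refine h.congr' ?_
    have h3 : ∀ᶠ z : ℂ in coclosedCompact ℂ, z ≠ 0 := by
      rw [coclosedCompact_eq_cocompact]
      exact (isCompact_singleton (x := (0 : ℂ))).compl_mem_cocompact
    filter_upwards [h3] with z hz
    simp [inftyChart_of_ne hz]
  | coe z =>
    rw [OnePoint.continuousAt_coe]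
    by_cases hz : z = 0
    · subst hz
      rw [continuousAt_iff_punctured_nhds]
      have h1 : Tendsto (fun w : ℂ => w⁻¹) (𝓝[≠] 0) (coclosedCompact ℂ) := by
        rw [coclosedCompact_eq_cocompact, ← Metric.cobounded_eq_cocompact]
        exact Filter.tendsto_inv₀_nhdsNE_zero
      have h2 := OnePoint.tendsto_coe_infty.comp h1
      simp only [Function.comp_apply, sphereInv_coe, inftyChart_zero]
      refine h2.congr' ?_
      filter_upwards [self_mem_nhdsWithin] with w hw
      simp [inftyChart_of_ne hw]
    · have h : ContinuousAt (fun w : ℂ => ((w⁻¹ : ℂ) : Sphere)) z :=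
        OnePoint.continuous_coe.continuousAt.comp (continuousAt_inv₀ hz)
      refine h.congr ?_
      filter_upwards [eventually_ne_nhds hz] with w hw
      simp [inftyChart_of_ne hw]

/-- The inversion of the sphere, as a homeomorphism. -/
def sphereInvHomeo : Sphere ≃ₜ Sphere where
  toEquiv := sphereInv_involutive.toPerm
  continuous_toFun := continuous_sphereInv
  continuous_invFun := continuous_sphereInv

theorem isOpenEmbedding_inftyChart : IsOpenEmbedding inftyChart :=
  sphereInvHomeo.isOpenEmbedding.comp OnePoint.isOpenEmbedding_coe

/-- A chart of the sphere centred at a given point. -/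
def chart : Sphere → ℂ → Sphere
  | ∞ => inftyChart
  | (z : ℂ) => fun w => ((z + w : ℂ) : Sphere)

theorem chart_infty : chart ∞ = inftyChart := rfl

theorem chart_coe (z w : ℂ) : chart (z : Sphere) w = ((z + w : ℂ) : Sphere) := rfl

@[simp] theorem chart_zero (a : Sphere) : chart a 0 = a := by
  induction a using OnePoint.rec <;> simp [chart_infty, chart_coe]

theorem isOpenEmbedding_chart (a : Sphere) : IsOpenEmbedding (chart a) := by
  induction a using OnePoint.rec with
  | infty => exact isOpenEmbedding_inftyChart
  | coe z => exact OnePoint.isOpenEmbedding_coe.comp (Homeomorph.addLeft z).isOpenEmbedding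

theorem map_chart_nhds (a : Sphere) (w : ℂ) : map (chart a) (𝓝 w) = 𝓝 (chart a w) :=
  (isOpenEmbedding_chart a).map_nhds_eq w

theorem eventually_chart_iff {a : Sphere} {w : ℂ} {p : Sphere → Prop} :
    (∀ᶠ z in 𝓝 (chart a w), p z) ↔ ∀ᶠ u in 𝓝 w, p (chart a u) := by
  rw [← map_chart_nhds, eventually_map]

theorem eventually_nhds_iff_chart {a : Sphere} {p : Sphere → Prop} :
    (∀ᶠ z in 𝓝 a, p z) ↔ ∀ᶠ u in 𝓝 0, p (chart a u) := by
  rw [← eventually_chart_iff, chart_zero]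

theorem eventually_nhdsNE_iff_chart {a : Sphere} {p : Sphere → Prop} :
    (∀ᶠ z in 𝓝[≠] a, p z) ↔ ∀ᶠ u in 𝓝[≠] 0, p (chart a u) := by
  rw [eventually_nhdsWithin_iff, eventually_nhdsWithin_iff, eventually_nhds_iff_chart]
  refine eventually_congr (Eventually.of_forall fun u => ?_)
  have : chart a u = a ↔ u = 0 :=
    ⟨fun h => (isOpenEmbedding_chart a).injective (h.trans (chart_zero a).symm),
      fun h => by simp [h]⟩
  simp [this]

theorem holomorphicAt_coe_iff {F : Sphere → ℂ} {z : ℂ} :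
    HolomorphicAt F (z : Sphere) ↔ AnalyticAt ℂ (fun w : ℂ => F (w : Sphere)) z := Iff.rfl

/-- The transition maps are holomorphic, so holomorphy can be tested at every point of a chart and
not only at its centre. Statements about all nearby points thereby become statements about functions
on `ℂ`. -/
theorem holomorphicAt_chart_iff {F : Sphere → ℂ} {a : Sphere} {w : ℂ} :
    HolomorphicAt F (chart a w) ↔ AnalyticAt ℂ (fun u => F (chart a u)) w := by
  induction a using OnePoint.rec with
  | infty =>
    by_cases hw : w = 0
    · subst hw
      rw [chart_infty, inftyChart_zero]
      rfl
    · rw [chart_infty, inftyChart_of_ne hw, holomorphicAt_coe_iff]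
      constructor
      · intro h
        have := AnalyticAt.fun_comp (f := fun u : ℂ => u⁻¹) h (analyticAt_inv hw)
        refine this.congr ?_
        filter_upwards [eventually_ne_nhds hw] with u hu
        simp [inftyChart_of_ne hu]
      · intro h
        rw [← inv_inv w] at h
        have hw' := inv_ne_zero hw
        have := AnalyticAt.fun_comp (f := fun u : ℂ => u⁻¹) h (analyticAt_inv hw')
        refine this.congr ?_
        filter_upwards [eventually_ne_nhds hw'] with u hu
        simp [inftyChart_of_ne (inv_ne_zero hu)]
  | coe z =>
    rw [chart_coe, holomorphicAt_coe_iff]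
    constructor
    · intro h
      exact AnalyticAt.fun_comp (f := fun u : ℂ => z + u) h (by fun_prop)
    · intro h
      have h' : AnalyticAt ℂ (fun u => F (chart (z : Sphere) u)) ((z + w) - z) := by
        simpa using h
      have := AnalyticAt.fun_comp (f := fun u : ℂ => u - z) h' (by fun_prop)
      refine this.congr (Eventually.of_forall fun u => ?_)
      simp [chart_coe]

theorem holomorphicAt_iff_chart {F : Sphere → ℂ} {a : Sphere} :
    HolomorphicAt F a ↔ AnalyticAt ℂ (fun u => F (chart a u)) 0 := by
  rw [← holomorphicAt_chart_iff, chart_zero]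

/-! ### Holomorphic functions on the sphere -/

namespace HolomorphicAt

variable {F G : Sphere → ℂ} {a : Sphere}

theorem congr (h : HolomorphicAt F a) (hFG : F =ᶠ[𝓝 a] G) : HolomorphicAt G a := by
  rw [holomorphicAt_iff_chart] at *
  exact AnalyticAt.congr h (eventually_nhds_iff_chart.1 hFG)

theorem eventually (h : HolomorphicAt F a) : ∀ᶠ z in 𝓝 a, HolomorphicAt F z := by
  rw [holomorphicAt_iff_chart] at h
  rw [eventually_nhds_iff_chart]
  filter_upwards [h.eventually_analyticAt] with w hw
  rwa [holomorphicAt_chart_iff]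

theorem const (c : ℂ) : HolomorphicAt (fun _ => c) a := by
  rw [holomorphicAt_iff_chart]; exact analyticAt_const

theorem add (hF : HolomorphicAt F a) (hG : HolomorphicAt G a) :
    HolomorphicAt (fun z => F z + G z) a := by
  rw [holomorphicAt_iff_chart] at *; exact hF.fun_add hG

theorem sub (hF : HolomorphicAt F a) (hG : HolomorphicAt G a) :
    HolomorphicAt (fun z => F z - G z) a := by
  rw [holomorphicAt_iff_chart] at *; exact hF.fun_sub hG

theorem neg (hF : HolomorphicAt F a) : HolomorphicAt (fun z => - F z) a := by
  rw [holomorphicAt_iff_chart] at *; exact hF.fun_neg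

theorem mul (hF : HolomorphicAt F a) (hG : HolomorphicAt G a) :
    HolomorphicAt (fun z => F z * G z) a := by
  rw [holomorphicAt_iff_chart] at *; exact hF.fun_mul hG

theorem pow (hF : HolomorphicAt F a) (n : ℕ) : HolomorphicAt (fun z => F z ^ n) a := by
  rw [holomorphicAt_iff_chart] at *; exact hF.fun_pow n

theorem sum {ι : Type*} {s : Finset ι} {F : ι → Sphere → ℂ}
    (h : ∀ i ∈ s, HolomorphicAt (F i) a) : HolomorphicAt (fun z => ∑ i ∈ s, F i z) a := by
  rw [holomorphicAt_iff_chart]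
  exact Finset.analyticAt_fun_sum s fun i hi => holomorphicAt_iff_chart.1 (h i hi)

theorem comp_analyticAt {ι : Type*} [Fintype ι] {g : (ι → ℂ) → ℂ} {F : ι → Sphere → ℂ}
    (hg : AnalyticAt ℂ g (fun i => F i a)) (hF : ∀ i, HolomorphicAt (F i) a) :
    HolomorphicAt (fun z => g (fun i => F i z)) a := by
  rw [holomorphicAt_iff_chart]
  have h : AnalyticAt ℂ (fun u i => F i (chart a u)) 0 :=
    AnalyticAt.pi fun i => holomorphicAt_iff_chart.1 (hF i)
  exact AnalyticAt.fun_comp (f := fun u i => F i (chart a u)) (by simpa using hg) h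

theorem comp_coe (hG : HolomorphicAt G ((F a : ℂ) : Sphere)) (hF : HolomorphicAt F a) :
    HolomorphicAt (fun z => G ((F z : ℂ) : Sphere)) a := by
  rw [holomorphicAt_iff_chart] at *
  rw [← holomorphicAt_iff_chart, holomorphicAt_coe_iff] at hG
  exact AnalyticAt.fun_comp (f := fun u => F (chart a u)) (by simpa using hG) hF

/-- A holomorphic function vanishes identically near a point or has no zeros in a punctured
neighbourhood. -/
theorem eventually_eq_zero_or (h : HolomorphicAt F a) :
    (∀ᶠ z in 𝓝 a, F z = 0) ∨ ∀ᶠ z in 𝓝[≠] a, F z ≠ 0 := by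
  rw [holomorphicAt_iff_chart] at h
  rw [eventually_nhds_iff_chart, eventually_nhdsNE_iff_chart]
  exact h.eventually_eq_zero_or_eventually_ne_zero

end HolomorphicAt

theorem nhdsNE_sphere_neBot (a : Sphere) : (𝓝[≠] a).NeBot := by
  rw [neBot_iff]
  intro h
  have h1 : ∀ᶠ z in 𝓝[≠] a, False := by rw [h]; exact eventually_bot
  rw [eventually_nhdsNE_iff_chart] at h1
  exact h1.exists.elim fun _ h => h

/-- A function which is analytic in a chart, transported to the sphere. -/
theorem exists_comp_chart (a : Sphere) (f : ℂ → ℂ) : ∃ F : Sphere → ℂ, ∀ w, F (chart a w) = f w :=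
  ⟨Function.extend (chart a) f 0, fun w => (isOpenEmbedding_chart a).injective.extend_apply f 0 w⟩

/-! ### Coordinate discs -/

/-- The coordinate disc with given centre and radius. -/
def disc (a : Sphere) (r : ℝ) : Set Sphere := chart a '' Metric.ball 0 r

theorem isOpen_disc (a : Sphere) (r : ℝ) : IsOpen (disc a r) :=
  (isOpenEmbedding_chart a).isOpenMap _ Metric.isOpen_ball

theorem isPreconnected_disc (a : Sphere) (r : ℝ) : IsPreconnected (disc a r) :=
  (convex_ball (0 : ℂ) r).isPreconnected.image _ (isOpenEmbedding_chart a).continuous.continuousOn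

theorem mem_disc_self (a : Sphere) {r : ℝ} (hr : 0 < r) : a ∈ disc a r :=
  ⟨0, by simpa using hr, chart_zero a⟩

theorem disc_mem_nhds (a : Sphere) {r : ℝ} (hr : 0 < r) : disc a r ∈ 𝓝 a :=
  (isOpen_disc a r).mem_nhds (mem_disc_self a hr)

theorem disc_mono (a : Sphere) {r s : ℝ} (h : r ≤ s) : disc a r ⊆ disc a s :=
  Set.image_mono (Metric.ball_subset_ball h)

theorem exists_disc_subset {a : Sphere} {U : Set Sphere} (hU : U ∈ 𝓝 a) :
    ∃ r > 0, disc a r ⊆ U := by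
  have h : ∀ᶠ u in 𝓝 0, chart a u ∈ U := eventually_nhds_iff_chart.1 hU
  obtain ⟨r, hr, h⟩ := Metric.eventually_nhds_iff_ball.1 h
  exact ⟨r, hr, by rintro _ ⟨w, hw, rfl⟩; exact h w hw⟩

/-- The complement of a countable set in a disc of the plane is path connected. -/
theorem isPathConnected_ball_diff_countable {A : Set ℂ} (hA : A.Countable) (c : ℂ) {r : ℝ}
    (hr : 0 < r) : IsPathConnected (Metric.ball c r \ A) := by
  -- The ball is a homeomorphic copy of the whole plane, where the complement of a countable set is
  -- path connected because the real dimension exceeds one.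
  set e := OpenPartialHomeomorph.univBall c r with he
  have hsrc : e.source = Set.univ := OpenPartialHomeomorph.univBall_source c r
  have htgt : e.target = Metric.ball c r := OpenPartialHomeomorph.univBall_target c hr
  have hinj : Function.Injective e := by
    have := e.injOn
    rw [hsrc] at this
    exact Set.injOn_univ.1 this
  have hcont : Continuous e := by
    have := e.continuousOn
    rw [hsrc] at this
    exact continuousOn_univ.1 this
  have h1 : IsPathConnected (e ⁻¹' A)ᶜ :=
    (hA.preimage hinj).isPathConnected_compl_of_one_lt_rank (by simp)
  have h2 := h1.image hcont
  convert h2 using 1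
  rw [← htgt, ← e.image_source_eq_target, hsrc]
  ext z
  constructor
  · rintro ⟨⟨w, -, rfl⟩, h⟩
    exact ⟨w, h, rfl⟩
  · rintro ⟨w, h, rfl⟩
    exact ⟨⟨w, trivial, rfl⟩, h⟩

theorem isPathConnected_disc_diff_countable {A : Set Sphere} (hA : A.Countable) (a : Sphere)
    {r : ℝ} (hr : 0 < r) : IsPathConnected (disc a r \ A) := by
  have hinj := (isOpenEmbedding_chart a).injective
  have h := (isPathConnected_ball_diff_countable (hA.preimage hinj) 0 hr).image
    (isOpenEmbedding_chart a).continuous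
  convert h using 1
  ext z
  constructor
  · rintro ⟨⟨w, hw, rfl⟩, h⟩
    exact ⟨w, ⟨hw, h⟩, rfl⟩
  · rintro ⟨w, ⟨hw, h⟩, rfl⟩
    exact ⟨⟨w, hw, rfl⟩, h⟩

theorem exists_mem_not_mem_countable {A U : Set Sphere} (hA : A.Countable) {a : Sphere}
    (hU : U ∈ 𝓝 a) : ∃ z ∈ U, z ∉ A := by
  obtain ⟨r, hr, h⟩ := exists_disc_subset hU
  obtain ⟨z, hz⟩ := (isPathConnected_disc_diff_countable hA a hr).nonempty
  exact ⟨z, h hz.1, hz.2⟩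

/-- Two open copies of `ℂ` cover the sphere. Second countability makes discrete subsets countable
and provides the countable basis for the Poincaré–Volterra argument. -/
instance : SecondCountableTopology Sphere := by
  let U : Bool → Set Sphere := fun b => bif b then Set.range ((↑) : ℂ → Sphere)
    else Set.range inftyChart
  have h1 : SecondCountableTopology (Set.range ((↑) : ℂ → Sphere)) :=
    OnePoint.isOpenEmbedding_coe.toIsEmbedding.toHomeomorph.symm.secondCountableTopology
  have h2 : SecondCountableTopology (Set.range inftyChart) :=
    isOpenEmbedding_inftyChart.toIsEmbedding.toHomeomorph.symm.secondCountableTopology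
  have : ∀ b, SecondCountableTopology (U b) := by rintro (_ | _) <;> assumption
  refine TopologicalSpace.secondCountableTopology_of_countable_cover (U := U) ?_ ?_
  · rintro (_ | _)
    · exact isOpenEmbedding_inftyChart.isOpen_range
    · exact OnePoint.isOpenEmbedding_coe.isOpen_range
  · rw [Set.eq_univ_iff_forall]
    intro p
    rw [Set.mem_iUnion]
    induction p using OnePoint.rec with
    | infty => exact ⟨false, 0, by simp⟩
    | coe z => exact ⟨true, z, rfl⟩

/-- The sphere has a countable basis consisting of connected sets. -/
theorem exists_countable_preconnected_basis : ∃ 𝔅 : Set (Set Sphere), 𝔅.Countable ∧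
    (∀ V ∈ 𝔅, IsOpen V ∧ IsPreconnected V) ∧
    ∀ (a : Sphere) (U : Set Sphere), U ∈ 𝓝 a → ∃ V ∈ 𝔅, a ∈ V ∧ V ⊆ U := by
  have hb : TopologicalSpace.IsTopologicalBasis
      {V : Set Sphere | IsOpen V ∧ IsPreconnected V} := by
    refine TopologicalSpace.isTopologicalBasis_of_isOpen_of_nhds (fun V hV => hV.1) ?_
    intro a U haU hU
    obtain ⟨r, hr, h⟩ := exists_disc_subset (hU.mem_nhds haU)
    exact ⟨disc a r, ⟨isOpen_disc a r, isPreconnected_disc a r⟩, mem_disc_self a hr, h⟩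
  obtain ⟨𝔅, h1, h2, h3⟩ := hb.exists_countable
  exact ⟨𝔅, h2, fun V hV => h1 hV, fun a U hU => h3.mem_nhds_iff.1 hU⟩

/-- A subset of the sphere whose points are isolated is countable. -/
theorem countable_of_isolated {S : Set Sphere} (h : ∀ p ∈ S, ∀ᶠ z in 𝓝[≠] p, z ∉ S) :
    S.Countable := by
  have : DiscreteTopology S := by
    rw [discreteTopology_subtype_iff]
    intro p hp
    rw [← disjoint_iff, disjoint_principal_right]
    exact h p hp
  exact Set.countable_coe_iff.1 (TopologicalSpace.separableSpace_iff_countable.1 inferInstance)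

/-! ### The étalé space of germs -/

/-- The germ `ψ` is the germ of the function `F`. -/
def Rep (ψ : RegularGerm) (F : Sphere → ℂ) : Prop :=
  (ψ.2 : (𝓝 ψ.1).Germ ℂ) = (F : (𝓝 ψ.1).Germ ℂ)

/-- The germ at `a` of a function holomorphic at `a`. -/
def germAt (F : Sphere → ℂ) (a : Sphere) (h : HolomorphicAt F a) : RegularGerm :=
  ⟨a, ⟨(F : (𝓝 a).Germ ℂ), F, h, rfl⟩⟩

@[simp] theorem germAt_fst (F : Sphere → ℂ) (a : Sphere) (h : HolomorphicAt F a) :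
    (germAt F a h).1 = a := rfl

theorem rep_germAt (F : Sphere → ℂ) (a : Sphere) (h : HolomorphicAt F a) :
    Rep (germAt F a h) F := rfl

theorem exists_rep (ψ : RegularGerm) : ∃ F, Rep ψ F := by
  obtain ⟨F, -, h⟩ := ψ.2.2
  exact ⟨F, h⟩

/-- A function representing a regular germ. -/
def rep (ψ : RegularGerm) : Sphere → ℂ := (exists_rep ψ).choose

theorem rep_spec (ψ : RegularGerm) : Rep ψ (rep ψ) := (exists_rep ψ).choose_spec

namespace Rep

variable {ψ χ : RegularGerm} {F G : Sphere → ℂ}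

theorem eventuallyEq (hF : Rep ψ F) (hG : Rep ψ G) : F =ᶠ[𝓝 ψ.1] G :=
  Filter.Germ.coe_eq.1 (hF.symm.trans hG)

theorem congr (hF : Rep ψ F) (h : F =ᶠ[𝓝 ψ.1] G) : Rep ψ G :=
  hF.trans (Filter.Germ.coe_eq.2 h)

theorem holomorphicAt (hF : Rep ψ F) : HolomorphicAt F ψ.1 := by
  obtain ⟨G, hG, h⟩ := ψ.2.2
  exact hG.congr (eventuallyEq h hF)

theorem ext (h : ψ.1 = χ.1) (h1 : Rep ψ F) (h2 : Rep χ F) : ψ = χ := by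
  obtain ⟨a, ψ⟩ := ψ
  obtain ⟨b, χ⟩ := χ
  obtain rfl : a = b := h
  have : ψ = χ := Subtype.ext (Eq.trans (show (ψ : (𝓝 a).Germ ℂ) = F from h1) h2.symm)
  rw [this]

theorem germAt_eq (h : Rep ψ F) : germAt F ψ.1 h.holomorphicAt = ψ :=
  ext rfl (rep_germAt _ _ _) h

end Rep

theorem holomorphicAt_rep (ψ : RegularGerm) : HolomorphicAt (rep ψ) ψ.1 :=
  (rep_spec ψ).holomorphicAt

theorem rep_germAt_eventuallyEq {F : Sphere → ℂ} {a : Sphere} (h : HolomorphicAt F a) :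
    rep (germAt F a h) =ᶠ[𝓝 a] F :=
  (rep_spec (germAt F a h)).eventuallyEq (rep_germAt F a h)

/-- The neighbourhood filter of a germ in the étalé space. -/
def germNhds (ψ : RegularGerm) : Filter RegularGerm :=
  comap Sigma.fst (𝓝 ψ.1) ⊓ 𝓟 {χ | Rep χ (rep ψ)}

instance : TopologicalSpace RegularGerm := TopologicalSpace.mkOfNhds germNhds

/-- Independence of the chosen representative is what makes the filters `germNhds` satisfy the
axioms of a topology: a germ of `rep ψ` near `ψ` has its own chosen representative, but may be
computed with `rep ψ`. -/
theorem mem_germNhds {ψ : RegularGerm} {F : Sphere → ℂ} (hF : Rep ψ F) {s : Set RegularGerm} :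
    s ∈ germNhds ψ ↔ ∀ᶠ z in 𝓝 ψ.1, ∀ χ : RegularGerm, χ.1 = z → Rep χ F → χ ∈ s := by
  have hr := eventually_eventually_nhds.2 ((rep_spec ψ).eventuallyEq hF)
  rw [germNhds, mem_inf_principal, mem_comap]
  constructor
  · rintro ⟨U, hU, h⟩
    filter_upwards [hU, hr] with z hz hz' χ hχ hχF
    subst hχ
    exact h hz (Rep.congr hχF (EventuallyEq.symm hz'))
  · intro h
    refine ⟨_, h.and hr, ?_⟩
    rintro χ ⟨h1, h2⟩ h3
    exact h1 χ rfl (Rep.congr h3 h2)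

theorem nhds_germ (ψ : RegularGerm) : 𝓝 ψ = germNhds ψ := by
  refine TopologicalSpace.nhds_mkOfNhds germNhds ψ ?_ ?_
  · intro ψ
    refine le_inf ?_ ?_
    · rw [← map_le_iff_le_comap, map_pure]
      exact pure_le_nhds _
    · simpa using rep_spec ψ
  · intro ψ s hs
    rw [mem_germNhds (rep_spec ψ)] at hs
    rw [Filter.Eventually, mem_germNhds (rep_spec ψ)]
    filter_upwards [eventually_eventually_nhds.2 hs] with z hz χ hχ hχψ
    subst hχ
    exact (mem_germNhds hχψ).2 hz

theorem mem_nhds_germ {ψ : RegularGerm} {F : Sphere → ℂ} (hF : Rep ψ F) {s : Set RegularGerm} :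
    s ∈ 𝓝 ψ ↔ ∀ᶠ z in 𝓝 ψ.1, ∀ χ : RegularGerm, χ.1 = z → Rep χ F → χ ∈ s := by
  rw [nhds_germ, mem_germNhds hF]

theorem continuous_base : Continuous (fun ψ : RegularGerm => ψ.1) := by
  rw [continuous_iff_continuousAt]
  intro ψ
  rw [ContinuousAt, nhds_germ]
  exact tendsto_comap.mono_left inf_le_left

theorem Rep.eventually {ψ : RegularGerm} {F : Sphere → ℂ} (hF : Rep ψ F) :
    ∀ᶠ χ in 𝓝 ψ, Rep χ F := by
  rw [Filter.Eventually, mem_nhds_germ hF]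
  exact Eventually.of_forall fun _ _ _ h => h

theorem isOpen_rep (F : Sphere → ℂ) : IsOpen {ψ : RegularGerm | Rep ψ F} :=
  isOpen_iff_mem_nhds.2 fun _ h => Rep.eventually h

/-- A map to the étalé space is continuous if its projection is, and if it is locally given by the
germs of one function. -/
theorem tendsto_germ {T : Type*} {l : Filter T} {Φ : T → RegularGerm} {ψ : RegularGerm}
    {F : Sphere → ℂ} (hF : Rep ψ F) (h1 : Tendsto (fun t => (Φ t).1) l (𝓝 ψ.1))
    (h2 : ∀ᶠ t in l, Rep (Φ t) F) : Tendsto Φ l (𝓝 ψ) := by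
  intro s hs
  rw [mem_nhds_germ hF] at hs
  rw [mem_map]
  filter_upwards [h1.eventually hs, h2] with t h1 h2
  exact h1 _ rfl h2

/-- If `F` differs from a representative of `ψ`, the difference has no zeros in a punctured
neighbourhood, so nearby germs of the representative are not germs of `F`. Together with
`isOpen_rep` this gives the open-closed alternative behind the identity principle and takes the
place of the Hausdorff property. -/
theorem isOpen_not_rep (F : Sphere → ℂ) :
    IsOpen {ψ : RegularGerm | HolomorphicAt F ψ.1 ∧ ¬ Rep ψ F} := by
  rw [isOpen_iff_mem_nhds]
  rintro ψ ⟨h1, h2⟩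
  have hG := rep_spec ψ
  rw [mem_nhds_germ hG]
  rcases (h1.sub hG.holomorphicAt).eventually_eq_zero_or with h | h
  · exact absurd (hG.congr (h.mono fun z hz => (sub_eq_zero.1 hz).symm)) h2
  · rw [eventually_nhdsWithin_iff] at h
    filter_upwards [h, h1.eventually] with z hz hz' χ hχ hχG
    subst hχ
    refine ⟨hz', fun hF => ?_⟩
    by_cases hχψ : χ.1 = ψ.1
    · obtain rfl := Rep.ext hχψ hχG hG
      exact h2 hF
    · exact hz hχψ (sub_eq_zero.2 (hF.eventuallyEq hχG).self_of_nhds)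

/-- The identity principle on connected sets of germs. -/
theorem Rep.of_isPreconnected {C : Set RegularGerm} (hC : IsPreconnected C) {F : Sphere → ℂ}
    (hF : ∀ ψ ∈ C, HolomorphicAt F ψ.1) {ψ χ : RegularGerm} (hψ : ψ ∈ C) (hχ : χ ∈ C)
    (h : Rep ψ F) : Rep χ F := by
  by_contra hn
  obtain ⟨ξ, -, h1, h2⟩ := hC _ _ (isOpen_rep F) (isOpen_not_rep F)
    (fun ξ hξ => or_iff_not_imp_left.2 fun h => ⟨hF ξ hξ, h⟩) ⟨ψ, hψ, h⟩ ⟨χ, hχ, hF χ hχ, hn⟩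
  exact h2.2 h1

theorem continuous_section {F : Sphere → ℂ} {V : Set Sphere} (hF : ∀ z ∈ V, HolomorphicAt F z) :
    Continuous (fun z : V => germAt F z (hF z z.2)) := by
  rw [continuous_iff_continuousAt]
  intro z
  exact tendsto_germ (rep_germAt _ _ _) continuous_subtype_val.continuousAt
    (Eventually.of_forall fun _ => rep_germAt _ _ _)

/-- The set of germs of one function holomorphic on a given set. -/
def sheet (F : Sphere → ℂ) (V : Set Sphere) : Set RegularGerm := {ψ | ψ.1 ∈ V ∧ Rep ψ F}

theorem isOpen_sheet (F : Sphere → ℂ) {V : Set Sphere} (hV : IsOpen V) : IsOpen (sheet F V) :=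
  (hV.preimage continuous_base).inter (isOpen_rep F)

theorem sheet_eq_range {F : Sphere → ℂ} {V : Set Sphere} (hF : ∀ z ∈ V, HolomorphicAt F z) :
    sheet F V = Set.range (fun z : V => germAt F z (hF z z.2)) := by
  ext ψ
  constructor
  · rintro ⟨h1, h2⟩
    exact ⟨⟨ψ.1, h1⟩, h2.germAt_eq⟩
  · rintro ⟨z, rfl⟩
    exact ⟨z.2, rep_germAt _ _ _⟩

theorem isPreconnected_sheet {F : Sphere → ℂ} {V : Set Sphere} (hF : ∀ z ∈ V, HolomorphicAt F z)
    (hV : IsPreconnected V) : IsPreconnected (sheet F V) := by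
  rw [sheet_eq_range hF]
  have := isPreconnected_iff_preconnectedSpace.1 hV
  exact isPreconnected_range (continuous_section hF)

/-- The identity principle for holomorphic functions on a connected set. -/
theorem eventuallyEq_of_isPreconnected {F G : Sphere → ℂ} {V : Set Sphere}
    (hV : IsPreconnected V) (hF : ∀ z ∈ V, HolomorphicAt F z) (hG : ∀ z ∈ V, HolomorphicAt G z)
    {z w : Sphere} (hz : z ∈ V) (hw : w ∈ V) (h : F =ᶠ[𝓝 z] G) : F =ᶠ[𝓝 w] G := by
  have h1 : Rep (germAt F z (hF z hz)) G := (rep_germAt _ _ _).congr h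
  have h2 := Rep.of_isPreconnected (isPreconnected_sheet hF hV) (F := G) (fun ψ hψ => hG _ hψ.1)
    (ψ := germAt F z (hF z hz)) (χ := germAt F w (hF w hw)) ⟨hz, rep_germAt _ _ _⟩
    ⟨hw, rep_germAt _ _ _⟩ h1
  exact (rep_germAt F w (hF w hw)).eventuallyEq h2

/-- Every germ has arbitrarily small neighbourhoods which are sheets over coordinate discs. -/
theorem exists_sheet_subset {ψ : RegularGerm} {F : Sphere → ℂ} (hF : Rep ψ F)
    {s : Set RegularGerm} (hs : s ∈ 𝓝 ψ) : ∃ r > 0, (∀ z ∈ disc ψ.1 r, HolomorphicAt F z) ∧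
      sheet F (disc ψ.1 r) ⊆ s := by
  rw [mem_nhds_germ hF] at hs
  obtain ⟨r, hr, h⟩ := exists_disc_subset (hs.and hF.holomorphicAt.eventually)
  exact ⟨r, hr, fun z hz => (h hz).2, fun χ hχ => (h hχ.1).1 χ rfl hχ.2⟩

theorem sheet_mem_nhds {ψ : RegularGerm} {F : Sphere → ℂ} (hF : Rep ψ F) {r : ℝ} (hr : 0 < r) :
    sheet F (disc ψ.1 r) ∈ 𝓝 ψ :=
  (isOpen_sheet F (isOpen_disc _ _)).mem_nhds ⟨mem_disc_self _ hr, hF⟩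

instance : LocallyConnectedSpace RegularGerm := by
  refine locallyConnectedSpace_of_connected_bases
    (fun ψ (r : ℝ) => sheet (rep ψ) (disc ψ.1 r))
    (fun ψ r => 0 < r ∧ ∀ z ∈ disc ψ.1 r, HolomorphicAt (rep ψ) z) ?_ ?_
  · intro ψ
    refine ⟨fun s => ⟨fun hs => ?_, ?_⟩⟩
    · obtain ⟨r, hr, h1, h2⟩ := exists_sheet_subset (rep_spec ψ) hs
      exact ⟨r, ⟨hr, h1⟩, h2⟩
    · rintro ⟨r, hr, h⟩
      exact mem_of_superset (sheet_mem_nhds (rep_spec ψ) hr.1) h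
  · intro ψ r hr
    exact isPreconnected_sheet hr.2 (isPreconnected_disc _ _)

/-- Two lifts of one map on a connected set agree if they agree at one point. -/
theorem lift_unique {T : Type*} [TopologicalSpace T] {s : Set T} (hs : IsPreconnected s)
    {Φ Ψ : T → RegularGerm} (hΦ : ContinuousOn Φ s) (hΨ : ContinuousOn Ψ s)
    (hb : ∀ t ∈ s, (Φ t).1 = (Ψ t).1) {t₀ t₁ : T} (h₀ : t₀ ∈ s) (h₁ : t₁ ∈ s)
    (h : Φ t₀ = Ψ t₀) : Φ t₁ = Ψ t₁ := by
  have := isPreconnected_iff_preconnectedSpace.1 hs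
  rw [continuousOn_iff_continuous_domRestrict] at hΦ hΨ
  -- Coincidence is closed because different germs over one point have disjoint sheets nearby, and
  -- open because a germ of a given function is determined by its base point.
  have key : IsClopen {t : s | Φ t = Ψ t} := by
    constructor
    · rw [← isOpen_compl_iff, isOpen_iff_mem_nhds]
      intro t ht
      have h1 : ¬ Rep (Φ t) (rep (Ψ t)) := fun h => ht (Rep.ext (hb t t.2) h (rep_spec _))
      have h2 : HolomorphicAt (rep (Ψ t)) (Φ t).1 := by
        rw [hb t t.2]; exact holomorphicAt_rep _
      have h3 := hΦ.continuousAt.eventually ((isOpen_not_rep (rep (Ψ t))).mem_nhds ⟨h2, h1⟩)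
      have h4 := hΨ.continuousAt.eventually (Rep.eventually (rep_spec (Ψ t)))
      filter_upwards [h3, h4] with u hu hu' he
      have he : Φ u = Ψ u := he
      refine hu.2 ?_
      change Rep (Φ u) _
      rw [he]
      exact hu'
    · rw [isOpen_iff_mem_nhds]
      intro t ht
      have ht : Φ t = Ψ t := ht
      have h3 := hΦ.continuousAt.eventually (Rep.eventually (rep_spec (Φ t)))
      have h4 := hΨ.continuousAt.eventually
        (Rep.eventually (ψ := Ψ t) (F := rep (Φ t)) (by rw [ht]; exact rep_spec _))
      filter_upwards [h3, h4] with u hu hu'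
      exact Rep.ext (hb u u.2) hu hu'
  have huniv := key.eq_univ ⟨⟨t₀, h₀⟩, h⟩
  exact (Set.ext_iff.1 huniv ⟨t₁, h₁⟩).2 trivial

/-- The value of a germ at its base point. -/
def val (ψ : RegularGerm) : ℂ := germValue ψ.2

theorem Rep.val_eq {ψ : RegularGerm} {F : Sphere → ℂ} (h : Rep ψ F) : val ψ = F ψ.1 := by
  rw [val, germValue, show (ψ.2 : (𝓝 ψ.1).Germ ℂ) = F from h]
  rfl

theorem continuous_val : Continuous val := by
  rw [continuous_iff_continuousAt]
  intro ψ
  have hF := rep_spec ψ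
  have h : Tendsto (fun χ : RegularGerm => rep ψ χ.1) (𝓝 ψ) (𝓝 (rep ψ ψ.1)) :=
    hF.holomorphicAt.continuousAt.tendsto.comp continuous_base.continuousAt
  rw [ContinuousAt, hF.val_eq]
  refine h.congr' ?_
  filter_upwards [hF.eventually] with χ hχ
  exact hχ.val_eq.symm

/-! ### Analytic continuation as path lifting -/

section Continuation

variable {φ : RegularGerm} {γ : unitInterval → Sphere} {τ T : unitInterval}
  {Φ : unitInterval → RegularGerm}

/-- Coherence says that `Φ` locally stays in the sheet of one function; combined with continuity of
the projected path this is continuity into the étalé space. -/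
theorem isContinuation_iff (hγ : Continuous γ) : IsContinuation φ γ τ Φ ↔
    Φ 0 = φ ∧ (∀ t ≤ τ, (Φ t).1 = γ t) ∧ ContinuousOn Φ (Set.Iic τ) := by
  constructor
  · intro h
    refine ⟨h.start, h.base, fun t ht => ?_⟩
    obtain ⟨F, hF⟩ := h.coherent t ht
    have hFt : Rep (Φ t) F := hF.self_of_nhdsWithin ht
    refine tendsto_germ hFt ?_ hF
    rw [h.base t ht]
    refine (hγ.continuousAt.continuousWithinAt (s := Set.Iic τ)).tendsto.congr' ?_
    filter_upwards [self_mem_nhdsWithin] with s hs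
    exact (h.base s hs).symm
  · rintro ⟨h1, h2, h3⟩
    refine ⟨h1, h2, fun t ht => ⟨rep (Φ t), ?_⟩⟩
    exact (h3 t ht).eventually (Rep.eventually (rep_spec (Φ t)))

theorem IsContinuation.continuousOn (h : IsContinuation φ γ τ Φ) (hγ : Continuous γ) :
    ContinuousOn Φ (Set.Iic τ) := ((isContinuation_iff hγ).1 h).2.2

theorem IsContinuation.continuous (h : IsContinuation φ γ 1 Φ) (hγ : Continuous γ) :
    Continuous Φ := by
  have := h.continuousOn hγ
  rwa [show Set.Iic (1 : unitInterval) = Set.univ from Set.Iic_top, continuousOn_univ] at this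

theorem isContinuation_one_iff (hγ : Continuous γ) : IsContinuation φ γ 1 Φ ↔
    Φ 0 = φ ∧ (∀ t, (Φ t).1 = γ t) ∧ Continuous Φ := by
  rw [isContinuation_iff hγ, show Set.Iic (1 : unitInterval) = Set.univ from Set.Iic_top,
    continuousOn_univ]
  simp [unitInterval.le_one']

theorem IsContinuation.mono (h : IsContinuation φ γ T Φ) (hτ : τ ≤ T) (hγ : Continuous γ) :
    IsContinuation φ γ τ Φ := by
  rw [isContinuation_iff hγ] at *
  exact ⟨h.1, fun t ht => h.2.1 t (ht.trans hτ), h.2.2.mono (Set.Iic_subset_Iic.2 hτ)⟩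

theorem IsContinuation.eq_of_le {Ψ : unitInterval → RegularGerm} (h : IsContinuation φ γ τ Φ)
    (h' : IsContinuation φ γ T Ψ) (hγ : Continuous γ) {t : unitInterval} (ht : t ≤ τ)
    (ht' : t ≤ T) : Φ t = Ψ t := by
  refine lift_unique (s := Set.Iic t) (Set.ordConnected_Iic.isPreconnected)
    ((h.mono ht hγ).continuousOn hγ) ((h'.mono ht' hγ).continuousOn hγ) (fun u hu => ?_)
    (t₀ := 0) unitInterval.nonneg' (Set.self_mem_Iic) (h.start.trans h'.start.symm)
  rw [h.base u (le_trans hu ht), h'.base u (le_trans hu ht')]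

/-- A continuation which reaches a germ of `F` can be prolonged as long as `F` is holomorphic. -/
theorem IsContinuation.prolong {F : Sphere → ℂ} (h : IsContinuation φ γ τ Φ) (hγ : Continuous γ)
    (hrep : Rep (Φ τ) F) (hF : ∀ t ∈ Set.Icc τ T, HolomorphicAt F (γ t)) :
    ∃ Ψ, IsContinuation φ γ T Ψ := by
  classical
  rcases le_or_gt T τ with hT | hT
  · exact ⟨Φ, h.mono hT hγ⟩
  -- The final default `φ` is never used at times up to `T`, where `F` is holomorphic along `γ`.
  let Ψ : unitInterval → RegularGerm := fun t => if t ≤ τ then Φ t else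
    if ht : HolomorphicAt F (γ t) then germAt F (γ t) ht else φ
  have hΨ1 : ∀ t ≤ τ, Ψ t = Φ t := fun t ht => if_pos ht
  have hΨ2 : ∀ t, τ < t → t ≤ T → (Ψ t).1 = γ t ∧ Rep (Ψ t) F := by
    intro t ht ht'
    have : Ψ t = germAt F (γ t) (hF t ⟨ht.le, ht'⟩) := by
      simp only [Ψ, not_le.2 ht, if_false, dif_pos (hF t ⟨ht.le, ht'⟩)]
    rw [this]
    exact ⟨rfl, rep_germAt _ _ _⟩
  have hbase : ∀ t ≤ T, (Ψ t).1 = γ t := by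
    intro t ht
    rcases le_or_gt t τ with h1 | h1
    · rw [hΨ1 t h1, h.base t h1]
    · exact (hΨ2 t h1 ht).1
  have hc := h.continuousOn hγ
  refine ⟨Ψ, ⟨(hΨ1 0 unitInterval.nonneg').trans h.start, hbase, fun t ht => ?_⟩⟩
  rcases lt_trichotomy t τ with h1 | h1 | h1
  · refine ⟨rep (Φ t), ?_⟩
    have h2 := (hc t h1.le).eventually (Rep.eventually (rep_spec (Φ t)))
    have h3 : Set.Iio τ ∈ 𝓝[Set.Iic T] t := mem_nhdsWithin_of_mem_nhds (Iio_mem_nhds h1)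
    have h4 : 𝓝[Set.Iic τ] t = 𝓝 t := nhdsWithin_eq_nhds.2 (Iic_mem_nhds h1)
    rw [h4] at h2
    filter_upwards [mem_nhdsWithin_of_mem_nhds h2, h3] with s hs hs'
    have := hΨ1 s (le_of_lt hs')
    rw [this]
    exact hs
  · subst h1
    refine ⟨F, ?_⟩
    have h2 := (hc t Set.self_mem_Iic).eventually (Rep.eventually hrep)
    rw [eventually_nhdsWithin_iff] at *
    filter_upwards [h2] with s hs hs'
    rcases le_or_gt s t with h3 | h3
    · have := hΨ1 s h3
      rw [this]
      exact hs h3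
    · exact (hΨ2 s h3 hs').2
  · refine ⟨F, ?_⟩
    rw [eventually_nhdsWithin_iff]
    filter_upwards [Ioi_mem_nhds h1] with s hs hs'
    exact (hΨ2 s hs hs').2

theorem isContinuation_zero (h0 : γ 0 = φ.1) : IsContinuation φ γ 0 (fun _ => φ) := by
  refine ⟨rfl, fun t ht => ?_, fun t ht => ⟨rep φ, ?_⟩⟩
  · rw [le_antisymm ht unitInterval.nonneg', h0]
  · exact Eventually.of_forall fun _ => rep_spec φ

/-- A germ can be continued along a path if there is no first time where it cannot. -/
theorem exists_continuation_of_forall (hγ : Continuous γ) (h0 : γ 0 = φ.1)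
    (h : ∀ T > 0, (∀ τ < T, ∃ Φ, IsContinuation φ γ τ Φ) → ∃ Φ, IsContinuation φ γ T Φ) :
    ∃ Φ, IsContinuation φ γ 1 Φ := by
  have hclopen : IsClopen {τ | ∃ Φ, IsContinuation φ γ τ Φ} := by
    constructor
    · refine isClosed_of_closure_subset fun T hT => ?_
      rcases (unitInterval.nonneg' (t := T)).eq_or_lt with h1 | h1
      · rw [← h1]
        exact ⟨_, isContinuation_zero h0⟩
      · refine h T h1 fun τ hτ => ?_
        obtain ⟨σ, hσ, Φ, hΦ⟩ := mem_closure_iff.1 hT _ isOpen_Ioi hτ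
        exact ⟨Φ, hΦ.mono (le_of_lt hσ) hγ⟩
    · rw [isOpen_iff_mem_nhds]
      rintro T ⟨Φ, hΦ⟩
      have hF := rep_spec (Φ T)
      have h1 : ∀ᶠ z in 𝓝 (γ T), HolomorphicAt (rep (Φ T)) z := by
        rw [← hΦ.base T le_rfl]
        exact hF.holomorphicAt.eventually
      have h2 := (hγ.continuousAt (x := T)).eventually h1
      have h3 : Tendsto (fun t => Set.uIcc T t) (𝓝 T) (𝓝 T).smallSets :=
        tendsto_const_nhds.uIcc tendsto_id
      filter_upwards [h3.eventually h2.smallSets] with t ht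
      rcases le_total T t with h4 | h4
      · exact hΦ.prolong hγ hF fun s hs => ht s (by rwa [Set.uIcc_of_le h4])
      · exact ⟨Φ, hΦ.mono h4 hγ⟩
  have := hclopen.eq_univ ⟨0, _, isContinuation_zero h0⟩
  exact (Set.ext_iff.1 this 1).2 trivial

/-- A germ can be continued along a path if each point of the path has a neighbourhood to which
every continuation of the germ reaching it extends. -/
theorem exists_continuation_of_local (hγ : Continuous γ) (h0 : γ 0 = φ.1)
    (h : ∀ T, ∃ V ∈ 𝓝 (γ T), ∀ᶠ τ in 𝓝 T, ∀ Φ, IsContinuation φ γ τ Φ →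
      ∃ F, Rep (Φ τ) F ∧ ∀ z ∈ V, HolomorphicAt F z) :
    ∃ Φ, IsContinuation φ γ 1 Φ := by
  refine exists_continuation_of_forall hγ h0 fun T hT hτ => ?_
  obtain ⟨V, hV, h⟩ := h T
  obtain ⟨l, hl, hlT⟩ := exists_Ioc_subset_of_mem_nhds
    (inter_mem (hγ.continuousAt.preimage_mem_nhds hV) h) ⟨0, hT⟩
  obtain ⟨τ, h1, h2⟩ := exists_between hl
  obtain ⟨Φ, hΦ⟩ := hτ τ h2
  obtain ⟨F, hF, hFV⟩ := (hlT ⟨h1, h2.le⟩).2 Φ hΦ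
  exact hΦ.prolong hγ hF fun t ht => hFV _ (hlT ⟨h1.trans_le ht.1, ht.2⟩).1

end Continuation

/-! ### Forbidden sets -/

/-- The germ `φ` can be continued along all paths which avoid `A`. -/
def Avoiding (A : Set Sphere) (φ : RegularGerm) : Prop :=
  ∀ γ : unitInterval → Sphere, Continuous γ → γ 0 = φ.1 → (∀ t, γ t ∉ A) →
    ∃ Φ, IsContinuation φ γ 1 Φ

theorem Avoiding.mono {A B : Set Sphere} {φ : RegularGerm} (h : Avoiding A φ) (hAB : A ⊆ B) :
    Avoiding B φ := fun γ hγ h0 hB => h γ hγ h0 fun t ht => hB t (hAB ht)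

/-- At a first time `T` where continuation fails, the initial piece of the path on `[0, T]`,
rescaled to the unit interval, exhibits its endpoint as a singular point. -/
theorem avoiding_singularSet (φ : RegularGerm) : Avoiding (singularSet φ) φ := by
  intro γ hγ h0 hA
  refine exists_continuation_of_forall hγ h0 fun T hT hτ => ?_
  by_contra hcon
  refine hA T ⟨⟨⟨fun s => γ (T * s), by fun_prop⟩, by simpa using h0, by simp⟩, ?_, ?_⟩
  · rintro ⟨Φ, hΦ⟩
    refine hcon ?_
    rw [isContinuation_one_iff (by fun_prop)] at hΦ
    have hT' : (0 : ℝ) < T := hT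
    refine ⟨fun t => Φ (Set.projIcc 0 1 zero_le_one ((t : ℝ) / T)), ?_⟩
    rw [isContinuation_iff hγ]
    refine ⟨?_, fun t ht => ?_, ?_⟩
    · simpa using hΦ.1
    · rw [hΦ.2.1]
      change γ _ = _
      congr 1
      apply Subtype.ext
      have ht' : (t : ℝ) / T ∈ Set.Icc (0 : ℝ) 1 :=
        ⟨div_nonneg t.2.1 hT'.le, (div_le_one hT').2 ht⟩
      rw [Set.projIcc_of_mem _ ht']
      push_cast
      field_simp
    · refine (hΦ.2.2.comp (continuous_projIcc.comp ?_)).continuousOn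
      fun_prop
  · intro σ hσ
    have hlt : T * σ < T := by
      have hT' : (0 : ℝ) < T := hT
      have hσ' : (σ : ℝ) < 1 := hσ
      change (T : ℝ) * σ < T
      nlinarith
    obtain ⟨Φ, hΦ⟩ := hτ _ hlt
    rw [isContinuation_iff hγ] at hΦ
    refine ⟨fun t => Φ (T * t), ?_⟩
    rw [isContinuation_iff (by fun_prop)]
    refine ⟨by simpa using hΦ.1, fun t ht => hΦ.2.1 _ ?_, ?_⟩
    · exact mul_le_mul_right ht T
    · refine hΦ.2.2.comp (by fun_prop) fun t ht => mul_le_mul_right ht T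

/-- Continuation of a germ does not create singular points. -/
theorem singularSet_subset_of_joined {φ ψ : RegularGerm} (h : Joined φ ψ) :
    singularSet ψ ⊆ singularSet φ := by
  obtain ⟨Γ⟩ := h
  rintro b ⟨δ, h1, h2⟩
  refine ⟨(Γ.map continuous_base).trans δ, ?_, ?_⟩
  · rintro ⟨Φ, hΦ⟩
    refine h1 ?_
    rw [isContinuation_one_iff (Path.continuous _)] at hΦ
    have key : ∀ t : unitInterval, (1 + (t : ℝ)) / 2 ∈ unitInterval := fun t =>
      ⟨by linarith [t.2.1], by linarith [t.2.2]⟩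
    have key' : ∀ t : unitInterval, (t : ℝ) / 2 ∈ unitInterval := fun t =>
      ⟨by linarith [t.2.1], by linarith [t.2.2]⟩
    refine ⟨fun t => Φ ⟨_, key t⟩, ?_⟩
    rw [isContinuation_one_iff δ.continuous]
    refine ⟨?_, ?_, ?_⟩
    · have h3 : Φ ⟨_, key' 1⟩ = Γ 1 := by
        refine lift_unique (s := Set.univ) (Φ := fun t => Φ ⟨_, key' t⟩) (Ψ := Γ)
          isPreconnected_univ ?_ Γ.continuous.continuousOn ?_ (t₀ := 0) (t₁ := 1)
          trivial trivial ?_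
        · exact (hΦ.2.2.comp (by fun_prop)).continuousOn
        · intro t _
          rw [hΦ.2.1, Path.trans_apply]
          have ht2 := t.2.2
          rw [dif_pos (by simp; linarith)]
          simp only [Path.map_coe, Function.comp_apply]
          congr 2
          apply Subtype.ext
          change 2 * ((t : ℝ) / 2) = t
          ring
        · simpa using hΦ.1
      have h4 : (⟨_, key 0⟩ : unitInterval) = ⟨_, key' 1⟩ := Subtype.ext (by simp)
      simp only [h4, h3, Path.target]
    · intro t
      rw [hΦ.2.1, Path.trans_apply]
      split_ifs with h5
      · have h6 : t = 0 := by
          apply Subtype.ext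
          simp only at h5
          change (t : ℝ) = 0
          linarith [t.2.1]
        subst h6
        simp
      · congr 1
        apply Subtype.ext
        change 2 * ((1 + (t : ℝ)) / 2) - 1 = t
        ring
    · exact hΦ.2.2.comp (by fun_prop)
  · intro τ hτ
    have hτ1 : (τ : ℝ) < 1 := hτ
    -- This is the time on `δ` that corresponds to time `τ` on the concatenation, cut off at zero
    -- while the first half is being run. The lift of `δ` is frozen from that time on, which does
    -- not matter since only times up to `τ` count.
    have hσm : max 0 (2 * (τ : ℝ) - 1) ∈ unitInterval :=
      ⟨le_max_left _ _, max_le zero_le_one (by linarith)⟩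
    set σ : unitInterval := ⟨_, hσm⟩ with hσ
    obtain ⟨Ψ, hΨ⟩ := h2 σ (by
      change max 0 (2 * (τ : ℝ) - 1) < 1
      exact max_lt zero_lt_one (by linarith))
    rw [isContinuation_iff δ.continuous] at hΨ
    let Ψ' : Path ψ (Ψ σ) := ⟨⟨fun t => Ψ (min t σ), ?_⟩, ?_, ?_⟩
    · refine ⟨Γ.trans Ψ', ?_⟩
      rw [isContinuation_iff (Path.continuous _)]
      refine ⟨by simp, fun t ht => ?_, (Path.continuous _).continuousOn⟩
      rw [Path.trans_apply, Path.trans_apply]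
      split_ifs with h5
      · rfl
      · have ht' : (t : ℝ) ≤ τ := ht
        have h6 : (⟨2 * (t : ℝ) - 1, unitInterval.two_mul_sub_one_mem_iff.2
            ⟨(not_le.1 h5).le, t.2.2⟩⟩ : unitInterval) ≤ σ := by
          change 2 * (t : ℝ) - 1 ≤ max 0 (2 * (τ : ℝ) - 1)
          exact le_max_of_le_right (by linarith)
        change (Ψ (min _ σ)).1 = _
        rw [min_eq_left h6, hΨ.2.1 _ h6]
    · exact continuousOn_univ.1 (hΨ.2.2.comp (by fun_prop)
        fun t _ => Set.mem_Iic.2 (min_le_right _ _))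
    · change Ψ (min 0 σ) = ψ
      rw [min_eq_left unitInterval.nonneg', hΨ.1]
    · change Ψ (min 1 σ) = Ψ σ
      rw [min_eq_right unitInterval.le_one']

theorem singularSet_eq_of_joined {φ ψ : RegularGerm} (h : Joined φ ψ) :
    singularSet φ = singularSet ψ :=
  (singularSet_subset_of_joined h.symm).antisymm (singularSet_subset_of_joined h)

theorem Equivalent.joined {φ ψ : RegularGerm} (h : Equivalent φ ψ) : Joined φ ψ := by
  obtain ⟨γ, Φ, hΦ, h1⟩ := h
  exact ⟨⟨⟨Φ, hΦ.continuous γ.continuous⟩, hΦ.start, h1⟩⟩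

/-- Checking the generating germ suffices, since every other germ of the function is a continuation
of it and so has no further singular points. -/
theorem isSFunction_generatedBy {a : Sphere} {φ : RegularGermAt a} (h : IsSGerm ⟨a, φ⟩) :
    IsSFunction (generatedBy φ) := by
  intro ψ hψ
  exact h.mono (singularSet_subset_of_joined (Equivalent.joined hψ))

/-- The germs of one function near a point are continuations of each other. -/
theorem eventually_joined {F : Sphere → ℂ} {a : Sphere} (h : HolomorphicAt F a) :
    ∀ᶠ z in 𝓝 a, ∀ hz : HolomorphicAt F z, Joined (germAt F a h) (germAt F z hz) := by
  obtain ⟨r, hr, hd⟩ := exists_disc_subset h.eventually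
  filter_upwards [disc_mem_nhds a hr] with z hz hz'
  have h1 := isPathConnected_disc_diff_countable Set.countable_empty a hr
  rw [Set.sdiff_empty] at h1
  obtain ⟨p, hp⟩ := h1.joinedIn a (mem_disc_self a hr) z hz
  refine ⟨⟨⟨fun t => germAt F (p t) (hd (hp t)), ?_⟩, ?_, ?_⟩⟩
  · rw [continuous_iff_continuousAt]
    intro t
    exact tendsto_germ (rep_germAt _ _ _) p.continuous.continuousAt
      (Eventually.of_forall fun _ => rep_germAt _ _ _)
  · exact Rep.ext (F := F) p.source (rep_germAt F (p 0) (hd (hp 0))) (rep_germAt _ _ _)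
  · exact Rep.ext (F := F) p.target (rep_germAt F (p 1) (hd (hp 1))) (rep_germAt _ _ _)

/-! ### Operations on lifts and permanence of relations -/

section Permanence

variable {T ι : Type*} [TopologicalSpace T] [Finite ι] {s : Set T} {γ : T → Sphere}
  {Φ : ι → T → RegularGerm}

theorem eventually_rep_eventuallyEq (hb : ∀ i, ∀ t ∈ s, (Φ i t).1 = γ t)
    (hΦ : ∀ i, ContinuousOn (Φ i) s) {t : T} (ht : t ∈ s) :
    ∀ᶠ u in 𝓝[s] t, ∀ i, rep (Φ i u) =ᶠ[𝓝 (γ u)] rep (Φ i t) := by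
  rw [eventually_all]
  intro i
  filter_upwards [(hΦ i t ht).eventually (Rep.eventually (rep_spec (Φ i t))),
    self_mem_nhdsWithin] with u hu hus
  rw [← hb i u hus]
  exact (rep_spec _).eventuallyEq hu

/-- Applying a local operator to lifts of one path gives a lift. -/
theorem continuousOn_of_rep_op (hγ : ContinuousOn γ s) (hb : ∀ i, ∀ t ∈ s, (Φ i t).1 = γ t)
    (hΦ : ∀ i, ContinuousOn (Φ i) s) {Op : (ι → Sphere → ℂ) → Sphere → ℂ}
    (hop : ∀ F G z, (∀ i, F i =ᶠ[𝓝 z] G i) → Op F =ᶠ[𝓝 z] Op G) {Θ : T → RegularGerm}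
    (hΘb : ∀ t ∈ s, (Θ t).1 = γ t) (hΘ : ∀ t ∈ s, Rep (Θ t) (Op fun i => rep (Φ i t))) :
    ContinuousOn Θ s := by
  intro t ht
  refine tendsto_germ (hΘ t ht) ?_ ?_
  · rw [hΘb t ht]
    refine (hγ t ht).tendsto.congr' ?_
    filter_upwards [self_mem_nhdsWithin] with u hu
    exact (hΘb u hu).symm
  · filter_upwards [eventually_rep_eventuallyEq hb hΦ ht, self_mem_nhdsWithin] with u hu hus
    refine (hΘ u hus).congr ?_
    rw [hΘb u hus]
    exact hop _ _ _ hu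

/-- A locally constant property of germs is preserved by analytic continuation. -/
theorem permanence (hs : IsPreconnected s) (hγ : ContinuousOn γ s)
    (hb : ∀ i, ∀ t ∈ s, (Φ i t).1 = γ t) (hΦ : ∀ i, ContinuousOn (Φ i) s)
    {P : (ι → Sphere → ℂ) → Sphere → Prop}
    (hcongr : ∀ F G z, (∀ i, F i =ᶠ[𝓝 z] G i) → P F z → P G z)
    (hloc : ∀ F z, (∀ i, HolomorphicAt (F i) z) →
      (∀ᶠ w in 𝓝 z, P F w) ∨ ∀ᶠ w in 𝓝 z, ¬ P F w)
    {t₀ t₁ : T} (h₀ : t₀ ∈ s) (h₁ : t₁ ∈ s) (h : P (fun i => rep (Φ i t₀)) (γ t₀)) :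
    P (fun i => rep (Φ i t₁)) (γ t₁) := by
  -- Near a given time all lifts are germs of fixed functions, so local constancy of `P` on the
  -- sphere turns into local constancy in the parameter.
  have key : ∀ t ∈ s, (∀ᶠ u in 𝓝[s] t, P (fun i => rep (Φ i u)) (γ u)) ∨
      ∀ᶠ u in 𝓝[s] t, ¬ P (fun i => rep (Φ i u)) (γ u) := by
    intro t ht
    have h1 := eventually_rep_eventuallyEq hb hΦ ht
    rcases hloc (fun i => rep (Φ i t)) (γ t)
      (fun i => by rw [← hb i t ht]; exact holomorphicAt_rep _) with h2 | h2
    · left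
      filter_upwards [h1, (hγ t ht).eventually h2] with u hu hu'
      exact hcongr _ _ _ (fun i => (hu i).symm) hu'
    · right
      filter_upwards [h1, (hγ t ht).eventually h2] with u hu hu' hcon
      exact hu' (hcongr _ _ _ hu hcon)
  have := isPreconnected_iff_preconnectedSpace.1 hs
  have hclopen : IsClopen {t : s | P (fun i => rep (Φ i t)) (γ t)} := by
    constructor
    · rw [← isOpen_compl_iff, isOpen_iff_mem_nhds]
      intro t ht
      rcases key t t.2 with h | h
      · exact absurd (h.self_of_nhdsWithin t.2) ht
      · rw [nhds_subtype_eq_comap_nhdsWithin]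
        exact preimage_mem_comap h
    · rw [isOpen_iff_mem_nhds]
      intro t ht
      rcases key t t.2 with h | h
      · rw [nhds_subtype_eq_comap_nhdsWithin]
        exact preimage_mem_comap h
      · exact absurd ht (h.self_of_nhdsWithin t.2)
  exact (Set.ext_iff.1 (hclopen.eq_univ ⟨⟨t₀, h₀⟩, h⟩) ⟨t₁, h₁⟩).2 trivial

end Permanence

/-- Isolated zeros make the vanishing of the germ a locally constant property, as `permanence`
requires. -/
theorem eventually_eventuallyEq_zero_or {F : Sphere → ℂ} {z : Sphere} (h : HolomorphicAt F z) :
    (∀ᶠ w in 𝓝 z, ∀ᶠ u in 𝓝 w, F u = 0) ∨ ∀ᶠ w in 𝓝 z, ¬ ∀ᶠ u in 𝓝 w, F u = 0 := by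
  rcases h.eventually_eq_zero_or with h | h
  · exact Or.inl (eventually_eventually_nhds.2 h)
  · right
    rw [eventually_nhdsWithin_iff] at h
    filter_upwards [h] with w hw h0
    by_cases hwz : w = z
    · subst hwz
      have := nhdsNE_sphere_neBot w
      have h1 : ∀ᶠ u in 𝓝[≠] w, F u ≠ 0 := eventually_nhdsWithin_iff.2 h
      obtain ⟨u, h2, h3⟩ := (h1.and (h0.filter_mono nhdsWithin_le_nhds)).exists
      exact h2 h3
    · exact hw hwz h0.self_of_nhds

/-- Analytic relations are preserved by analytic continuation. -/
theorem permanence_eq {T ι : Type*} [TopologicalSpace T] [Finite ι] {s : Set T} {γ : T → Sphere}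
    {Φ : ι → T → RegularGerm} (hs : IsPreconnected s) (hγ : ContinuousOn γ s)
    (hb : ∀ i, ∀ t ∈ s, (Φ i t).1 = γ t) (hΦ : ∀ i, ContinuousOn (Φ i) s)
    {Op : (ι → Sphere → ℂ) → Sphere → ℂ}
    (hop : ∀ F G z, (∀ i, F i =ᶠ[𝓝 z] G i) → Op F =ᶠ[𝓝 z] Op G)
    (hhol : ∀ F z, (∀ i, HolomorphicAt (F i) z) → HolomorphicAt (Op F) z)
    {t₀ t₁ : T} (h₀ : t₀ ∈ s) (h₁ : t₁ ∈ s)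
    (h : ∀ᶠ z in 𝓝 (γ t₀), Op (fun i => rep (Φ i t₀)) z = 0) :
    ∀ᶠ z in 𝓝 (γ t₁), Op (fun i => rep (Φ i t₁)) z = 0 :=
  permanence hs hγ hb hΦ (P := fun F z => ∀ᶠ w in 𝓝 z, Op F w = 0)
    (fun F G z hFG h => by
      filter_upwards [hop F G z hFG, h] with w h1 h2
      rw [← h1, h2])
    (fun F z hF => eventually_eventuallyEq_zero_or (hhol F z hF)) h₀ h₁ h

/-! ### Avoiding a countable set -/

theorem exists_mem_nhds_base_not_mem {A : Set Sphere} (hA : A.Countable) {ψ : RegularGerm}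
    {s : Set RegularGerm} (hs : s ∈ 𝓝 ψ) : ∃ χ ∈ s, χ.1 ∉ A := by
  obtain ⟨r, hr, h1, h2⟩ := exists_sheet_subset (rep_spec ψ) hs
  obtain ⟨z, hz, hzA⟩ := exists_mem_not_mem_countable hA (disc_mem_nhds ψ.1 hr)
  exact ⟨germAt (rep ψ) z (h1 z hz), h2 ⟨hz, rep_germAt _ _ _⟩, hzA⟩

/-- A sheet over a disc is a copy of the disc, so a path in the disc that misses `A` lifts to it. -/
theorem joinedIn_sheet_diff_countable {A : Set Sphere} (hA : A.Countable) {F : Sphere → ℂ}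
    {a : Sphere} {r : ℝ} (hr : 0 < r) (hF : ∀ z ∈ disc a r, HolomorphicAt F z)
    {ξ η : RegularGerm} (hξ : ξ ∈ sheet F (disc a r)) (hη : η ∈ sheet F (disc a r))
    (hξA : ξ.1 ∉ A) (hηA : η.1 ∉ A) :
    JoinedIn {ψ | ψ ∈ sheet F (disc a r) ∧ ψ.1 ∉ A} ξ η := by
  obtain ⟨p, hp⟩ := (isPathConnected_disc_diff_countable hA a hr).joinedIn
    ξ.1 ⟨hξ.1, hξA⟩ η.1 ⟨hη.1, hηA⟩
  refine ⟨⟨⟨fun t => germAt F (p t) (hF _ (hp t).1), ?_⟩, ?_, ?_⟩, fun t => ?_⟩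
  · rw [continuous_iff_continuousAt]
    intro t
    exact tendsto_germ (rep_germAt _ _ _) p.continuous.continuousAt
      (Eventually.of_forall fun _ => rep_germAt _ _ _)
  · exact Rep.ext (F := F) p.source (rep_germAt F (p 0) (hF _ (hp 0).1)) hξ.2
  · exact Rep.ext (F := F) p.target (rep_germAt F (p 1) (hF _ (hp 1).1)) hη.2
  · exact ⟨⟨(hp t).1, rep_germAt F (p t) (hF _ (hp t).1)⟩, (hp t).2⟩

/-- The complement of a countable union of fibres in a connected open set of germs is path
connected. -/
theorem joinedIn_diff_countable {A : Set Sphere} (hA : A.Countable) {O : Set RegularGerm}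
    (hO : IsOpen O) (hO' : IsPreconnected O) {ξ η : RegularGerm} (hξ : ξ ∈ O) (hη : η ∈ O)
    (hξA : ξ.1 ∉ A) (hηA : η.1 ∉ A) : JoinedIn {ψ | ψ ∈ O ∧ ψ.1 ∉ A} ξ η := by
  set M : Set RegularGerm := {ψ | ψ ∈ O ∧ ψ.1 ∉ A}
  -- Germs over `A` cannot be joined inside `M`, so the condition concerns the nearby germs off `A`
  -- only. It is open and closed in `O`, because on a small sheet one joined germ off `A` reaches
  -- all the others.
  set U : Set RegularGerm := {x | ∀ᶠ y in 𝓝 x, y.1 ∉ A → JoinedIn M ξ y} with hU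
  have hUo : IsOpen U := by
    rw [isOpen_iff_mem_nhds]
    intro x hx
    exact eventually_eventually_nhds.2 hx
  have key : ∀ x ∈ O, ∃ N ∈ 𝓝 x, N ⊆ O ∧ ∀ y ∈ N, y ∈ U → N ⊆ U := by
    intro x hx
    obtain ⟨r, hr, h1, h2⟩ := exists_sheet_subset (rep_spec x) (hO.mem_nhds hx)
    refine ⟨_, sheet_mem_nhds (rep_spec x) hr, h2, fun y hy hyU => ?_⟩
    have hN := isOpen_sheet (rep x) (isOpen_disc x.1 r)
    obtain ⟨z, ⟨hz1, hz2⟩, hz3⟩ := exists_mem_nhds_base_not_mem hA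
      (inter_mem (hN.mem_nhds hy) hyU)
    intro w hw
    filter_upwards [hN.mem_nhds hw] with v hv hvA
    exact (hz2 hz3).trans ((joinedIn_sheet_diff_countable hA hr h1 hz1 hv hz3 hvA).mono
      fun u hu => ⟨h2 hu.1, hu.2⟩)
  have hU'o : IsOpen {x | x ∈ O ∧ x ∉ U} := by
    rw [isOpen_iff_mem_nhds]
    rintro x ⟨hx, hxU⟩
    obtain ⟨N, hN, h1, h2⟩ := key x hx
    filter_upwards [hN] with y hy
    exact ⟨h1 hy, fun hyU => hxU (h2 y hy hyU (mem_of_mem_nhds hN))⟩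
  have hξU : ξ ∈ U := by
    obtain ⟨r, hr, h1, h2⟩ := exists_sheet_subset (rep_spec ξ) (hO.mem_nhds hξ)
    filter_upwards [sheet_mem_nhds (rep_spec ξ) hr] with v hv hvA
    exact (joinedIn_sheet_diff_countable hA hr h1 ⟨mem_disc_self _ hr, rep_spec ξ⟩ hv hξA
      hvA).mono fun u hu => ⟨h2 hu.1, hu.2⟩
  have hηU : η ∈ U := by
    by_contra hcon
    obtain ⟨x, -, h1, h2⟩ := hO' _ _ hUo hU'o
      (fun x hx => or_iff_not_imp_left.2 fun h => ⟨hx, h⟩) ⟨ξ, hξ, hξU⟩ ⟨η, hη, hη, hcon⟩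
    exact h2.2 h1
  exact hηU.self_of_nhds hηA

/-- Infinite concatenation of paths. -/
theorem exists_infinite_concatenation {X : Type*} [TopologicalSpace X] (x : ℕ → X)
    (p : ∀ n, Path (x n) (x (n + 1))) : ∃ f : ℝ → X, Continuous f ∧ f 0 = x 0 ∧
      ∀ n : ℕ, ∀ t ∈ Set.Icc (n : ℝ) (n + 1), f t ∈ Set.range (p n) := by
  let g : ℝ → X := fun t => (p ⌊t⌋₊).extend (t - ⌊t⌋₊)
  have hg : ∀ n : ℕ, ∀ t ∈ Set.Icc (n : ℝ) (n + 1), g t = (p n).extend (t - n) := by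
    intro n t ht
    rcases ht.2.eq_or_lt with h | h
    · have h1 : ⌊t⌋₊ = n + 1 := by
        rw [h]
        exact_mod_cast Nat.floor_natCast (R := ℝ) (n + 1)
      simp only [g]
      rw [h1, h]
      simp
    · have h1 : ⌊t⌋₊ = n := (Nat.floor_eq_iff ((Nat.cast_nonneg n).trans ht.1)).2 ⟨ht.1, h⟩
      simp only [g]
      rw [h1]
  have hgc : ∀ n : ℕ, ContinuousOn g (Set.Icc (n : ℝ) (n + 1)) := by
    intro n
    refine ContinuousOn.congr (f := fun t : ℝ => (p n).extend (t - n)) ?_ (hg n)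
    exact ((p n).continuous_extend.comp (by fun_prop)).continuousOn
  have hgc' : ∀ n : ℕ, ContinuousOn g (Set.Icc (0 : ℝ) n) := by
    intro n
    induction n with
    | zero => simp
    | succ n ih =>
      have : Set.Icc (0 : ℝ) (n + 1 : ℕ) = Set.Icc (0 : ℝ) n ∪ Set.Icc (n : ℝ) (n + 1) := by
        rw [Set.Icc_union_Icc_eq_Icc (Nat.cast_nonneg n) (by simp)]
        simp
      rw [this]
      exact ih.union_of_isClosed (hgc n) isClosed_Icc isClosed_Icc
  have hgI : ContinuousOn g (Set.Ici 0) := by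
    intro t ht
    obtain ⟨n, hn⟩ := exists_nat_gt t
    refine (hgc' n t ⟨ht, hn.le⟩).mono_of_mem_nhdsWithin ?_
    rw [mem_nhdsWithin_iff_exists_mem_nhds_inter]
    exact ⟨Set.Iio (n : ℝ), Iio_mem_nhds hn, fun u hu => ⟨hu.2, le_of_lt hu.1⟩⟩
  refine ⟨fun t => g (max t 0), ?_, ?_, ?_⟩
  · exact continuousOn_univ.1
      (hgI.comp (s := Set.univ) (by fun_prop) fun t _ => Set.mem_Ici.2 (le_max_right t 0))
  · simp [g]
  · intro n t ht
    simp only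
    rw [max_eq_left ((Nat.cast_nonneg n).trans ht.1), hg n t ht, Path.extend_apply _
      ⟨by linarith [ht.1], by linarith [ht.2]⟩]
    exact Set.mem_range_self _

/-- If a germ can be continued along all paths avoiding a countable set, then its singular points
belong to this set. -/
theorem singularSet_subset_of_avoiding {A : Set Sphere} (hA : A.Countable) {φ : RegularGerm}
    (hφ : Avoiding A φ) (ha : φ.1 ∉ A) : singularSet φ ⊆ A := by
  classical
  rintro b ⟨γ, h1, h2⟩
  by_contra hb
  refine h1 ?_
  choose Ψ hΨ using h2
  -- By uniqueness the continuations over `[0, τ]` glue to one lift over `[0, 1)`; its value at `1`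
  -- is a dummy.
  obtain ⟨Γ, hΓ⟩ : ∃ Γ, ∀ τ < 1, IsContinuation φ γ τ Γ := by
    refine ⟨fun t => if h : t < 1 then Ψ t h t else φ, fun τ hτ => ?_⟩
    have he : ∀ t ≤ τ, (if h : t < 1 then Ψ t h t else φ) = Ψ τ hτ t := by
      intro t ht
      rw [dif_pos (ht.trans_lt hτ)]
      exact (hΨ _ _).eq_of_le (hΨ _ _) γ.continuous le_rfl ht
    have h := hΨ τ hτ
    rw [isContinuation_iff γ.continuous] at h ⊢
    refine ⟨(he 0 unitInterval.nonneg').trans h.1, fun t ht => ?_, h.2.2.congr he⟩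
    rw [← h.2.1 t ht, ← he t ht]
  have hΓb : ∀ t < 1, (Γ t).1 = γ t := fun t ht => (hΓ t ht).base t le_rfl
  have hΓc : ContinuousOn Γ (Set.Iio 1) := by
    intro t ht
    obtain ⟨τ, h3, h4⟩ := exists_between (Set.mem_Iio.1 ht)
    exact (((hΓ τ h4).continuousOn γ.continuous).continuousAt
      (Iic_mem_nhds h3)).continuousWithinAt
  -- These are discs shrinking to `b`. The guard `1 ≤ m` makes `V 0` the whole sphere, so that the
  -- first component `C 0` contains the starting germ `φ`.
  let V : ℕ → Set Sphere := fun m => {z | 1 ≤ m → z ∈ disc b (1 / (m : ℝ))}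
  have hVpos : ∀ m : ℕ, 1 ≤ m → (0 : ℝ) < 1 / (m : ℝ) := fun m hm => by
    have : (0 : ℝ) < m := by exact_mod_cast hm
    positivity
  have hVo : ∀ m, IsOpen (V m) := by
    intro m
    by_cases hm : 1 ≤ m
    · simpa [V, hm] using isOpen_disc b _
    · simp [V, hm]
  have hVb : ∀ m, b ∈ V m := fun m hm => mem_disc_self b (hVpos m hm)
  have hVanti : ∀ m, V (m + 1) ⊆ V m := by
    intro m z hz hm
    refine disc_mono b ?_ (hz (by omega))
    have : (0 : ℝ) < m := by exact_mod_cast hm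
    exact one_div_le_one_div_of_le this (by push_cast; linarith)
  have hs : ∀ m, ∃ s : unitInterval, s < 1 ∧ ∀ t, s ≤ t → γ t ∈ V m := by
    intro m
    have h3 : γ ⁻¹' V m ∈ 𝓝 (1 : unitInterval) :=
      γ.continuous.continuousAt.preimage_mem_nhds (by
        rw [γ.target]; exact (hVo m).mem_nhds (hVb m))
    obtain ⟨l, hl, h4⟩ := exists_Ioc_subset_of_mem_nhds h3 ⟨0, zero_lt_one⟩
    obtain ⟨s, h5, h6⟩ := exists_between hl
    exact ⟨s, h6, fun t ht => h4 ⟨h5.trans_le ht, unitInterval.le_one'⟩⟩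
  choose s hs1 hs2 using hs
  let O : ℕ → Set RegularGerm := fun m => (fun ψ => ψ.1) ⁻¹' V m
  have hOo : ∀ m, IsOpen (O m) := fun m => (hVo m).preimage continuous_base
  -- The branch on which `Γ` approaches `b`: the component, among germs over `V m`, that contains
  -- the tail of `Γ`.
  let C : ℕ → Set RegularGerm := fun m => connectedComponentIn (O m) (Γ (s m))
  have hCo : ∀ m, IsOpen (C m) := fun m => (hOo m).connectedComponentIn
  have hCc : ∀ m, IsPreconnected (C m) := fun m => isPreconnected_connectedComponentIn
  have hCO : ∀ m, C m ⊆ O m := fun m => connectedComponentIn_subset _ _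
  have hΓC : ∀ m t, s m ≤ t → t < 1 → Γ t ∈ C m := by
    intro m t ht ht1
    have h3 : IsPreconnected (Γ '' Set.Ico (s m) 1) :=
      Set.ordConnected_Ico.isPreconnected.image _ (hΓc.mono fun u hu => hu.2)
    refine h3.subset_connectedComponentIn (Set.mem_image_of_mem _ ⟨le_rfl, hs1 m⟩) ?_
      (Set.mem_image_of_mem _ ⟨ht, ht1⟩)
    rintro _ ⟨u, hu, rfl⟩
    change (Γ u).1 ∈ V m
    rw [hΓb u hu.2]
    exact hs2 m u hu.1
  have hφC : φ ∈ C 0 := by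
    have h3 : IsPreconnected (Γ '' Set.Iio 1) :=
      Set.ordConnected_Iio.isPreconnected.image _ hΓc
    refine h3.subset_connectedComponentIn (Set.mem_image_of_mem _ (hs1 0)) ?_
      ⟨0, Set.mem_Iio.2 zero_lt_one, (hΓ 0 zero_lt_one).start⟩
    rintro _ _ hm
    omega
  have hCanti : Antitone C := by
    refine antitone_nat_of_succ_le fun m => ?_
    have h3 : max (s m) (s (m + 1)) < 1 := max_lt (hs1 _) (hs1 _)
    have h4 := hΓC m _ (le_max_left _ _) h3
    have h5 := hΓC (m + 1) _ (le_max_right _ _) h3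
    have h6 : C m = connectedComponentIn (O m) _ := connectedComponentIn_eq h4
    rw [h6]
    exact (hCc (m + 1)).subset_connectedComponentIn h5
      ((hCO (m + 1)).trans (Set.preimage_mono (hVanti m)))
  obtain ⟨ξ, hξ0, hξC, hξA⟩ : ∃ ξ : ℕ → RegularGerm, ξ 0 = φ ∧ (∀ m, ξ m ∈ C m) ∧
      ∀ m, (ξ m).1 ∉ A := by
    have h3 : ∀ m, ∃ χ ∈ C m, χ.1 ∉ A := fun m =>
      exists_mem_nhds_base_not_mem hA ((hCo m).mem_nhds (hΓC m _ le_rfl (hs1 m)))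
    choose η hη1 hη2 using h3
    refine ⟨fun m => if m = 0 then φ else η m, by simp, fun m => ?_, fun m => ?_⟩
    · by_cases hm : m = 0
      · subst hm; simpa using hφC
      · simpa [hm] using hη1 m
    · by_cases hm : m = 0
      · simpa [hm] using ha
      · simpa [hm] using hη2 m
  -- Linking these germs inside the decreasing sets `C m` gives a path of germs that misses `A`,
  -- starts at `φ` and whose base point tends to `b`. It need not stay close to `γ`; only the sets
  -- `C m` are shared.
  have hp : ∀ m, JoinedIn {ψ | ψ ∈ C m ∧ ψ.1 ∉ A} (ξ m) (ξ (m + 1)) := fun m =>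
    joinedIn_diff_countable hA (hCo m) (hCc m) (hξC m) (hCanti (Nat.le_succ m) (hξC (m + 1)))
      (hξA m) (hξA (m + 1))
  choose p hp using hp
  obtain ⟨f, hfc, hf0, hf⟩ := exists_infinite_concatenation ξ p
  have hfC : ∀ (m : ℕ) (t : ℝ), m ≤ t → f t ∈ C m ∧ (f t).1 ∉ A := by
    intro m t ht
    have ht0 : 0 ≤ t := (Nat.cast_nonneg m).trans ht
    obtain ⟨u, hu⟩ := hf ⌊t⌋₊ t ⟨Nat.floor_le ht0, (Nat.lt_floor_add_one t).le⟩
    rw [← hu]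
    exact ⟨hCanti (Nat.le_floor ht) (hp _ u).1, (hp _ u).2⟩
  -- The half-line is compressed to `[0, 1)`. The value at `1` is irrelevant, as `δ 1` is set to `b`
  -- by hand.
  let g : unitInterval → ℝ := fun t => t / (1 - t)
  have hg0 : ∀ t, 0 ≤ g t := fun t => div_nonneg t.2.1 (by linarith [t.2.2])
  have hgc : ∀ t < 1, ContinuousAt g t := by
    intro t ht
    have ht' : (t : ℝ) < 1 := ht
    refine ContinuousAt.div (by fun_prop) (by fun_prop) (by linarith)
  have hgtop : Tendsto g (𝓝[≠] 1) atTop := by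
    have h3 : Tendsto (fun t : unitInterval => 1 - (t : ℝ)) (𝓝[≠] 1) (𝓝[>] 0) := by
      refine tendsto_nhdsWithin_iff.2 ⟨?_, ?_⟩
      · have : ContinuousAt (fun t : unitInterval => 1 - (t : ℝ)) 1 := by fun_prop
        have h := this.tendsto
        simp only [Set.Icc.coe_one, sub_self] at h
        exact h.mono_left nhdsWithin_le_nhds
      · filter_upwards [self_mem_nhdsWithin] with t ht
        have : (t : ℝ) < 1 := lt_of_le_of_ne t.2.2 fun h => ht (Subtype.ext h)
        exact sub_pos.2 this
    have h4 := (tendsto_atTop_add_const_right _ (-1 : ℝ) (tendsto_inv_nhdsGT_zero.comp h3))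
    refine h4.congr' ?_
    filter_upwards [self_mem_nhdsWithin] with t ht
    have : (t : ℝ) < 1 := lt_of_le_of_ne t.2.2 fun h => ht (Subtype.ext h)
    have h5 : 1 - (t : ℝ) ≠ 0 := by linarith
    simp only [Function.comp_apply, g]
    field_simp
    ring
  let δ : unitInterval → Sphere := fun t => if t = 1 then b else (f (g t)).1
  have hδ : ∀ t < 1, δ t = (f (g t)).1 := fun t ht => if_neg ht.ne
  have hδc : Continuous δ := by
    rw [continuous_iff_continuousAt]
    intro t
    rcases (unitInterval.le_one' (t := t)).eq_or_lt with h3 | h3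
    · subst h3
      rw [continuousAt_iff_punctured_nhds]
      have h4 : δ 1 = b := if_pos rfl
      rw [h4]
      intro U hU
      obtain ⟨r, hr, hrU⟩ := exists_disc_subset hU
      obtain ⟨m, hm⟩ := exists_nat_one_div_lt hr
      have h5 := hgtop.eventually (eventually_ge_atTop ((m + 1 : ℕ) : ℝ))
      rw [mem_map]
      filter_upwards [h5, self_mem_nhdsWithin] with t ht ht1
      have h6 := hCO _ (hfC (m + 1) _ ht).1 (by omega)
      change δ t ∈ U
      rw [hδ t (lt_of_le_of_ne unitInterval.le_one' ht1)]
      refine hrU (disc_mono b ?_ h6)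
      push_cast
      exact hm.le
    · have h4 : ContinuousAt (fun t => (f (g t)).1) t :=
        (continuous_base.comp hfc).continuousAt.comp (hgc t h3)
      refine h4.congr ?_
      filter_upwards [Iio_mem_nhds h3] with u hu
      exact (hδ u hu).symm
  have hδA : ∀ t, δ t ∉ A := by
    intro t
    rcases (unitInterval.le_one' (t := t)).eq_or_lt with h3 | h3
    · simpa [δ, h3] using hb
    · rw [hδ t h3]
      exact (hfC 0 _ (by simpa using hg0 t)).2
  have hδ0 : δ 0 = φ.1 := by
    rw [hδ 0 zero_lt_one]
    simp [g, hf0, hξ0]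
  obtain ⟨Θ, hΘ⟩ := hφ δ hδc hδ0 hδA
  rw [isContinuation_one_iff hδc] at hΘ
  have hΘf : ∀ t < 1, Θ t = f (g t) := by
    intro t ht
    refine lift_unique (s := Set.Iio 1) (Ψ := fun t => f (g t))
      Set.ordConnected_Iio.isPreconnected hΘ.2.2.continuousOn
      (fun u hu => (hfc.continuousAt.comp (hgc u hu)).continuousWithinAt) (fun u hu => ?_)
      (t₀ := 0) (Set.mem_Iio.2 zero_lt_one) ht ?_
    · rw [hΘ.2.1, hδ u hu]
    · rw [hΘ.1]
      simp [g, hf0, hξ0]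
  -- The continuation along `δ` reaches a germ at `b`, whose representative is holomorphic on some
  -- `V (m + 1)`. On the connected set `C (m + 1)` the identity principle makes `Γ` a germ of the
  -- same function, so `Γ` extends to time `1`.
  have hF := rep_spec (Θ 1)
  have hΘ1 : (Θ 1).1 = b := by rw [hΘ.2.1]; exact if_pos rfl
  obtain ⟨r, hr, hrF⟩ := exists_disc_subset hF.holomorphicAt.eventually
  rw [hΘ1] at hrF
  obtain ⟨m, hm⟩ := exists_nat_one_div_lt hr
  have hVF : ∀ z ∈ V (m + 1), HolomorphicAt (rep (Θ 1)) z := by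
    intro z hz
    refine hrF (disc_mono b ?_ (hz (by omega)))
    push_cast
    exact hm.le
  have h1neBot : (𝓝[≠] (1 : unitInterval)).NeBot := inferInstance
  obtain ⟨t, ht1, ht2, ht3⟩ : ∃ t : unitInterval, t < 1 ∧ ((m + 1 : ℕ) : ℝ) ≤ g t ∧
      Rep (Θ t) (rep (Θ 1)) := by
    have h3 := hgtop.eventually (eventually_ge_atTop ((m + 1 : ℕ) : ℝ))
    have h4 := (hΘ.2.2.continuousAt (x := 1)).eventually hF.eventually
    obtain ⟨t, h5, h6, h7⟩ := (h3.and ((h4.filter_mono nhdsWithin_le_nhds).and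
      (self_mem_nhdsWithin (a := (1 : unitInterval)) (s := {1}ᶜ)))).exists
    exact ⟨t, lt_of_le_of_ne unitInterval.le_one' h7, h5, h6⟩
  rw [hΘf t ht1] at ht3
  have hrep : Rep (Γ (s (m + 1))) (rep (Θ 1)) :=
    Rep.of_isPreconnected (hCc (m + 1)) (fun ψ hψ => hVF _ (hCO _ hψ)) (hfC (m + 1) _ ht2).1
      (hΓC _ _ le_rfl (hs1 _)) ht3
  exact (hΓ _ (hs1 (m + 1))).prolong γ.continuous hrep
    fun t ht => hVF _ (hs2 (m + 1) t ht.1)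

/-! ### Countability of the set of branches -/

/-- The germs obtained from one germ by continuation are germs of countably many functions. -/
theorem exists_countable_reps (φ : RegularGerm) : ∃ E : Set (Sphere → ℂ), E.Countable ∧
    ∀ ψ ∈ connectedComponent φ, ∃ F ∈ E, Rep ψ F := by
  classical
  obtain ⟨𝔅, h𝔅c, h𝔅, h𝔅n⟩ := exists_countable_preconnected_basis
  have := h𝔅c.to_subtype
  let Q : Set Sphere → Set Sphere → (Sphere → ℂ) → (Sphere → ℂ) → Prop := fun V W F G =>
    (∀ z ∈ V, HolomorphicAt G z) ∧ ∀ z ∈ W, G z = F z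
  -- One step of continuation is encoded by countable data: replace `F` by some function holomorphic
  -- on `V` that agrees with `F` on `W`. When `V` is connected and meets `W`, the identity principle
  -- makes the choice immaterial on `V`. Finite words in these steps give the countable family `E`.
  let ext : 𝔅 × 𝔅 → (Sphere → ℂ) → Sphere → ℂ := fun p F =>
    if h : ∃ G, Q p.1 p.2 F G then h.choose else F
  let E : Set (Sphere → ℂ) := Set.range fun l : List (𝔅 × 𝔅) => l.foldr ext (rep φ)
  have hE : ∀ p, ∀ F ∈ E, ext p F ∈ E := by
    rintro p _ ⟨l, rfl⟩
    exact ⟨p :: l, rfl⟩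
  have hclopen : IsClopen {ψ : RegularGerm | ∃ F ∈ E, Rep ψ F} := by
    constructor
    -- Take a germ of `rep ψ` near `ψ` that is already represented by some `F` in `E`. One step from
    -- a small `W` around it to the set `V` around `ψ` recovers `ψ`.
    · refine isClosed_of_closure_subset fun ψ hψ => ?_
      have hG := rep_spec ψ
      obtain ⟨V, hV, hψV, hVG⟩ := h𝔅n ψ.1 _ hG.holomorphicAt.eventually
      obtain ⟨χ, ⟨hχV, hχG⟩, F, hFE, hF⟩ := mem_closure_iff.1 hψ _
        (isOpen_sheet (rep ψ) (h𝔅 V hV).1) ⟨hψV, hG⟩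
      obtain ⟨W, hW, hχW, hWF⟩ := h𝔅n χ.1 _
        (((h𝔅 V hV).1.eventually_mem hχV).and (hχG.eventuallyEq hF))
      have hex : ∃ G, Q V W F G := ⟨rep ψ, hVG, fun z hz => (hWF hz).2⟩
      refine ⟨ext (⟨V, hV⟩, ⟨W, hW⟩) F, hE _ _ hFE, ?_⟩
      have hQ : Q V W F (ext (⟨V, hV⟩, ⟨W, hW⟩) F) := by
        simp only [ext, dif_pos hex]
        exact hex.choose_spec
      refine hG.congr (eventuallyEq_of_isPreconnected (h𝔅 V hV).2 hVG hQ.1 hχV hψV ?_)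
      filter_upwards [(h𝔅 W hW).1.mem_nhds hχW] with z hz
      rw [hQ.2 z hz, (hWF hz).2]
    · rw [isOpen_iff_mem_nhds]
      rintro ψ ⟨F, hF, h⟩
      filter_upwards [h.eventually] with χ hχ
      exact ⟨F, hF, hχ⟩
  refine ⟨E, Set.countable_range _, fun ψ hψ => ?_⟩
  exact hclopen.connectedComponent_subset ⟨rep φ, ⟨[], rfl⟩, rep_spec φ⟩ hψ

/-- If the points where continuations of given germs satisfy a condition are isolated on each
branch, then there are only countably many such points. -/
theorem countable_of_isolated_on_branches {ι : Type*} [Finite ι] {φ : ι → RegularGerm}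
    {P : (ι → Sphere → ℂ) → Sphere → Prop}
    (hcongr : ∀ F G z, (∀ i, F i =ᶠ[𝓝 z] G i) → P F z → P G z)
    (hreach : ∀ F z, P F z → ∀ i, ∃ ψ ∈ connectedComponent (φ i), ψ.1 = z ∧ Rep ψ (F i))
    (hiso : ∀ F z, P F z → ∀ᶠ w in 𝓝[≠] z, ¬ P F w) :
    {z | ∃ F, P F z}.Countable := by
  choose E hEc hE using fun i => exists_countable_reps (φ i)
  have : ∀ i, Countable (E i) := fun i => (hEc i).to_subtype
  -- Finitely many indices give only countably many tuples of representatives, and for each fixed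
  -- tuple the points in question are isolated.
  have hsub : {z | ∃ F, P F z} ⊆ ⋃ F : ∀ i, E i, {z | P (fun i => F i) z} := by
    rintro z ⟨F, hF⟩
    choose ψ hψ hψz hψF using hreach F z hF
    choose G hGE hG using fun i => hE i (ψ i) (hψ i)
    refine Set.mem_iUnion.2 ⟨fun i => ⟨G i, hGE i⟩, hcongr _ _ _ (fun i => ?_) hF⟩
    rw [← hψz i]
    exact (hψF i).eventuallyEq (hG i)
  refine (Set.countable_iUnion fun F => ?_).mono hsub
  exact countable_of_isolated fun z hz => hiso _ z hz

/-! ### Change of the base point -/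

theorem eventually_singularSet_eq {F : Sphere → ℂ} {a : Sphere} (hF : HolomorphicAt F a) :
    ∀ᶠ z in 𝓝 a, ∀ hz : HolomorphicAt F z,
      singularSet (germAt F z hz) = singularSet (germAt F a hF) := by
  filter_upwards [eventually_joined hF] with z hz hz'
  exact (singularSet_eq_of_joined (hz hz')).symm

theorem eventually_avoiding {F : Sphere → ℂ} {a : Sphere} (hF : HolomorphicAt F a)
    {A : Set Sphere} (hA : singularSet (germAt F a hF) ⊆ A) :
    ∀ᶠ z in 𝓝 a, ∀ hz : HolomorphicAt F z, Avoiding A (germAt F z hz) := by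
  filter_upwards [eventually_singularSet_eq hF] with z hz hz'
  exact (avoiding_singularSet _).mono ((hz hz').subset.trans hA)

theorem singularSet_subset_of_eventually {K : Sphere → ℂ} {a : Sphere} (hK : HolomorphicAt K a)
    {A : Set Sphere} (hA : A.Countable)
    (h : ∀ᶠ z in 𝓝 a, z ∉ A → ∀ hz : HolomorphicAt K z, Avoiding A (germAt K z hz)) :
    singularSet (germAt K a hK) ⊆ A := by
  -- The point `a` may lie in `A`; a nearby point outside `A` carries a germ with the same singular
  -- set.
  obtain ⟨z, ⟨⟨h1, h2⟩, h3⟩, hzA⟩ := exists_mem_not_mem_countable hA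
    ((h.and hK.eventually).and (eventually_singularSet_eq hK))
  rw [← h3 h2]
  exact singularSet_subset_of_avoiding hA (h1 hzA h2) hzA

/-- To bound the singular points of a germ one may continue it from nearby generic points. -/
theorem isSGerm_of_eventually {K : Sphere → ℂ} {a : Sphere} (hK : HolomorphicAt K a)
    {A : Set Sphere} (hA : A.Countable)
    (h : ∀ᶠ z in 𝓝 a, z ∉ A → ∀ hz : HolomorphicAt K z, Avoiding A (germAt K z hz)) :
    IsSGerm (germAt K a hK) :=
  hA.mono (singularSet_subset_of_eventually hK hA h)

/-- A local operator applied to germs which can be continued along a path. -/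
theorem exists_continuation_op {ι : Type*} [Finite ι] {F : ι → Sphere → ℂ} {z : Sphere}
    {γ : unitInterval → Sphere} (hγ : Continuous γ) {Φ : ι → unitInterval → RegularGerm}
    (hF : ∀ i, HolomorphicAt (F i) z)
    (hΦ : ∀ i, IsContinuation (germAt (F i) z (hF i)) γ 1 (Φ i)) (h0 : γ 0 = z)
    {Op : (ι → Sphere → ℂ) → Sphere → ℂ}
    (hop : ∀ F G z, (∀ i, F i =ᶠ[𝓝 z] G i) → Op F =ᶠ[𝓝 z] Op G)
    (hhol : ∀ t, HolomorphicAt (Op fun i => rep (Φ i t)) (γ t)) {K : Sphere → ℂ}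
    (hK : HolomorphicAt K z) (hKF : K =ᶠ[𝓝 z] Op F) :
    ∃ Θ, IsContinuation (germAt K z hK) γ 1 Θ := by
  refine ⟨fun t => germAt _ (γ t) (hhol t), ?_⟩
  rw [isContinuation_one_iff hγ]
  refine ⟨?_, fun t => rfl, ?_⟩
  · refine Rep.ext (F := K) h0 ?_ (rep_germAt _ _ _)
    refine (rep_germAt _ _ _).congr ?_
    simp only [germAt_fst, h0]
    refine (hop _ _ _ fun i => ?_).trans hKF.symm
    rw [(hΦ i).start]
    exact rep_germAt_eventuallyEq (hF i)
  · rw [← continuousOn_univ]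
    refine continuousOn_of_rep_op (γ := γ) (Φ := Φ) hγ.continuousOn
      (fun i t _ => (hΦ i).base t unitInterval.le_one')
      (fun i => ((hΦ i).continuous hγ).continuousOn) hop (fun t _ => rfl)
      (fun t _ => rep_germAt _ _ _)

theorem IsContinuation.mem_connectedComponent {φ : RegularGerm} {γ : unitInterval → Sphere}
    {Φ : unitInterval → RegularGerm} {τ : unitInterval} (h : IsContinuation φ γ τ Φ)
    (hγ : Continuous γ) {t : unitInterval} (ht : t ≤ τ) : Φ t ∈ connectedComponent φ := by
  have h1 : IsPreconnected (Φ '' Set.Iic τ) :=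
    Set.ordConnected_Iic.isPreconnected.image _ (h.continuousOn hγ)
  refine h1.subset_connectedComponent ⟨0, ?_, h.start⟩ (Set.mem_image_of_mem _ ht)
  exact unitInterval.nonneg'

theorem eventually_mem_connectedComponent {F : Sphere → ℂ} {a : Sphere} (hF : HolomorphicAt F a) :
    ∀ᶠ z in 𝓝 a, ∀ hz : HolomorphicAt F z,
      connectedComponent (germAt F z hz) = connectedComponent (germAt F a hF) := by
  filter_upwards [eventually_joined hF] with z hz hz'
  exact (connectedComponent_eq (pathComponent_subset_component _ (hz hz'))).symm

/-- A nonconstant multivalued function takes every value at countably many points. -/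
theorem countable_setOf_val_eq {φ : RegularGerm} {c : ℂ} (hφ : ¬ Rep φ fun _ => c) :
    {p | ∃ ψ ∈ connectedComponent φ, ψ.1 = p ∧ val ψ = c}.Countable := by
  have hc : ∀ ψ ∈ connectedComponent φ, ¬ Rep ψ fun _ => c := fun ψ hψ h =>
    hφ (Rep.of_isPreconnected isPreconnected_connectedComponent
      (fun _ _ => HolomorphicAt.const c) hψ mem_connectedComponent h)
  have key := countable_of_isolated_on_branches (ι := Unit) (φ := fun _ => φ)
    (P := fun F z => (∃ ψ ∈ connectedComponent φ, ψ.1 = z ∧ Rep ψ (F ())) ∧ F () z = c)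
    ?_ ?_ ?_
  · refine key.mono ?_
    rintro p ⟨ψ, hψ, rfl, hv⟩
    exact ⟨fun _ => rep ψ, ⟨ψ, hψ, rfl, rep_spec ψ⟩, (rep_spec ψ).val_eq.symm.trans hv⟩
  · rintro F G z hFG ⟨⟨ψ, hψ, rfl, h⟩, hv⟩
    exact ⟨⟨ψ, hψ, rfl, h.congr (hFG ())⟩, by rw [← (hFG ()).self_of_nhds, hv]⟩
  · rintro F z ⟨h, -⟩ -
    exact h
  · rintro F z ⟨⟨ψ, hψ, rfl, h⟩, hv⟩
    rcases (h.holomorphicAt.sub (HolomorphicAt.const c)).eventually_eq_zero_or with h1 | h1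
    · exact absurd (h.congr (h1.mono fun z hz => sub_eq_zero.1 hz)) (hc ψ hψ)
    · filter_upwards [h1] with w hw hcon
      exact hw (sub_eq_zero.2 hcon.2)

/-! ### Differentiation -/

/-- Differentiating a lift gives a lift, so no new singular points arise. -/
theorem isSGerm_derivGerm {a : Sphere} {φ : RegularGermAt a} (hφ : IsSGerm ⟨a, φ⟩) :
    IsSGerm ⟨a, derivGerm φ⟩ := by
  obtain ⟨_, F, hF, rfl⟩ := φ
  change IsSGerm (germAt F a hF) at hφ
  change IsSGerm (germAt (sphereDeriv F) a hF.sphereDeriv)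
  refine isSGerm_of_eventually _ hφ ?_
  filter_upwards [eventually_avoiding hF subset_rfl, hF.eventually] with z hz hFz _ hKz
    γ hγ h0 hA
  obtain ⟨Φ, hΦ⟩ := hz hFz γ hγ h0 hA
  refine exists_continuation_op (ι := Unit) (F := fun _ => F) (Φ := fun _ => Φ)
    (Op := fun F => sphereDeriv (F ())) hγ (fun _ => hFz) (fun _ => hΦ) h0
    (fun F G z h => sphereDeriv_congr (h ())) (fun t => ?_) hKz EventuallyEq.rfl
  rw [← hΦ.base t unitInterval.le_one']
  exact (holomorphicAt_rep _).sphereDeriv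

/-! ### Integration -/

theorem sphereDeriv_coe (F : Sphere → ℂ) (z : ℂ) :
    sphereDeriv F (z : Sphere) = deriv (fun w : ℂ => F (w : Sphere)) z := rfl

theorem sphereDeriv_chart (F : Sphere → ℂ) (z w : ℂ) :
    sphereDeriv F (chart (z : Sphere) w) = deriv (fun u => F (chart (z : Sphere) u)) w := by
  rw [chart_coe, sphereDeriv_coe]
  simp only [chart_coe]
  rw [deriv_comp_const_add (f := fun u : ℂ => F (u : Sphere))]

theorem HolomorphicAt.differentiableAt_chart {F : Sphere → ℂ} {a : Sphere} {w : ℂ}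
    (h : HolomorphicAt F (chart a w)) : DifferentiableAt ℂ (fun u => F (chart a u)) w :=
  (holomorphicAt_chart_iff.1 h).differentiableAt

theorem eventually_eq_const_of_sphereDeriv {F : Sphere → ℂ} {a : Sphere} (ha : a ≠ ∞)
    (hF : HolomorphicAt F a) (h : ∀ᶠ z in 𝓝 a, sphereDeriv F z = 0) :
    ∀ᶠ z in 𝓝 a, F z = F a := by
  induction a using OnePoint.rec with
  | infty => exact absurd rfl ha
  | coe z =>
    rw [eventually_nhds_iff_chart] at h ⊢
    have h2 := eventually_nhds_iff_chart.1 hF.eventually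
    obtain ⟨r, hr, hd⟩ := Metric.eventually_nhds_iff_ball.1 (h.and h2)
    filter_upwards [Metric.ball_mem_nhds 0 hr] with w hw
    have := Metric.isOpen_ball.is_const_of_deriv_eq_zero (𝕜 := ℂ)
      (f := fun u => F (chart (z : Sphere) u)) (convex_ball (0 : ℂ) r).isPreconnected
      (fun u hu => (hd u hu).2.differentiableAt_chart.differentiableWithinAt)
      (fun u hu => by
        have := (hd u hu).1
        rw [sphereDeriv_chart] at this
        exact this) hw (Metric.mem_ball_self hr)
    simpa using this

theorem exists_primitive {G : Sphere → ℂ} {z : ℂ} (hG : HolomorphicAt G (z : Sphere)) :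
    ∃ P : Sphere → ℂ, ∀ᶠ w in 𝓝 (z : Sphere), HolomorphicAt P w ∧ sphereDeriv P w = G w := by
  have h2 := eventually_nhds_iff_chart.1 hG.eventually
  obtain ⟨r, hr, hd⟩ := Metric.eventually_nhds_iff_ball.1 h2
  have h3 : DifferentiableOn ℂ (fun u => G (chart (z : Sphere) u)) (Metric.ball 0 r) :=
    fun u hu => (hd u hu).differentiableAt_chart.differentiableWithinAt
  obtain ⟨p, hp⟩ := h3.isExactOn_ball
  obtain ⟨P, hP⟩ := exists_comp_chart (z : Sphere) p
  have hP' : (fun u => P (chart (z : Sphere) u)) = p := funext hP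
  refine ⟨P, ?_⟩
  rw [eventually_nhds_iff_chart]
  filter_upwards [Metric.ball_mem_nhds 0 hr] with w hw
  rw [holomorphicAt_chart_iff, sphereDeriv_chart, hP']
  exact ⟨DifferentiableOn.analyticAt
    (fun u hu => (hp u hu).differentiableAt.differentiableWithinAt)
    (Metric.isOpen_ball.mem_nhds hw), (hp w hw).deriv⟩

theorem sphereDeriv_sub {F G : Sphere → ℂ} {z : Sphere} (hF : HolomorphicAt F z)
    (hG : HolomorphicAt G z) :
    sphereDeriv (fun w => F w - G w) z = sphereDeriv F z - sphereDeriv G z := by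
  induction z using OnePoint.rec with
  | infty => simp [sphereDeriv]
  | coe z =>
    simp only [sphereDeriv_coe]
    exact deriv_fun_sub (AnalyticAt.differentiableAt hF) (AnalyticAt.differentiableAt hG)

/-- Near a finite point to which the derivative continues, every branch of the primitive differs
from one local primitive by a constant, hence extends as far as that primitive. The point `∞` is
forbidden because the form `dx` has a double pole there, and primitives may acquire a pole or a
logarithm. -/
theorem isSGerm_of_derivGerm {a : Sphere} {χ : RegularGermAt a} (h : IsSGerm ⟨a, derivGerm χ⟩) :
    IsSGerm ⟨a, χ⟩ := by
  obtain ⟨_, K, hK, rfl⟩ := χ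
  change IsSGerm (germAt (sphereDeriv K) a hK.sphereDeriv) at h
  change IsSGerm (germAt K a hK)
  refine isSGerm_of_eventually _ (A := insert ∞ _) (h.insert ∞) ?_
  filter_upwards [eventually_avoiding hK.sphereDeriv (Set.subset_insert ∞ _), hK.eventually] with
    z hz hKz _ hKz' γ hγ h0 hA
  obtain ⟨Φ, hΦ⟩ := hz hKz.sphereDeriv γ hγ h0 hA
  have hΦc := hΦ.continuous hγ
  have hfin : ∀ t, γ t ≠ ∞ := fun t ht => hA t (by rw [ht]; exact Set.mem_insert _ _)
  refine exists_continuation_of_local hγ h0 fun T => ?_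
  obtain ⟨z₀, hz₀⟩ := OnePoint.ne_infty_iff_exists.1 (hfin T)
  have hG := rep_spec (Φ T)
  have hGh := hG.holomorphicAt
  rw [hΦ.base T unitInterval.le_one', ← hz₀] at hGh
  obtain ⟨P, hP⟩ := exists_primitive hGh
  rw [hz₀] at hP
  refine ⟨_, eventually_eventually_nhds.2 hP, ?_⟩
  filter_upwards [hΦc.continuousAt.eventually hG.eventually,
    hγ.continuousAt.eventually (eventually_eventually_nhds.2 hP)] with τ h1 h2 Ξ hΞ
  have hΞb := hΞ.base τ le_rfl
  have hL := rep_spec (Ξ τ)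
  -- The differential relation is carried along both lifts; `true` indexes the primitive and `false`
  -- its derivative.
  have hperm := permanence_eq (ι := Bool) (s := Set.Iic τ) (γ := γ)
    (Φ := fun b => if b then Ξ else Φ) (Set.ordConnected_Iic.isPreconnected)
    hγ.continuousOn (by
      rintro (_ | _) t ht
      · exact hΦ.base t unitInterval.le_one'
      · exact hΞ.base t ht) (by
      rintro (_ | _)
      · exact hΦc.continuousOn
      · exact hΞ.continuousOn hγ)
    (Op := fun F z => sphereDeriv (F true) z - F false z)
    (fun F G z h => by
      filter_upwards [sphereDeriv_congr (h true), h false] with w h1 h2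
      rw [h1, h2])
    (fun F z hF => (hF true).sphereDeriv.sub (hF false))
    (t₀ := 0) (t₁ := τ) (Set.mem_Iic.2 unitInterval.nonneg') Set.self_mem_Iic (by
      simp only [if_true, Bool.false_eq_true, if_false, hΞ.start, hΦ.start, h0, germAt_fst]
      filter_upwards [sphereDeriv_congr (rep_germAt_eventuallyEq hKz'),
        rep_germAt_eventuallyEq hKz.sphereDeriv] with w hw1 hw2
      rw [hw1, hw2, sub_self])
  simp only [if_true, Bool.false_eq_true, if_false] at hperm
  have hLh := hL.holomorphicAt
  rw [hΞb] at hLh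
  have hPτ := h2.self_of_nhds.1
  have hdiff : ∀ᶠ w in 𝓝 (γ τ), sphereDeriv (fun u => rep (Ξ τ) u - P u) w = 0 := by
    have h3 := (rep_spec (Φ τ)).eventuallyEq h1
    rw [hΦ.base τ unitInterval.le_one'] at h3
    filter_upwards [hperm, h2, h3, hLh.eventually] with w hw1 hw2 hw3 hw4
    rw [sphereDeriv_sub hw4 hw2.1, hw2.2, ← hw3, hw1]
  have hconst := eventually_eq_const_of_sphereDeriv (hfin τ) (hLh.sub hPτ) hdiff
  refine ⟨fun u => P u + (rep (Ξ τ) (γ τ) - P (γ τ)), hL.congr ?_, fun w hw => ?_⟩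
  · rw [hΞb]
    filter_upwards [hconst] with w hw
    rw [← hw]
    ring
  · exact (Eventually.self_of_nhds hw).1.add (HolomorphicAt.const _)

/-! ### Composition -/

theorem isSGerm_of_const {a : Sphere} {K : Sphere → ℂ} (hK : HolomorphicAt K a) {c : ℂ}
    (h : ∀ᶠ z in 𝓝 a, K z = c) : IsSGerm (germAt K a hK) := by
  refine isSGerm_of_eventually _ Set.countable_empty ?_
  filter_upwards [eventually_eventually_nhds.2 h] with z hz _ hKz γ hγ h0 _
  exact (isContinuation_zero h0).prolong hγ (F := fun _ => c) ((rep_germAt _ _ _).congr hz)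
    fun t _ => HolomorphicAt.const c

/-- Besides the singular points of the inner function, trouble occurs only where one of its branches
takes a value singular for the outer one. A nonconstant inner function takes each of these countably
many values at countably many points; a constant one gives a constant. -/
theorem isSGerm_compGerm {a : Sphere} {φ : RegularGermAt a}
    {ψ : RegularGermAt ((germValue φ : ℂ) : Sphere)} (hφ : IsSGerm ⟨a, φ⟩)
    (hψ : IsSGerm ⟨_, ψ⟩) : IsSGerm ⟨a, compGerm φ ψ⟩ := by
  obtain ⟨_, F, hF, rfl⟩ := φ
  obtain ⟨_, G, hG, rfl⟩ := ψ
  change HolomorphicAt G ((F a : ℂ) : Sphere) at hG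
  change IsSGerm (germAt F a hF) at hφ
  change IsSGerm (germAt G ((F a : ℂ) : Sphere) hG) at hψ
  change IsSGerm (germAt (fun z => G ((F z : ℂ) : Sphere)) a (hG.comp_coe hF))
  by_cases hconst : ∃ c, Rep (germAt F a hF) fun _ => c
  · obtain ⟨c, hc⟩ := hconst
    refine isSGerm_of_const _ (c := G ((c : ℂ) : Sphere)) ?_
    filter_upwards [(rep_germAt F a hF).eventuallyEq hc] with z hz
    rw [hz]
  push Not at hconst
  set B := singularSet (germAt G ((F a : ℂ) : Sphere) hG)
  set S : Set Sphere := ⋃ c ∈ ((↑) : ℂ → Sphere) ⁻¹' B,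
    {p | ∃ ξ ∈ connectedComponent (germAt F a hF), ξ.1 = p ∧ val ξ = c} with hS
  have hSc : S.Countable := (hψ.preimage OnePoint.coe_injective).biUnion
    fun c _ => countable_setOf_val_eq (hconst c)
  have hSmem : ∀ ξ ∈ connectedComponent (germAt F a hF), ξ.1 ∉ S → ((val ξ : ℂ) : Sphere) ∉ B :=
    fun ξ hξ hn hB => hn (Set.mem_biUnion (x := val ξ) hB ⟨ξ, hξ, rfl, rfl⟩)
  refine isSGerm_of_eventually _ (hφ.union hSc) ?_
  have hFc : Tendsto (fun z => ((F z : ℂ) : Sphere)) (𝓝 a) (𝓝 ((F a : ℂ) : Sphere)) :=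
    (OnePoint.continuous_coe.tendsto _).comp hF.continuousAt
  filter_upwards [eventually_avoiding hF Set.subset_union_left, hF.eventually,
    eventually_mem_connectedComponent hF, hFc.eventually hG.eventually,
    hFc.eventually (eventually_avoiding hG subset_rfl)] with z h1 hFz h2 hGz h3 hzA hKz γ hγ h0 hA
  obtain ⟨Φ, hΦ⟩ := h1 hFz γ hγ h0 hA
  have hΦc := hΦ.continuous hγ
  have hΦb : ∀ t, (Φ t).1 = γ t := fun t => hΦ.base t unitInterval.le_one'
  have hΦS : ∀ t, Φ t ∈ connectedComponent (germAt F a hF) := fun t => by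
    rw [← h2 hFz]
    exact hΦ.mem_connectedComponent hγ unitInterval.le_one'
  -- The inner values along `γ` trace a path that misses the singular points of the outer germ,
  -- which is continued along it.
  let w : unitInterval → Sphere := fun t => ((val (Φ t) : ℂ) : Sphere)
  have hw : Continuous w := OnePoint.continuous_coe.comp (continuous_val.comp hΦc)
  have hw0 : w 0 = ((F z : ℂ) : Sphere) := by
    simp only [w, hΦ.start, (rep_germAt F z hFz).val_eq, germAt_fst]
  obtain ⟨Ψ, hΨ⟩ := h3 hGz w hw hw0 fun t => hSmem _ (hΦS t) fun h =>
    hA t (Or.inr (by rwa [hΦb] at h))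
  have hΨc := hΨ.continuous hw
  have hΨb : ∀ t, (Ψ t).1 = ((val (Φ t) : ℂ) : Sphere) := fun t => hΨ.base t unitInterval.le_one'
  have hhol : ∀ t, HolomorphicAt (fun z => rep (Ψ t) ((rep (Φ t) z : ℂ) : Sphere)) (γ t) := by
    intro t
    rw [← hΦb]
    refine HolomorphicAt.comp_coe ?_ (holomorphicAt_rep _)
    rw [← (rep_spec (Φ t)).val_eq, ← hΨb]
    exact holomorphicAt_rep _
  have hlocal : ∀ (t : unitInterval) (F' G' : Sphere → ℂ), Rep (Φ t) F' → Rep (Ψ t) G' →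
      Rep (germAt _ (γ t) (hhol t)) fun z => G' ((F' z : ℂ) : Sphere) := by
    intro t F' G' hF' hG'
    refine (rep_germAt _ _ _).congr ?_
    have h4 := (rep_spec (Φ t)).eventuallyEq hF'
    have h5 := (rep_spec (Ψ t)).eventuallyEq hG'
    have h6 : Tendsto (fun z => ((F' z : ℂ) : Sphere)) (𝓝 (Φ t).1) (𝓝 (Ψ t).1) := by
      rw [hΨb, hF'.val_eq]
      exact (OnePoint.continuous_coe.tendsto _).comp hF'.holomorphicAt.continuousAt
    simp only [germAt_fst, ← hΦb t]
    filter_upwards [h4, h6.eventually h5] with u hu1 hu2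
    rw [hu1, hu2]
  refine ⟨fun t => germAt _ (γ t) (hhol t), ?_⟩
  rw [isContinuation_one_iff hγ]
  refine ⟨?_, fun t => rfl, ?_⟩
  · refine Rep.ext (F := fun z => G ((F z : ℂ) : Sphere)) h0 (hlocal 0 F G ?_ ?_)
      (rep_germAt _ _ _)
    · rw [hΦ.start]; exact rep_germAt _ _ _
    · rw [hΨ.start]; exact rep_germAt _ _ _
  · rw [continuous_iff_continuousAt]
    intro t
    refine tendsto_germ (rep_germAt _ _ _) hγ.continuousAt ?_
    filter_upwards [hΦc.continuousAt.eventually (rep_spec (Φ t)).eventually,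
      hΨc.continuousAt.eventually (rep_spec (Ψ t)).eventually] with u hu1 hu2
    exact hlocal u _ _ hu1 hu2

/-! ### Linear differential equations in the plane -/

/-- The solutions of a holomorphic linear system exist on discs whose radius does not depend on the
initial condition. -/
theorem exists_forall_solution_linear_system {E : Type*} [NormedAddCommGroup E]
    [NormedSpace ℂ E] [CompleteSpace E] {M : ℂ → E →L[ℂ] E} {r : ℝ} (hr : 0 < r)
    (hM : DifferentiableOn ℂ M (Metric.ball 0 r)) : ∃ δ > 0, δ ≤ r ∧ ∀ w₁ ∈ Metric.ball (0 : ℂ) δ,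
      ∀ y₀ : E, ∃ Y : ℂ → E, Y w₁ = y₀ ∧
        ∀ w ∈ Metric.ball (0 : ℂ) δ, HasDerivAt Y (M w (Y w)) w := by
  classical
  set C : ℝ := ‖M 0‖ + 1 with hC
  have hC0 : 0 < C := by positivity
  have hMc : ContinuousAt M 0 := (hM.differentiableAt (Metric.ball_mem_nhds 0 hr)).continuousAt
  have hev : ∀ᶠ w in 𝓝 (0 : ℂ), ‖M w‖ < C :=
    hMc.norm.eventually_lt continuousAt_const (by simp [hC])
  obtain ⟨δ₀, hδ₀, hb⟩ := Metric.eventually_nhds_iff_ball.1 hev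
  -- Two points of the disc are less than `2 * δ` apart, so `1 / (4 * C)` makes each Picard step a
  -- contraction by `1 / 2`. By linearity the radius does not involve the initial value.
  set δ : ℝ := min (min δ₀ r) (1 / (4 * C)) with hδ
  have hδpos : 0 < δ := lt_min (lt_min hδ₀ hr) (by positivity)
  have hδr : δ ≤ r := (min_le_left _ _).trans (min_le_right _ _)
  have hδC : 2 * δ * C ≤ 1 / 2 := by
    have h1 : δ ≤ 1 / (4 * C) := min_le_right _ _
    rw [le_div_iff₀ (by positivity)] at h1
    linarith
  refine ⟨δ, hδpos, hδr, fun w₁ hw₁ y₀ => ?_⟩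
  set D := Metric.ball (0 : ℂ) δ with hD
  have hMb : ∀ w ∈ D, ‖M w‖ ≤ C := fun w hw =>
    (hb w (Metric.ball_subset_ball ((min_le_left _ _).trans (min_le_left _ _)) hw)).le
  have hMD : DifferentiableOn ℂ M D := hM.mono (Metric.ball_subset_ball hδr)
  have step : ∀ Z : ℂ → E, DifferentiableOn ℂ Z D → ∃ Z' : ℂ → E, Z' w₁ = 0 ∧
      ∀ w ∈ D, HasDerivAt Z' (M w (Z w)) w := by
    intro Z hZ
    have h1 : DifferentiableOn ℂ (fun w => M w (Z w)) D := hMD.clm_apply hZ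
    obtain ⟨g, hg, hg'⟩ := h1.isExactOn_ball.with_val_at w₁ 0
    exact ⟨g, hg, hg'⟩
  -- These are the increments of Picard's iteration: each is the primitive, vanishing at `w₁`, of
  -- `M` applied to the previous one. The solution is their sum.
  let Z : ℕ → {Z : ℂ → E // DifferentiableOn ℂ Z D} := fun k =>
    Nat.rec ⟨fun _ => y₀, differentiableOn_const _⟩ (fun _ Z => ⟨(step Z.1 Z.2).choose,
      fun w hw => ((step Z.1 Z.2).choose_spec.2 w hw).differentiableAt.differentiableWithinAt⟩) k
  have hZ0 : (Z 0).1 = fun _ => y₀ := rfl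
  have hZ1 : ∀ k, (Z (k + 1)).1 w₁ = 0 := fun k => (step (Z k).1 (Z k).2).choose_spec.1
  have hZ2 : ∀ k, ∀ w ∈ D, HasDerivAt (Z (k + 1)).1 (M w ((Z k).1 w)) w := fun k =>
    (step (Z k).1 (Z k).2).choose_spec.2
  have hZb : ∀ k, ∀ w ∈ D, ‖(Z k).1 w‖ ≤ ‖y₀‖ * (1 / 2) ^ k := by
    intro k
    induction k with
    | zero => intro w _; simp [hZ0]
    | succ k ih =>
      intro w hw
      have h1 := (convex_ball (0 : ℂ) δ).norm_image_sub_le_of_norm_hasDerivWithin_le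
        (f := (Z (k + 1)).1) (f' := fun w => M w ((Z k).1 w)) (C := C * (‖y₀‖ * (1 / 2) ^ k))
        (fun u hu => (hZ2 k u hu).hasDerivWithinAt)
        (fun u hu => (M u).le_of_opNorm_le_of_le (hMb u hu) (ih u hu)) hw₁ hw
      rw [hZ1, sub_zero] at h1
      have h2 : ‖w - w₁‖ ≤ 2 * δ := by
        have h3 := mem_ball_zero_iff.1 hw
        have h4 := mem_ball_zero_iff.1 hw₁
        have := norm_sub_le w w₁
        linarith
      calc ‖(Z (k + 1)).1 w‖ ≤ C * (‖y₀‖ * (1 / 2) ^ k) * (2 * δ) :=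
            h1.trans (mul_le_mul_of_nonneg_left h2 (by positivity))
        _ = (2 * δ * C) * (‖y₀‖ * (1 / 2) ^ k) := by ring
        _ ≤ (1 / 2) * (‖y₀‖ * (1 / 2) ^ k) := by gcongr
        _ = ‖y₀‖ * (1 / 2) ^ (k + 1) := by ring
  have hsum : Summable fun k : ℕ => ‖y₀‖ * (1 / 2 : ℝ) ^ k :=
    summable_geometric_two.mul_left _
  have hZs : ∀ w ∈ D, Summable fun k => (Z k).1 w := fun w hw =>
    Summable.of_norm_bounded hsum fun k => hZb k w hw
  -- The derivatives of the increments are `M` applied to the increments shifted by one, so termwise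
  -- differentiation of the sum gives the equation back.
  let g' : ℕ → ℂ → E := fun k => Nat.casesOn k (fun _ => 0) fun k w => M w ((Z k).1 w)
  have hg' : ∀ k, ∀ w ∈ D, HasDerivAt (Z k).1 (g' k w) w := by
    intro k w hw
    cases k with
    | zero => exact hasDerivAt_const w y₀
    | succ k => exact hZ2 k w hw
  have hg'b : ∀ k, ∀ w ∈ D, ‖g' k w‖ ≤ 2 * C * (‖y₀‖ * (1 / 2) ^ k) := by
    intro k w hw
    cases k with
    | zero =>
      change ‖(0 : E)‖ ≤ _
      rw [norm_zero]
      positivity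
    | succ k =>
      refine ((M w).le_of_opNorm_le_of_le (hMb w hw) (hZb k w hw)).trans (le_of_eq ?_)
      ring
  refine ⟨fun w => ∑' k, (Z k).1 w, ?_, fun w hw => ?_⟩
  · simp only
    refine (tsum_eq_single 0 fun k hk => ?_).trans (congrFun hZ0 w₁)
    obtain ⟨k, rfl⟩ := Nat.exists_eq_succ_of_ne_zero hk
    exact hZ1 k
  · have h1 := hasDerivAt_tsum_of_isPreconnected (hsum.mul_left (2 * C)) Metric.isOpen_ball
      (convex_ball (0 : ℂ) δ).isPreconnected hg' hg'b hw₁ (hZs w₁ hw₁) hw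
    have h2 : ∑' k, g' k w = M w (∑' k, (Z k).1 w) := by
      have h3 : Summable fun k => g' k w :=
        Summable.of_norm_bounded (hsum.mul_left (2 * C)) fun k => hg'b k w hw
      rw [h3.tsum_eq_zero_add, (M w).map_tsum (hZs w hw)]
      simp [g']
    rwa [h2] at h1

/-- A solution of a linear system which vanishes at one point vanishes near this point. -/
theorem eventually_eq_zero_of_linear_system {E : Type*} [NormedAddCommGroup E]
    [NormedSpace ℂ E] {M : ℂ → E →L[ℂ] E} {w₁ : ℂ} (hM : ContinuousAt M w₁)
    {y : ℂ → E} (hy : ∀ᶠ w in 𝓝 w₁, HasDerivAt y (M w (y w)) w) (h0 : y w₁ = 0) :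
    ∀ᶠ w in 𝓝 w₁, y w = 0 := by
  set C : ℝ := ‖M w₁‖ + 1 with hC
  have hC0 : 0 < C := by positivity
  have hev : ∀ᶠ w in 𝓝 w₁, ‖M w‖ < C :=
    hM.norm.eventually_lt continuousAt_const (by simp [hC])
  obtain ⟨δ₀, hδ₀, hb⟩ := Metric.eventually_nhds_iff_ball.1 (hev.and hy)
  set δ : ℝ := min (δ₀ / 2) (1 / (2 * C)) with hδ
  have hδpos : 0 < δ := lt_min (by positivity) (by positivity)
  have hδC : C * δ ≤ 1 / 2 := by
    have h1 : δ ≤ 1 / (2 * C) := min_le_right _ _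
    rw [le_div_iff₀ (by positivity)] at h1
    linarith
  have hsub : Metric.closedBall w₁ δ ⊆ Metric.ball w₁ δ₀ :=
    Metric.closedBall_subset_ball ((min_le_left _ _).trans_lt (by linarith))
  have hcont : ContinuousOn y (Metric.closedBall w₁ δ) := fun w hw =>
    (hb w (hsub hw)).2.continuousAt.continuousWithinAt
  -- At a maximum point of `‖y‖` on a small ball, the mean value inequality bounds the maximum by
  -- half of itself.
  obtain ⟨u, hu, hmax⟩ := (isCompact_closedBall w₁ δ).exists_isMaxOn
    ⟨w₁, Metric.mem_closedBall_self hδpos.le⟩ hcont.norm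
  have h1 := (convex_closedBall w₁ δ).norm_image_sub_le_of_norm_hasDerivWithin_le
    (f := y) (f' := fun w => M w (y w)) (C := C * ‖y u‖)
    (fun v hv => (hb v (hsub hv)).2.hasDerivWithinAt)
    (fun v hv => (M v).le_of_opNorm_le_of_le (hb v (hsub hv)).1.le (hmax hv))
    (Metric.mem_closedBall_self hδpos.le) hu
  rw [h0, sub_zero] at h1
  have h2 : ‖u - w₁‖ ≤ δ := by rwa [← dist_eq_norm]
  have h3 : ‖y u‖ ≤ (1 / 2) * ‖y u‖ := by
    calc ‖y u‖ ≤ C * ‖y u‖ * δ := h1.trans (mul_le_mul_of_nonneg_left h2 (by positivity))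
      _ = (C * δ) * ‖y u‖ := by ring
      _ ≤ (1 / 2) * ‖y u‖ := by gcongr
  have h4 : ‖y u‖ = 0 := by linarith [norm_nonneg (y u)]
  filter_upwards [Metric.closedBall_mem_nhds w₁ hδpos] with w hw
  have h5 : ‖y w‖ ≤ ‖y u‖ := hmax hw
  rw [h4] at h5
  exact norm_le_zero_iff.1 h5

/-- Germs of solutions of a linear equation with holomorphic coefficients extend to a disc of
uniform radius. -/
theorem exists_forall_solution_linear_equation {n : ℕ} {f : Fin n → ℂ → ℂ}
    (hf : ∀ i, AnalyticAt ℂ (f i) 0) : ∃ δ > 0, ∀ w₁ ∈ Metric.ball (0 : ℂ) δ, ∀ k : ℂ → ℂ,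
      AnalyticAt ℂ k w₁ →
      (∀ᶠ w in 𝓝 w₁, deriv^[n] k w + ∑ i, f i w * deriv^[n - (i + 1 : ℕ)] k w = 0) →
      ∃ g : ℂ → ℂ, (∀ w ∈ Metric.ball (0 : ℂ) δ, AnalyticAt ℂ g w) ∧ k =ᶠ[𝓝 w₁] g := by
  obtain ⟨r, hr, hfr⟩ := Metric.eventually_nhds_iff_ball.1
    (eventually_all.2 fun i => (hf i).eventually_analyticAt)
  let P : Fin n → (Fin n → ℂ) →L[ℂ] ℂ := fun i => ContinuousLinearMap.proj i
  -- This is the companion system: `M₀` is the shift, and `M₁` fills the last row. The coefficient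
  -- `f i` multiplies the derivative of order `n - (i + 1)`, whose index is `Fin.rev i`.
  let M₀ : (Fin n → ℂ) →L[ℂ] (Fin n → ℂ) := ContinuousLinearMap.pi fun j =>
    if h : (j : ℕ) + 1 < n then P ⟨j + 1, h⟩ else 0
  let M₁ : Fin n → (Fin n → ℂ) →L[ℂ] (Fin n → ℂ) := fun i => ContinuousLinearMap.pi fun j =>
    if (j : ℕ) + 1 < n then 0 else - P (Fin.rev i)
  let M : ℂ → (Fin n → ℂ) →L[ℂ] (Fin n → ℂ) := fun w => M₀ + ∑ i, f i w • M₁ i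
  have hM1 : ∀ w y (j : Fin n) (h : (j : ℕ) + 1 < n), M w y j = y ⟨j + 1, h⟩ := by
    intro w y j h
    simp [M, M₀, M₁, h, P]
  have hM2 : ∀ w y (j : Fin n), ¬ (j : ℕ) + 1 < n → M w y j = - ∑ i, f i w * y (Fin.rev i) := by
    intro w y j h
    simp [M, M₀, M₁, h, P]
  have hM : DifferentiableOn ℂ M (Metric.ball 0 r) := by
    intro w hw
    refine (DifferentiableAt.const_add _ ?_).differentiableWithinAt
    exact DifferentiableAt.fun_sum fun i _ =>
      ((hfr w hw i).differentiableAt).smul_const (M₁ i)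
  obtain ⟨δ, hδ, hδr, hsol⟩ := exists_forall_solution_linear_system hr hM
  refine ⟨δ, hδ, fun w₁ hw₁ k hk hode => ?_⟩
  -- For `n = 0` the equation reads `k = 0`, and there is no zeroth coordinate to extract.
  rcases Nat.eq_zero_or_pos n with hn | hn
  · subst hn
    refine ⟨0, fun w _ => analyticAt_const, ?_⟩
    filter_upwards [hode] with w hw
    simpa using hw
  let y : ℂ → Fin n → ℂ := fun w j => deriv^[j] k w
  have hka : ∀ᶠ w in 𝓝 w₁, AnalyticAt ℂ k w := hk.eventually_analyticAt
  have hy : ∀ᶠ w in 𝓝 w₁, HasDerivAt y (M w (y w)) w := by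
    filter_upwards [hka, hode] with w hw hw'
    rw [hasDerivAt_pi]
    intro j
    have h1 : HasDerivAt (fun w => y w j) (deriv^[(j : ℕ) + 1] k w) w := by
      rw [Function.iterate_succ_apply']
      exact (hw.iterated_deriv j).differentiableAt.hasDerivAt
    suffices h2 : M w (y w) j = deriv^[(j : ℕ) + 1] k w by rw [h2]; exact h1
    by_cases hj : (j : ℕ) + 1 < n
    · rw [hM1 w _ j hj]
    · have hj' : (j : ℕ) + 1 = n := by omega
      rw [hM2 w _ j hj, hj', eq_comm, eq_neg_iff_add_eq_zero]
      convert hw' using 2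
      refine Finset.sum_congr rfl fun i _ => ?_
      simp only [y, Fin.val_rev]
  obtain ⟨Y, hY0, hY⟩ := hsol w₁ hw₁ (y w₁)
  have hYd : DifferentiableOn ℂ Y (Metric.ball 0 δ) := fun w hw =>
    (hY w hw).differentiableAt.differentiableWithinAt
  have hMc : ContinuousAt M w₁ :=
    (hM.differentiableAt (Metric.isOpen_ball.mem_nhds
      (Metric.ball_subset_ball hδr hw₁))).continuousAt
  have hzero := eventually_eq_zero_of_linear_system (y := fun w => y w - Y w) hMc (by
    filter_upwards [hy, Metric.isOpen_ball.mem_nhds hw₁] with w h1 h2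
    rw [map_sub]
    exact h1.fun_sub (hY w h2)) (by simp [hY0])
  refine ⟨fun w => Y w ⟨0, hn⟩, fun w hw => ?_, ?_⟩
  · refine DifferentiableOn.analyticAt (s := Metric.ball 0 δ) ?_ (Metric.isOpen_ball.mem_nhds hw)
    exact differentiableOn_pi.1 hYd ⟨0, hn⟩
  · filter_upwards [hzero] with w hw
    have := congrFun (sub_eq_zero.1 hw) ⟨0, hn⟩
    simpa [y] using this

/-! ### Linear differential equations on the sphere -/

theorem iterate_sphereDeriv_chart (F : Sphere → ℂ) (z : ℂ) (n : ℕ) :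
    (fun w => sphereDeriv^[n] F (chart (z : Sphere) w)) =
      deriv^[n] fun w => F (chart (z : Sphere) w) := by
  induction n with
  | zero => rfl
  | succ n ih =>
    simp only [Function.iterate_succ_apply', ← ih]
    funext w
    exact sphereDeriv_chart _ _ _

theorem iterate_sphereDeriv_congr {F G : Sphere → ℂ} {a : Sphere} (h : F =ᶠ[𝓝 a] G) (n : ℕ) :
    sphereDeriv^[n] F =ᶠ[𝓝 a] sphereDeriv^[n] G := by
  induction n with
  | zero => exact h
  | succ n ih =>
    simp only [Function.iterate_succ_apply']
    exact sphereDeriv_congr ih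

theorem HolomorphicAt.iterate_sphereDeriv {F : Sphere → ℂ} {a : Sphere} (h : HolomorphicAt F a)
    (n : ℕ) : HolomorphicAt (SFun.sphereDeriv^[n] F) a := by
  induction n with
  | zero => exact h
  | succ n ih =>
    rw [Function.iterate_succ_apply']
    exact ih.sphereDeriv

theorem iterate_derivGerm_coe {a : Sphere} {χ : RegularGermAt a} {K : Sphere → ℂ}
    (h : (χ : (𝓝 a).Germ ℂ) = K) (n : ℕ) :
    ((derivGerm^[n] χ : RegularGermAt a) : (𝓝 a).Germ ℂ) = (sphereDeriv^[n] K : Sphere → ℂ) := by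
  induction n with
  | zero => exact h
  | succ n ih =>
    simp only [Function.iterate_succ_apply']
    change germDeriv _ = _
    rw [ih]
    rfl

/-- At a finite point to which all coefficients continue, every solution extends to one and the same
disc, so continuation never stops there. The point `∞` is forbidden because in the coordinate `w = 1
/ x` the derivation is `-w ^ 2 * d/dw`, which makes the leading coefficient vanish. -/
theorem isSGerm_of_linear_equation {n : ℕ} {a : Sphere} {φ : Fin n → RegularGermAt a}
    {χ : RegularGermAt a} (hφ : ∀ i, IsSGerm ⟨a, φ i⟩)
    (h : derivGerm^[n] χ + ∑ i : Fin n, φ i * derivGerm^[n - (i + 1 : ℕ)] χ = 0) :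
    IsSGerm ⟨a, χ⟩ := by
  choose F hF hφF using fun i => (φ i).2
  have hφg : ∀ i, (⟨a, φ i⟩ : RegularGerm) = germAt (F i) a (hF i) := fun i =>
    Rep.ext (F := F i) rfl (hφF i) (rep_germAt _ _ _)
  obtain ⟨K, hK, hχK⟩ := χ.2
  have hχg : (⟨a, χ⟩ : RegularGerm) = germAt K a hK := Rep.ext (F := K) rfl hχK (rep_germAt _ _ _)
  rw [hχg]
  let Op : (Option (Fin n) → Sphere → ℂ) → Sphere → ℂ := fun F z =>
    sphereDeriv^[n] (F none) z +
      ∑ i : Fin n, F (Option.some i) z * sphereDeriv^[n - (i + 1 : ℕ)] (F none) z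
  have hop : ∀ F G z, (∀ i, F i =ᶠ[𝓝 z] G i) → Op F =ᶠ[𝓝 z] Op G := by
    intro F G z hFG
    filter_upwards [iterate_sphereDeriv_congr (hFG none) n, eventually_all.2 hFG,
      eventually_all.2 fun i : Fin n => iterate_sphereDeriv_congr (hFG none) (n - (i + 1 : ℕ))]
      with w h1 h2 h3
    simp only [Op, h1, h2, h3]
  have hhol : ∀ F z, (∀ i, HolomorphicAt (F i) z) → HolomorphicAt (Op F) z := fun F z hF =>
    ((hF none).iterate_sphereDeriv n).add
      (HolomorphicAt.sum fun i _ => (hF (Option.some i)).mul ((hF none).iterate_sphereDeriv _))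
  have hrel : ∀ᶠ z in 𝓝 a, Op (fun o => Option.elim o K F) z = 0 := by
    have h1 := congrArg (fun ξ : RegularGermAt a => (ξ : (𝓝 a).Germ ℂ)) h
    simp only [Subring.coe_add, AddSubmonoidClass.coe_finsetSum, Subring.coe_mul,
      Subring.coe_zero, iterate_derivGerm_coe hχK, hφF] at h1
    refine Filter.Germ.coe_eq.1 (Eq.trans ?_ h1)
    have h2 : ∀ (s : Finset (Fin n)) (f : Fin n → Sphere → ℂ),
        ((fun z => ∑ i ∈ s, f i z : Sphere → ℂ) : (𝓝 a).Germ ℂ) =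
          ∑ i ∈ s, ((f i : Sphere → ℂ) : (𝓝 a).Germ ℂ) := by
      intro s f
      induction s using Finset.cons_induction with
      | empty => simp; rfl
      | cons i s hi ih =>
        simp only [Finset.sum_cons]
        rw [← ih]
        rfl
    have h3 : ∀ i : Fin n, ((F i : Sphere → ℂ) : (𝓝 a).Germ ℂ) *
        ((sphereDeriv^[n - (i + 1 : ℕ)] K : Sphere → ℂ) : (𝓝 a).Germ ℂ) =
        ((fun z => F i z * sphereDeriv^[n - (i + 1 : ℕ)] K z : Sphere → ℂ) : (𝓝 a).Germ ℂ) :=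
      fun i => rfl
    simp only [h3]
    rw [← h2]
    rfl
  set A : Set Sphere := insert ∞ (⋃ i, singularSet (germAt (F i) a (hF i))) with hA_def
  have hAF : ∀ i, singularSet (germAt (F i) a (hF i)) ⊆ A := fun i =>
    (Set.subset_iUnion (fun i => singularSet (germAt (F i) a (hF i))) i).trans
      (Set.subset_insert ∞ _)
  refine isSGerm_of_eventually _ (A := A)
    ((Set.countable_iUnion fun i => by rw [← hφg i]; exact hφ i).insert ∞) ?_
  filter_upwards [eventually_all.2 fun i => eventually_avoiding (hF i) (hAF i),
    eventually_all.2 fun i => (hF i).eventually, eventually_eventually_nhds.2 hrel]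
    with z hz hFz hrelz _ hKz γ hγ h0 hA
  choose Φ hΦ using fun i => hz i (hFz i) γ hγ h0 hA
  have hΦc := fun i => (hΦ i).continuous hγ
  have hfin : ∀ t, γ t ≠ ∞ := fun t ht => hA t (by rw [ht]; exact Set.mem_insert _ _)
  refine exists_continuation_of_local hγ h0 fun T => ?_
  obtain ⟨z₀, hz₀⟩ := OnePoint.ne_infty_iff_exists.1 (hfin T)
  have hG := fun i => rep_spec (Φ i T)
  have hGh := fun i => (hG i).holomorphicAt
  simp only [fun i => (hΦ i).base T unitInterval.le_one', ← hz₀] at hGh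
  obtain ⟨δ, hδ, hsol⟩ := exists_forall_solution_linear_equation
    (fun i => holomorphicAt_iff_chart.1 (hGh i))
  refine ⟨disc z₀ δ, by rw [← hz₀]; exact disc_mem_nhds _ hδ, ?_⟩
  have hV : ∀ᶠ τ in 𝓝 T, γ τ ∈ disc z₀ δ :=
    hγ.continuousAt.eventually (by rw [← hz₀]; exact disc_mem_nhds _ hδ)
  filter_upwards [hV, eventually_all.2 fun i => (hΦc i).continuousAt.eventually (hG i).eventually]
    with τ hτV hτG Ξ hΞ
  have hΞb := hΞ.base τ le_rfl
  have hL := rep_spec (Ξ τ)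
  have hperm := permanence_eq (s := Set.Iic τ) (γ := γ) (Φ := fun o => Option.elim o Ξ Φ)
    (Set.ordConnected_Iic.isPreconnected) hγ.continuousOn (by
      rintro (_ | i) t ht
      · exact hΞ.base t ht
      · exact (hΦ i).base t unitInterval.le_one') (by
      rintro (_ | i)
      · exact hΞ.continuousOn hγ
      · exact (hΦc i).continuousOn)
    hop hhol (t₀ := 0) (t₁ := τ) (Set.mem_Iic.2 unitInterval.nonneg') Set.self_mem_Iic (by
      rw [h0]
      filter_upwards [hrelz, hop (fun o => rep (Option.elim o Ξ Φ 0))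
        (fun o => Option.elim o K F) z (by
          rintro (_ | i)
          · simp only [Option.elim, hΞ.start]
            exact rep_germAt_eventuallyEq hKz
          · simp only [Option.elim, (hΦ i).start]
            exact rep_germAt_eventuallyEq (hFz i))] with w h1 h2
      exact h2.trans h1)
  obtain ⟨w₁, hw₁, hw₁τ⟩ := hτV
  -- The coefficient germs at time `τ` are expressed by the representatives at time `T`, for which
  -- the disc was chosen.
  have hperm2 : ∀ᶠ u in 𝓝 (γ τ), Op (fun o => Option.elim o (rep (Ξ τ)) fun i => rep (Φ i T)) u
      = 0 := by
    filter_upwards [hperm, hop (fun o => rep (Option.elim o Ξ Φ τ))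
      (fun o => Option.elim o (rep (Ξ τ)) fun i => rep (Φ i T)) (γ τ) (by
        rintro (_ | i)
        · exact EventuallyEq.rfl
        · rw [← (hΦ i).base τ unitInterval.le_one']
          exact (rep_spec (Φ i τ)).eventuallyEq (hτG i))] with u h1 h2
    exact h2.symm.trans h1
  rw [← hw₁τ, eventually_chart_iff] at hperm2
  have hLh := hL.holomorphicAt
  rw [hΞb, ← hw₁τ, holomorphicAt_chart_iff] at hLh
  obtain ⟨g, hg, hkg⟩ := hsol w₁ hw₁ (fun w => rep (Ξ τ) (chart z₀ w)) hLh (by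
    filter_upwards [hperm2] with w hw
    simpa only [Op, Option.elim, ← iterate_sphereDeriv_chart] using hw)
  obtain ⟨G, hGg⟩ := exists_comp_chart (z₀ : Sphere) g
  refine ⟨G, hL.congr ?_, ?_⟩
  · rw [hΞb, ← hw₁τ]
    refine eventually_chart_iff.2 ?_
    filter_upwards [hkg] with w hw
    rw [hGg]
    exact hw
  · rintro _ ⟨w, hw, rfl⟩
    rw [holomorphicAt_chart_iff]
    simp only [hGg]
    exact hg w hw

/-! ### Separable equations over a domain -/

open Polynomial in
/-- An element algebraic over a domain of characteristic zero is a root of a polynomial which is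
coprime to its derivative up to a nonzero constant. -/
theorem exists_separable_annihilator {R D : Type*} [CommRing R] [IsDomain R] [CharZero R]
    [CommRing D] [IsDomain D] [Algebra R D] (hinj : Function.Injective (algebraMap R D)) {x : D}
    {p : R[X]} (hp : p ≠ 0) (hpx : aeval x p = 0) : ∃ (M u v : R[X]) (r : R), M ≠ 0 ∧
      aeval x M = 0 ∧ r ≠ 0 ∧ u * M + v * derivative M = C r := by
  classical
  let Q : ℕ → Prop := fun n => ∃ q : R[X], q ≠ 0 ∧ aeval x q = 0 ∧ q.natDegree = n
  have hQ : ∃ n, Q n := ⟨_, p, hp, hpx, rfl⟩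
  obtain ⟨M, hM0, hMx, hMd⟩ := Nat.find_spec hQ
  have hmin : ∀ q : R[X], q ≠ 0 → q.natDegree < M.natDegree → aeval x q ≠ 0 := by
    intro q hq hlt h
    rw [hMd] at hlt
    exact Nat.find_min hQ hlt ⟨q, hq, h, rfl⟩
  have hdeg : M.natDegree ≠ 0 := by
    intro h
    rw [natDegree_eq_zero] at h
    obtain ⟨c, rfl⟩ := h
    rw [aeval_C] at hMx
    exact hM0 (by rw [(map_eq_zero_iff _ hinj).1 hMx, C_0])
  let k := FractionRing R
  have hk : Function.Injective (algebraMap R k) := IsFractionRing.injective R k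
  have hkp : Function.Injective (Polynomial.map (algebraMap R k)) := Polynomial.map_injective _ hk
  have clear : ∀ g : k[X], ∃ b : R, b ≠ 0 ∧ ∃ q : R[X],
      q.map (algebraMap R k) = C (algebraMap R k b) * g := by
    intro g
    obtain ⟨b, hb, h⟩ := IsLocalization.integerNormalization_spec (nonZeroDivisors R) g
    refine ⟨b, nonZeroDivisors.ne_zero hb, _, h.trans ?_⟩
    rw [← Polynomial.smul_eq_C_mul, algebraMap_smul]
  -- `M` annihilates `x` with least degree. Factors over the fraction field, cleared of
  -- denominators, have a product that vanishes at `x` in the domain `D`, so one of them would be an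
  -- annihilator of smaller degree.
  have hirr : Irreducible (M.map (algebraMap R k)) := by
    refine ⟨fun h => hdeg ?_, fun g h hgh => ?_⟩
    · have := natDegree_eq_zero_of_isUnit h
      rwa [natDegree_map_eq_of_injective hk] at this
    · by_contra hcon
      push Not at hcon
      have hMk : M.map (algebraMap R k) ≠ 0 := by rwa [Ne, Polynomial.map_eq_zero_iff hk]
      have hg0 : g ≠ 0 := by rintro rfl; exact hMk (by simpa using hgh)
      have hh0 : h ≠ 0 := by rintro rfl; exact hMk (by simpa using hgh)
      have hgd : g.natDegree ≠ 0 := fun h' => hcon.1 (by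
        rw [Polynomial.isUnit_iff_degree_eq_zero, degree_eq_natDegree hg0, h']; rfl)
      have hhd : h.natDegree ≠ 0 := fun h' => hcon.2 (by
        rw [Polynomial.isUnit_iff_degree_eq_zero, degree_eq_natDegree hh0, h']; rfl)
      have hsum : M.natDegree = g.natDegree + h.natDegree := by
        rw [← natDegree_map_eq_of_injective hk M, hgh, natDegree_mul hg0 hh0]
      obtain ⟨b, hb, g', hg'⟩ := clear g
      obtain ⟨c, hc, h', hh'⟩ := clear h
      have hbk : algebraMap R k b ≠ 0 := by rwa [Ne, map_eq_zero_iff _ hk]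
      have hck : algebraMap R k c ≠ 0 := by rwa [Ne, map_eq_zero_iff _ hk]
      have hg'd : g'.natDegree = g.natDegree := by
        rw [← natDegree_map_eq_of_injective hk g', hg', natDegree_C_mul hbk]
      have hh'd : h'.natDegree = h.natDegree := by
        rw [← natDegree_map_eq_of_injective hk h', hh', natDegree_C_mul hck]
      have hprod : g' * h' = C (b * c) * M := by
        apply hkp
        rw [Polynomial.map_mul, Polynomial.map_mul, hg', hh', hgh, Polynomial.map_C, map_mul, C_mul]
        ring
      have hzero : aeval x g' * aeval x h' = 0 := by
        rw [← map_mul, hprod, map_mul, hMx, mul_zero]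
      rcases mul_eq_zero.1 hzero with h1 | h1
      · exact hmin g' (fun h => hgd (by rw [← hg'd, h, natDegree_zero])) (by omega) h1
      · exact hmin h' (fun h => hhd (by rw [← hh'd, h, natDegree_zero])) (by omega) h1
  have : CharZero k := charZero_of_injective_algebraMap hk
  -- In characteristic zero irreducibility gives separability; the constant `r` is the product of
  -- the denominators cleared from the Bezout coefficients.
  obtain ⟨u, v, huv⟩ := hirr.separable
  obtain ⟨b, hb, u', hu'⟩ := clear u
  obtain ⟨c, hc, v', hv'⟩ := clear v
  refine ⟨M, C c * u', C b * v', b * c, hM0, hMx, mul_ne_zero hb hc, hkp ?_⟩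
  rw [Polynomial.map_add, Polynomial.map_mul, Polynomial.map_mul, Polynomial.map_mul,
    Polynomial.map_mul, hu', hv', Polynomial.map_C, Polynomial.map_C, Polynomial.map_C,
    ← Polynomial.derivative_map, map_mul, C_mul]
  linear_combination (C (algebraMap R k b) * C (algebraMap R k c)) * huv

/-! ### Simple roots depend analytically on the coefficients -/

/-- A simple root of a polynomial extends to an analytic family of roots. -/
theorem exists_analytic_root {d : ℕ} {f : Fin (d + 1) → ℂ → ℂ} (hf : ∀ i, AnalyticAt ℂ (f i) 0)
    {c : ℂ} (hc : ∑ i, f i 0 * c ^ (i : ℕ) = 0)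
    (hc' : ∑ i, f i 0 * ((i : ℕ) * c ^ ((i : ℕ) - 1)) ≠ 0) :
    ∃ ρ : ℂ → ℂ, AnalyticAt ℂ ρ 0 ∧ ρ 0 = c ∧ ∀ᶠ w in 𝓝 0, ∑ i, f i w * ρ w ^ (i : ℕ) = 0 := by
  let P : ℂ × ℂ → ℂ := fun q => ∑ i, f i q.1 * q.2 ^ (i : ℕ)
  have hP : AnalyticAt ℂ P (0, c) := by
    refine Finset.analyticAt_fun_sum _ fun i _ => ?_
    refine AnalyticAt.fun_mul ?_ (analyticAt_snd.fun_pow _)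
    exact AnalyticAt.fun_comp (f := Prod.fst) (hf i) analyticAt_fst
  have hcd : ContDiffAt ℂ ⊤ P (0, c) := hP.contDiffAt
  have hd : (fderiv ℂ P (0, c) ∘L .inr ℂ ℂ ℂ) 1 = ∑ i, f i 0 * ((i : ℕ) * c ^ ((i : ℕ) - 1)) := by
    have h1 : HasFDerivAt P (fderiv ℂ P (0, c)) (0, c) := hP.differentiableAt.hasFDerivAt
    have h2 : HasFDerivAt (fun y : ℂ => P (0, y)) (fderiv ℂ P (0, c) ∘L .inr ℂ ℂ ℂ) c :=
      HasFDerivAt.comp (f := fun y : ℂ => ((0 : ℂ), y)) c h1 (hasFDerivAt_prodMk_right 0 c)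
    have h3 : HasDerivAt (fun y : ℂ => P (0, y))
        (∑ i, f i 0 * (((i : ℕ) : ℂ) * c ^ ((i : ℕ) - 1))) c := by
      refine HasDerivAt.fun_sum fun i _ => ?_
      exact (hasDerivAt_pow (i : ℕ) c).const_mul (f i 0)
    exact h2.hasDerivAt.unique h3
  -- The partial derivative in the root variable is multiplication by a nonzero scalar, so the
  -- implicit function theorem applies.
  have hinv : (fderiv ℂ P (0, c) ∘L .inr ℂ ℂ ℂ).IsInvertible := by
    set e := ∑ i, f i 0 * (((i : ℕ) : ℂ) * c ^ ((i : ℕ) - 1)) with he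
    refine ⟨ContinuousLinearEquiv.unitsEquivAut ℂ (Units.mk0 e hc'), ?_⟩
    ext
    simp [hd]
  refine ⟨hcd.implicitFunction (by simp) hinv, ?_, ?_, ?_⟩
  · exact (hcd.contDiffAt_implicitFunction (by simp) hinv).analyticAt
  · exact hcd.implicitFunction_apply_self (by simp) hinv
  · filter_upwards [hcd.eventually_apply_implicitFunction (by simp) hinv] with w hw
    exact hw.trans hc

open Polynomial in
/-- Near a parameter where all roots are simple, the roots of an analytic family of polynomials
are given by finitely many analytic functions. -/
theorem exists_analytic_roots {d : ℕ} {f : Fin (d + 1) → ℂ → ℂ} (hf : ∀ i, AnalyticAt ℂ (f i) 0)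
    (hlead : f (Fin.last d) 0 ≠ 0)
    (hsimple : ∀ y, ∑ i, f i 0 * y ^ (i : ℕ) = 0 → ∑ i, f i 0 * ((i : ℕ) * y ^ ((i : ℕ) - 1)) ≠ 0) :
    ∃ (s : Finset ℂ) (ρ : ℂ → ℂ → ℂ), ∃ δ > 0,
      (∀ c ∈ s, ∀ w ∈ Metric.ball (0 : ℂ) δ, AnalyticAt ℂ (ρ c) w) ∧
      ∀ w ∈ Metric.ball (0 : ℂ) δ, ∀ y, ∑ i, f i w * y ^ (i : ℕ) = 0 → ∃ c ∈ s, y = ρ c w := by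
  classical
  let q : ℂ → ℂ[X] := fun w => ∑ i : Fin (d + 1), C (f i w) * X ^ (i : ℕ)
  have hqe : ∀ w y, (q w).eval y = ∑ i, f i w * y ^ (i : ℕ) := fun w y => by
    simp [q, eval_finsetSum]
  have hqd : ∀ w y, (derivative (q w)).eval y = ∑ i, f i w * ((i : ℕ) * y ^ ((i : ℕ) - 1)) :=
    fun w y => by simp [q, eval_finsetSum, derivative_X_pow]
  have hcoeff : ∀ w, (q w).coeff d = f (Fin.last d) w := by
    intro w
    simp only [q, finsetSum_coeff, coeff_C_mul, coeff_X_pow]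
    rw [Finset.sum_eq_single (Fin.last d)]
    · simp
    · intro i _ hi
      rw [if_neg, mul_zero]
      intro h
      exact hi (Fin.ext (by simpa using h.symm))
    · simp
  have hdeg : ∀ w, f (Fin.last d) w ≠ 0 → (q w).natDegree = d := by
    intro w hw
    refine natDegree_eq_of_le_of_coeff_ne_zero ?_ ?_
    · refine natDegree_sum_le_of_forall_le _ _ fun i _ => ?_
      exact (natDegree_C_mul_X_pow_le _ _).trans (Nat.lt_succ_iff.1 i.2)
    · rw [hcoeff]
      exact hw
  have hne : ∀ w, f (Fin.last d) w ≠ 0 → q w ≠ 0 := by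
    intro w hw h0
    have := hcoeff w
    rw [h0, coeff_zero] at this
    exact hw this.symm
  set s := (q 0).roots.toFinset with hs
  have hroot : ∀ c ∈ s, ∑ i, f i 0 * c ^ (i : ℕ) = 0 := by
    intro c hc
    rw [hs, Multiset.mem_toFinset, mem_roots (hne 0 hlead), IsRoot.def, hqe] at hc
    exact hc
  -- Simple roots are distinct, so there are `d` of them. Their analytic extensions stay distinct
  -- nearby and therefore exhaust the roots of a polynomial that still has degree `d`.
  have hcard : s.card = d := by
    rw [hs, Multiset.toFinset_card_of_nodup, IsAlgClosed.card_roots_eq_natDegree, hdeg 0 hlead]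
    rw [Multiset.nodup_iff_count_le_one]
    intro c
    rw [count_roots]
    by_contra hcon
    rw [not_le, one_lt_rootMultiplicity_iff_isRoot (hne 0 hlead)] at hcon
    have h1 := hcon.1
    have h2 := hcon.2
    rw [IsRoot.def, hqe] at h1
    rw [IsRoot.def, hqd] at h2
    exact hsimple c h1 h2
  have hρ : ∀ c, ∃ ρ : ℂ → ℂ, c ∈ s → AnalyticAt ℂ ρ 0 ∧ ρ 0 = c ∧
      ∀ᶠ w in 𝓝 0, ∑ i, f i w * ρ w ^ (i : ℕ) = 0 := by
    intro c
    by_cases hc : c ∈ s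
    · obtain ⟨ρ, h⟩ := exists_analytic_root hf (hroot c hc) (hsimple c (hroot c hc))
      exact ⟨ρ, fun _ => h⟩
    · exact ⟨0, fun h => absurd h hc⟩
  choose ρ hρ using hρ
  have hev : ∀ᶠ w in 𝓝 (0 : ℂ), f (Fin.last d) w ≠ 0 ∧ (∀ c ∈ s, AnalyticAt ℂ (ρ c) w ∧
      ∑ i, f i w * ρ c w ^ (i : ℕ) = 0) ∧ ∀ c ∈ s, ∀ c' ∈ s, c ≠ c' → ρ c w ≠ ρ c' w := by
    refine ((hf _).continuousAt.eventually_ne hlead).and (.and ?_ ?_)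
    · refine (Finset.eventually_all s).2 fun c hc => ?_
      exact (hρ c hc).1.eventually_analyticAt.and (hρ c hc).2.2
    · refine (Finset.eventually_all s).2 fun c hc => (Finset.eventually_all s).2 fun c' hc' => ?_
      by_cases hcc : c = c'
      · simp [hcc]
      · have : ρ c 0 ≠ ρ c' 0 := by rwa [(hρ c hc).2.1, (hρ c' hc').2.1]
        filter_upwards [((hρ c hc).1.continuousAt.sub
          (hρ c' hc').1.continuousAt).eventually_ne (sub_ne_zero.2 this)] with w hw _
        exact sub_ne_zero.1 hw
  obtain ⟨δ, hδ, h⟩ := Metric.eventually_nhds_iff_ball.1 hev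
  refine ⟨s, ρ, δ, hδ, fun c hc w hw => ((h w hw).2.1 c hc).1, fun w hw y hy => ?_⟩
  obtain ⟨h1, h2, h3⟩ := h w hw
  have hinj : Set.InjOn (fun c => ρ c w) s := fun c hc c' hc' he => by
    by_contra hcon
    exact h3 c hc c' hc' hcon he
  have hsub : s.image (fun c => ρ c w) ⊆ (q w).roots.toFinset := by
    intro y hy
    obtain ⟨c, hc, rfl⟩ := Finset.mem_image.1 hy
    rw [Multiset.mem_toFinset, mem_roots (hne w h1), IsRoot.def, hqe]
    exact (h2 c hc).2
  have heq := Finset.eq_of_subset_of_card_le hsub (by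
    rw [Finset.card_image_of_injOn hinj, hcard]
    exact (Multiset.toFinset_card_le _).trans ((card_roots' _).trans (hdeg w h1).le))
  have hyr : y ∈ (q w).roots.toFinset := by
    rw [Multiset.mem_toFinset, mem_roots (hne w h1), IsRoot.def, hqe]
    exact hy
  rw [← heq] at hyr
  obtain ⟨c, hc, rfl⟩ := Finset.mem_image.1 hyr
  exact ⟨c, hc, rfl⟩

/-! ### The ring of germs with given singular points -/

/-- Two nonzero germs are both free of zeros on a punctured neighbourhood, so their product is not
zero. -/
theorem isDomain_regularGermAt (a : Sphere) : IsDomain (RegularGermAt a) := by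
  have : Nontrivial (RegularGermAt a) :=
    ((Filter.Germ.valueRingHom (x := a) (E := ℂ)).comp
      (RegularGermAt a).subtype).domain_nontrivial
  have : NoZeroDivisors (RegularGermAt a) := by
    refine ⟨fun {φ ψ} h => ?_⟩
    obtain ⟨_, F, hF, rfl⟩ := φ
    obtain ⟨_, G, hG, rfl⟩ := ψ
    have hFG : ∀ᶠ z in 𝓝 a, F z * G z = 0 := Filter.Germ.coe_eq.1 (congrArg Subtype.val h)
    rcases hF.eventually_eq_zero_or with h1 | h1
    · exact Or.inl (Subtype.ext (Filter.Germ.coe_eq.2 h1))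
    rcases hG.eventually_eq_zero_or with h2 | h2
    · exact Or.inr (Subtype.ext (Filter.Germ.coe_eq.2 h2))
    have := nhdsNE_sphere_neBot a
    obtain ⟨z, h3, h4, h5⟩ := (h1.and (h2.and (hFG.filter_mono nhdsWithin_le_nhds))).exists
    exact absurd h5 (mul_ne_zero h3 h4)
  exact NoZeroDivisors.to_isDomain _

theorem charZero_regularGermAt (a : Sphere) : CharZero (RegularGermAt a) :=
  ((Filter.Germ.valueRingHom (x := a) (E := ℂ)).comp (RegularGermAt a).subtype).charZero

/-- The singular points of a function obtained by a local operation. -/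
theorem singularSet_op_subset {ι : Type*} [Finite ι] {F : ι → Sphere → ℂ} {a : Sphere}
    (hF : ∀ i, HolomorphicAt (F i) a) {A : Set Sphere} (hA : A.Countable)
    (hFA : ∀ i, singularSet (germAt (F i) a (hF i)) ⊆ A)
    {Op : (ι → Sphere → ℂ) → Sphere → ℂ}
    (hop : ∀ F G z, (∀ i, F i =ᶠ[𝓝 z] G i) → Op F =ᶠ[𝓝 z] Op G)
    (hhol : ∀ F z, (∀ i, HolomorphicAt (F i) z) → HolomorphicAt (Op F) z) :
    singularSet (germAt (Op F) a (hhol F a hF)) ⊆ A := by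
  refine singularSet_subset_of_eventually _ hA ?_
  filter_upwards [eventually_all.2 fun i => eventually_avoiding (hF i) (hFA i),
    eventually_all.2 fun i => (hF i).eventually] with z hz hFz _ hKz γ hγ h0 hγA
  choose Φ hΦ using fun i => hz i (hFz i) γ hγ h0 hγA
  refine exists_continuation_op hγ hFz hΦ h0 hop (fun t => hhol _ _ fun i => ?_) hKz
    EventuallyEq.rfl
  rw [← (hΦ i).base t unitInterval.le_one']
  exact holomorphicAt_rep _

/-- The ring of germs whose singular points belong to a given countable set. -/
def subringSingularSetSubset (a : Sphere) {A : Set Sphere} (hA : A.Countable) :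
    Subring (RegularGermAt a) where
  carrier := {φ | singularSet ⟨a, φ⟩ ⊆ A}
  zero_mem' := singularSet_op_subset (ι := Empty) (F := Empty.rec) (fun i => i.elim) hA
    (fun i => i.elim) (Op := fun _ _ => 0) (fun _ _ _ _ => EventuallyEq.rfl)
    (fun _ _ _ => HolomorphicAt.const 0)
  one_mem' := singularSet_op_subset (ι := Empty) (F := Empty.rec) (fun i => i.elim) hA
    (fun i => i.elim) (Op := fun _ _ => 1) (fun _ _ _ _ => EventuallyEq.rfl)
    (fun _ _ _ => HolomorphicAt.const 1)
  add_mem' := by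
    rintro ⟨_, F, hF, rfl⟩ ⟨_, G, hG, rfl⟩ h1 h2
    exact singularSet_op_subset (ι := Bool) (F := fun b => Bool.casesOn b F G)
      (by rintro (_ | _) <;> assumption) hA (by rintro (_ | _) <;> assumption)
      (Op := fun F z => F false z + F true z)
      (fun F G z h => (h false).add (h true)) (fun F z h => (h false).add (h true))
  mul_mem' := by
    rintro ⟨_, F, hF, rfl⟩ ⟨_, G, hG, rfl⟩ h1 h2
    exact singularSet_op_subset (ι := Bool) (F := fun b => Bool.casesOn b F G)
      (by rintro (_ | _) <;> assumption) hA (by rintro (_ | _) <;> assumption)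
      (Op := fun F z => F false z * F true z)
      (fun F G z h => (h false).mul (h true)) (fun F z h => (h false).mul (h true))
  neg_mem' := by
    rintro ⟨_, F, hF, rfl⟩ h1
    exact singularSet_op_subset (ι := Unit) (F := fun _ => F) (fun _ => hF) hA (fun _ => h1)
      (Op := fun F z => - F () z) (fun F G z h => (h ()).neg) (fun F z h => (h ()).neg)

/-! ### Algebraic equations -/

open Polynomial in
theorem eval₂_derivative_eq_sum {R S : Type*} [CommRing R] [CommRing S] (f : R →+* S) (x : S)
    (p : R[X]) {N : ℕ} (h : p.natDegree < N) :
    eval₂ f x (derivative p) = ∑ i : Fin N, f (p.coeff i) * ((i : ℕ) * x ^ ((i : ℕ) - 1)) := by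
  conv_lhs => rw [p.as_sum_range' N h]
  rw [map_sum, eval₂_finsetSum, ← Fin.sum_univ_eq_sum_range
    (fun i => eval₂ f x (derivative (monomial i (p.coeff i))))]
  refine Finset.sum_congr rfl fun i _ => ?_
  rw [derivative_monomial, eval₂_monomial, map_mul, map_natCast, mul_assoc]

open Polynomial in
theorem eval₂_eq_sum_fin {R S : Type*} [CommRing R] [CommRing S] (f : R →+* S) (x : S)
    (p : R[X]) {N : ℕ} (h : p.natDegree < N) :
    eval₂ f x p = ∑ i : Fin N, f (p.coeff i) * x ^ (i : ℕ) := by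
  rw [eval₂_eq_sum_range' f h, ← Fin.sum_univ_eq_sum_range (fun i => f (p.coeff i) * x ^ i)]

/-- An analytic function whose values are among those of finitely many analytic functions coincides
with one of them. -/
theorem exists_eventuallyEq_of_eventually_mem {s : Finset ℂ} {ρ : ℂ → ℂ → ℂ} {k : ℂ → ℂ} {w₁ : ℂ}
    (hρ : ∀ c ∈ s, AnalyticAt ℂ (ρ c) w₁) (hk : AnalyticAt ℂ k w₁)
    (h : ∀ᶠ w in 𝓝 w₁, ∃ c ∈ s, k w = ρ c w) : ∃ c ∈ s, k =ᶠ[𝓝 w₁] ρ c := by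
  by_contra! hcon
  have h1 : ∀ᶠ w in 𝓝[≠] w₁, ∀ c ∈ s, k w ≠ ρ c w := by
    refine (Finset.eventually_all s).2 fun c hc => ?_
    by_contra h2
    have h3 : ∃ᶠ w in 𝓝[≠] w₁, k w = ρ c w := h2
    exact hcon c hc ((hk.frequently_eq_iff_eventually_eq (hρ c hc)).1 h3)
  obtain ⟨w, hw, c, hc, hw'⟩ := (h1.and (h.filter_mono nhdsWithin_le_nhds)).exists
  exact hw c hc hw'

open Polynomial in
-- The germs with singular points in `A` form a subring of a domain, over which `χ` is algebraic. A
-- polynomial of least degree annihilating `χ` satisfies a Bezout identity with its derivative.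
-- Where its leading coefficient and the Bezout constant do not vanish, the roots are distinct
-- analytic functions, and each branch of `χ` coincides with one of them.
theorem isSGerm_of_algebraic_equation {n : ℕ} {a : Sphere} {φ : Fin n → RegularGermAt a}
    {χ : RegularGermAt a} (hφ : ∀ i, IsSGerm ⟨a, φ i⟩)
    (h : χ ^ n + ∑ i : Fin n, φ i * χ ^ (n - (i + 1 : ℕ)) = 0) : IsSGerm ⟨a, χ⟩ := by
  have := isDomain_regularGermAt a
  have := charZero_regularGermAt a
  set A : Set Sphere := ⋃ i, singularSet ⟨a, φ i⟩ with hA_def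
  have hA : A.Countable := Set.countable_iUnion fun i => hφ i
  set R := subringSingularSetSubset a hA with hR
  have hRmem : ∀ x : R, singularSet ⟨a, (x : RegularGermAt a)⟩ ⊆ A := fun x => x.2
  let φ' : Fin n → R := fun i => ⟨φ i, Set.subset_iUnion (fun i => singularSet ⟨a, φ i⟩) i⟩
  let p : R[X] := X ^ n + ∑ i : Fin n, C (φ' i) * X ^ (n - (i + 1 : ℕ))
  have hp0 : p ≠ 0 := by
    have hm : p.Monic := by
      refine monic_X_pow_add ?_
      refine (degree_sum_le _ _).trans_lt ?_
      refine (Finset.sup_lt_iff (by exact WithBot.bot_lt_coe n)).2 fun i _ => ?_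
      refine (degree_C_mul_X_pow_le _ _).trans_lt ?_
      have := i.2
      exact_mod_cast (by omega : n - ((i : ℕ) + 1) < n)
    exact hm.ne_zero
  have hpx : aeval χ p = 0 := by
    rw [← h]
    simp only [p, map_add, map_pow, aeval_X, map_sum, map_mul, aeval_C]
    rfl
  obtain ⟨M, u, v, r, hM0, hMx, hr0, huv⟩ :=
    exists_separable_annihilator (R := R) (D := RegularGermAt a) Subtype.val_injective hp0 hpx
  set d := M.natDegree with hd
  obtain ⟨N, huN, hvN⟩ : ∃ N, u.natDegree < N ∧ v.natDegree < N :=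
    ⟨max u.natDegree v.natDegree + 1, by omega, by omega⟩
  let ι := Option (Fin (d + 1) ⊕ Fin N ⊕ Fin N)
  let G : ι → R := fun o => Option.elim o r
    (Sum.elim (fun i => M.coeff i) (Sum.elim (fun i => u.coeff i) fun i => v.coeff i))
  let F : ι → Sphere → ℂ := fun o => rep ⟨a, (G o : RegularGermAt a)⟩
  have hF : ∀ o, HolomorphicAt (F o) a := fun o => holomorphicAt_rep _
  have hFg : ∀ o, germAt (F o) a (hF o) = ⟨a, (G o : RegularGermAt a)⟩ := fun o =>
    (rep_spec _).germAt_eq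
  set K := rep ⟨a, χ⟩ with hK_def
  have hK : HolomorphicAt K a := holomorphicAt_rep _
  have hKg : germAt K a hK = ⟨a, χ⟩ := (rep_spec _).germAt_eq
  let cg : (Sphere → ℂ) →+* (𝓝 a).Germ ℂ := Filter.Germ.coeRingHom (𝓝 a)
  let f : R →+* (𝓝 a).Germ ℂ := (RegularGermAt a).subtype.comp R.subtype
  have hcgF : ∀ o, f (G o) = cg (F o) := fun o => rep_spec (⟨a, (G o : RegularGermAt a)⟩)
  have hcgK : ((χ : RegularGermAt a) : (𝓝 a).Germ ℂ) = cg K := rep_spec (⟨a, χ⟩ : RegularGerm)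
  let iM : Fin (d + 1) → ι := fun i => Option.some (Sum.inl i)
  let iu : Fin N → ι := fun i => Option.some (Sum.inr (Sum.inl i))
  let iv : Fin N → ι := fun i => Option.some (Sum.inr (Sum.inr i))
  -- the equation satisfied by `K`
  let Op₁ : (Option (Fin (d + 1)) → Sphere → ℂ) → Sphere → ℂ := fun F z =>
    ∑ i, F (Option.some i) z * F none z ^ (i : ℕ)
  have hop₁ : ∀ F G z, (∀ i, F i =ᶠ[𝓝 z] G i) → Op₁ F =ᶠ[𝓝 z] Op₁ G := by
    intro F G z hFG
    filter_upwards [eventually_all.2 hFG] with w hw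
    simp only [Op₁, hw]
  have hhol₁ : ∀ F z, (∀ i, HolomorphicAt (F i) z) → HolomorphicAt (Op₁ F) z := fun F z hF =>
    HolomorphicAt.sum fun i _ => (hF (Option.some i)).mul ((hF none).pow _)
  have hrel₁ : ∀ᶠ z in 𝓝 a, Op₁ (fun o => Option.elim o K fun i => F (iM i)) z = 0 := by
    have h1 : eval₂ f (cg K) M = 0 := by
      have h2 := congrArg (RegularGermAt a).subtype hMx
      rw [aeval_def, hom_eval₂, map_zero] at h2
      rw [← hcgK]
      exact h2
    rw [eval₂_eq_sum_fin f _ M (Nat.lt_succ_self _)] at h1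
    have h2 : cg (∑ i : Fin (d + 1), F (iM i) * K ^ (i : ℕ)) = cg 0 := by
      rw [map_sum, map_zero, ← h1]
      refine Finset.sum_congr rfl fun i _ => ?_
      rw [map_mul, map_pow, ← hcgF]
      rfl
    filter_upwards [Filter.Germ.coe_eq.1 h2] with z hz
    simpa [Op₁, Finset.sum_apply] using hz
  -- the Bezout identity, evaluated at a constant
  let Op₂ : ℂ → (ι → Sphere → ℂ) → Sphere → ℂ := fun y F z =>
    (∑ i, F (iu i) z * y ^ (i : ℕ)) * (∑ i, F (iM i) z * y ^ (i : ℕ)) +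
      (∑ i, F (iv i) z * y ^ (i : ℕ)) * (∑ i, F (iM i) z * ((i : ℕ) * y ^ ((i : ℕ) - 1)))
      - F none z
  have hop₂ : ∀ y F G z, (∀ i, F i =ᶠ[𝓝 z] G i) → Op₂ y F =ᶠ[𝓝 z] Op₂ y G := by
    intro y F G z hFG
    filter_upwards [eventually_all.2 hFG] with w hw
    simp only [Op₂, hw]
  have hhol₂ : ∀ y F z, (∀ i, HolomorphicAt (F i) z) → HolomorphicAt (Op₂ y F) z := by
    intro y F z hF
    have hs : ∀ {m : ℕ} (j : Fin m → ι) (e : Fin m → ℂ),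
        HolomorphicAt (fun z => ∑ i, F (j i) z * e i) z := fun j e =>
      HolomorphicAt.sum fun i _ => (hF (j i)).mul (HolomorphicAt.const _)
    exact (((hs iu _).mul (hs iM _)).add ((hs iv _).mul (hs iM _))).sub (hF none)
  have hrel₂ : ∀ y, ∀ᶠ z in 𝓝 a, Op₂ y F z = 0 := by
    intro y
    have h1 := congrArg (eval₂ f (cg fun _ => y)) huv
    rw [eval₂_add, eval₂_mul, eval₂_mul, eval₂_C, eval₂_eq_sum_fin f _ u huN,
      eval₂_eq_sum_fin f _ v hvN, eval₂_eq_sum_fin f _ M (Nat.lt_succ_self _),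
      eval₂_derivative_eq_sum f _ M (Nat.lt_succ_self _), ← sub_eq_zero] at h1
    let Y : Sphere → ℂ := fun _ => y
    have h2 : cg ((∑ i, F (iu i) * Y ^ (i : ℕ)) * (∑ i, F (iM i) * Y ^ (i : ℕ)) +
        (∑ i, F (iv i) * Y ^ (i : ℕ)) * (∑ i, F (iM i) * ((i : ℕ) * Y ^ ((i : ℕ) - 1)))
        - F none) = cg 0 := by
      rw [map_zero, ← h1]
      simp only [map_sub, map_add, map_mul, map_sum, map_pow, map_natCast, ← hcgF]
      rfl
    filter_upwards [Filter.Germ.coe_eq.1 h2] with z hz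
    simpa [Op₂, Finset.sum_apply, Y] using hz
  have hzero : ∀ o, G o ≠ 0 → ¬ Rep (germAt (F o) a (hF o)) fun _ => 0 := by
    intro o ho hrep
    rw [hFg] at hrep
    exact ho (Subtype.ext (Subtype.ext hrep))
  -- Zeros are collected over all branches of the coefficient, since the continuation path selects
  -- the branch.
  let Z : ι → Set Sphere := fun o =>
    {z | ∃ ψ ∈ connectedComponent (germAt (F o) a (hF o)), ψ.1 = z ∧ val ψ = 0}
  have hZr : (Z none).Countable := countable_setOf_val_eq (hzero none hr0)
  have hZl : (Z (iM (Fin.last d))).Countable := countable_setOf_val_eq (hzero _ (by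
    change M.coeff d ≠ 0
    exact leadingCoeff_ne_zero.2 hM0))
  rw [← hKg]
  refine isSGerm_of_eventually _ (A := A ∪ (Z none ∪ Z (iM (Fin.last d))))
    (hA.union (hZr.union hZl)) ?_
  -- One neighbourhood must serve all `y` at once; the identity principle on a fixed disc removes
  -- the dependence on `y`.
  have hrel₂' : ∀ᶠ z in 𝓝 a, ∀ y, ∀ᶠ w in 𝓝 z, Op₂ y F w = 0 := by
    obtain ⟨ρ, hρ, hdisc⟩ := exists_disc_subset (eventually_all.2 fun o => (hF o).eventually)
    filter_upwards [disc_mem_nhds a hρ] with z hz y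
    exact eventuallyEq_of_isPreconnected (G := fun _ => 0) (isPreconnected_disc a ρ)
      (fun w hw => hhol₂ y F w (hdisc hw)) (fun _ _ => HolomorphicAt.const 0)
      (mem_disc_self a hρ) hz (hrel₂ y)
  filter_upwards [eventually_all.2 fun o => eventually_avoiding (hF o)
      (A := A ∪ (Z none ∪ Z (iM (Fin.last d))))
      (by rw [hFg]; exact (hRmem (G o)).trans Set.subset_union_left),
    eventually_all.2 fun o => (hF o).eventually, eventually_eventually_nhds.2 hrel₁,
    eventually_all.2 fun o => eventually_mem_connectedComponent (hF o), hrel₂']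
    with z hz hFz hrel₁z hcomp hrel₂z _ hKz γ hγ h0 hγA
  choose Φ hΦ using fun o => hz o (hFz o) γ hγ h0 hγA
  have hΦc := fun o => (hΦ o).continuous hγ
  have hΦb : ∀ o t, (Φ o t).1 = γ t := fun o t => (hΦ o).base t unitInterval.le_one'
  refine exists_continuation_of_local hγ h0 fun T => ?_
  have hL := fun o => rep_spec (Φ o T)
  have hLh := fun o => (hL o).holomorphicAt
  simp only [hΦb] at hLh
  have hmem : ∀ o, Φ o T ∈ connectedComponent (germAt (F o) a (hF o)) := fun o => by
    rw [← hcomp o (hFz o)]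
    exact (hΦ o).mem_connectedComponent hγ unitInterval.le_one'
  have hne : ∀ o, γ T ∉ Z o → rep (Φ o T) (γ T) ≠ 0 := fun o ho h1 =>
    ho ⟨Φ o T, hmem o, hΦb o T, by rw [(hL o).val_eq, hΦb, h1]⟩
  have hne_r := hne none fun h1 => hγA T (Or.inr (Or.inl h1))
  have hne_l := hne (iM (Fin.last d)) fun h1 => hγA T (Or.inr (Or.inr h1))
  -- Bezout's identity survives continuation, so a common root of the continued polynomial and its
  -- derivative would force the continued constant to vanish.
  have hbez : ∀ y, Op₂ y (fun o => rep (Φ o T)) (γ T) = 0 := fun y =>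
    (permanence_eq (s := Set.univ) (γ := γ) (Φ := Φ) isPreconnected_univ hγ.continuousOn
      (fun o t _ => hΦb o t) (fun o => (hΦc o).continuousOn) (hop₂ y) (hhol₂ y)
      (Set.mem_univ 0) (Set.mem_univ T) (by
        rw [h0]
        filter_upwards [hrel₂z y, hop₂ y (fun o => rep (Φ o 0)) F z (fun o => by
          rw [(hΦ o).start]
          exact rep_germAt_eventuallyEq (hFz o))] with w h1 h2
        exact h2.trans h1)).self_of_nhds
  obtain ⟨s, ρ, δ, hδ, hρ, hroots⟩ := exists_analytic_roots
    (f := fun i w => rep (Φ (iM i) T) (chart (γ T) w))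
    (fun i => holomorphicAt_iff_chart.1 (hLh (iM i)))
    (by rw [chart_zero]; exact hne_l) (by
      simp only [chart_zero]
      intro y h1 h2
      have h3 := hbez y
      simp only [Op₂] at h3
      rw [h1, h2, mul_zero, mul_zero, zero_add, zero_sub, neg_eq_zero] at h3
      exact hne_r h3)
  refine ⟨disc (γ T) δ, disc_mem_nhds _ hδ, ?_⟩
  filter_upwards [hγ.continuousAt.eventually (disc_mem_nhds (γ T) hδ),
    eventually_all.2 fun o => (hΦc o).continuousAt.eventually (hL o).eventually] with τ hτV hτG Ξ hΞ
  have hΞb := hΞ.base τ le_rfl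
  have hperm := permanence_eq (s := Set.Iic τ) (γ := γ)
    (Φ := fun o => Option.elim o Ξ fun i => Φ (iM i))
    (Set.ordConnected_Iic.isPreconnected) hγ.continuousOn (by
      rintro (_ | i) t ht
      · exact hΞ.base t ht
      · exact hΦb _ t) (by
      rintro (_ | i)
      · exact hΞ.continuousOn hγ
      · exact (hΦc _).continuousOn)
    hop₁ hhol₁ (t₀ := 0) (t₁ := τ) (Set.mem_Iic.2 unitInterval.nonneg') Set.self_mem_Iic (by
      rw [h0]
      filter_upwards [hrel₁z, hop₁ (fun o => rep (Option.elim o Ξ (fun i => Φ (iM i)) 0))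
        (fun o => Option.elim o K fun i => F (iM i)) z (by
          rintro (_ | i)
          · simp only [Option.elim, hΞ.start]
            exact rep_germAt_eventuallyEq hKz
          · simp only [Option.elim, (hΦ (iM i)).start]
            exact rep_germAt_eventuallyEq (hFz (iM i)))] with w h1 h2
      exact h2.trans h1)
  obtain ⟨w₁, hw₁, hw₁τ⟩ := hτV
  have hperm2 : ∀ᶠ u in 𝓝 (γ τ),
      Op₁ (fun o => Option.elim o (rep (Ξ τ)) fun i => rep (Φ (iM i) T)) u = 0 := by
    filter_upwards [hperm, hop₁ (fun o => rep (Option.elim o Ξ (fun i => Φ (iM i)) τ))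
      (fun o => Option.elim o (rep (Ξ τ)) fun i => rep (Φ (iM i) T)) (γ τ) (by
        rintro (_ | i)
        · exact EventuallyEq.rfl
        · rw [← hΦb (iM i) τ]
          exact (rep_spec (Φ (iM i) τ)).eventuallyEq (hτG (iM i)))] with u h1 h2
    exact h2.symm.trans h1
  rw [← hw₁τ, eventually_chart_iff] at hperm2
  have hΞh := holomorphicAt_rep (Ξ τ)
  rw [hΞb, ← hw₁τ, holomorphicAt_chart_iff] at hΞh
  obtain ⟨c, hc, hkc⟩ := exists_eventuallyEq_of_eventually_mem (ρ := ρ)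
    (fun c hc => hρ c hc w₁ hw₁) hΞh (by
      filter_upwards [hperm2, Metric.isOpen_ball.mem_nhds hw₁] with w hw hwδ
      exact hroots w hwδ _ hw)
  obtain ⟨H, hH⟩ := exists_comp_chart (γ T) (ρ c)
  refine ⟨H, (rep_spec (Ξ τ)).congr ?_, ?_⟩
  · rw [hΞb, ← hw₁τ]
    refine eventually_chart_iff.2 ?_
    filter_upwards [hkc] with w hw
    rw [hH]
    exact hw
  · rintro _ ⟨w, hw, rfl⟩
    rw [holomorphicAt_chart_iff]
    simp only [hH]
    exact hρ c hc w hw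

/-! ### Superposition operators and circle averages depending on parameters -/

section Superposition

variable {K X : Type*} [TopologicalSpace K] [CompactSpace K] [NormedAddCommGroup X]
  [NormedSpace ℂ X]

/-- The power series of the superposition operator `u ↦ H ∘ u`, where `p` is a power series
of `H`. -/
def superpositionSeries (K : Type*) [TopologicalSpace K] [CompactSpace K]
    (p : FormalMultilinearSeries ℂ X ℂ) : FormalMultilinearSeries ℂ C(K, X) C(K, ℂ) := fun k =>
  MultilinearMap.mkContinuous
    { toFun := fun u => ⟨fun s => p k fun i => u i s, by fun_prop⟩
      map_update_add' := by
        intro _ u i x y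
        ext s
        have h : ∀ w : C(K, X), (fun j => Function.update u i w j s) =
            Function.update (fun j => u j s) i (w s) := by
          intro w
          ext j
          by_cases hj : j = i
          · subst hj; simp
          · simp [hj]
        simp [h]
      map_update_smul' := by
        intro _ u i c x
        ext s
        have h : ∀ w : C(K, X), (fun j => Function.update u i w j s) =
            Function.update (fun j => u j s) i (w s) := by
          intro w
          ext j
          by_cases hj : j = i
          · subst hj; simp
          · simp [hj]
        simp [h] } ‖p k‖ (by
    intro u
    refine (ContinuousMap.norm_le _ (by positivity)).2 fun s => ?_
    refine ((p k).le_opNorm _).trans ?_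
    gcongr with i _
    exact (u i).norm_coe_le_norm s)

/-- The terms act pointwise, so the norm of the `k`-th one is at most `‖p k‖`. -/
theorem radius_le_superpositionSeries (p : FormalMultilinearSeries ℂ X ℂ) :
    p.radius ≤ (superpositionSeries K p).radius :=
  FormalMultilinearSeries.radius_le_of_le fun _ =>
    MultilinearMap.mkContinuous_norm_le _ (norm_nonneg _) _

/-- Superposition with an analytic function is an analytic operator. -/
theorem exists_analyticAt_superposition (K : Type*) [TopologicalSpace K] [CompactSpace K]
    {H : X → ℂ} {p : FormalMultilinearSeries ℂ X ℂ} {c : X} {R : ℝ}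
    (hH : HasFPowerSeriesOnBall H p c (ENNReal.ofReal R)) :
    ∃ S : C(K, X) → C(K, ℂ), ∀ u : C(K, X), (∀ s, u s ∈ Metric.ball c R) →
      AnalyticAt ℂ S u ∧ ∀ s, S u s = H (u s) := by
  have hR : 0 < R := ENNReal.ofReal_pos.1 hH.r_pos
  have hrad := hH.r_le.trans (radius_le_superpositionSeries (K := K) p)
  have hP := (superpositionSeries K p).hasFPowerSeriesOnBall (hH.r_pos.trans_le hrad)
  refine ⟨fun u => (superpositionSeries K p).sum (u - ContinuousMap.const K c), fun u hu => ?_⟩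
  have hlt : u - ContinuousMap.const K c ∈ Metric.eball 0 (superpositionSeries K p).radius := by
    refine Metric.eball_subset_eball hrad ?_
    rw [Metric.eball_ofReal, mem_ball_zero_iff, ContinuousMap.norm_lt_iff _ hR]
    intro s
    exact mem_ball_iff_norm.1 (hu s)
  constructor
  · have h1 : AnalyticAt ℂ (superpositionSeries K p).sum (u - ContinuousMap.const K c) :=
      hP.analyticAt_of_mem hlt
    exact h1.comp_of_eq (analyticAt_id.sub analyticAt_const) rfl
  · intro s
    have h1 := (hP.hasSum hlt).mapL (ContinuousMap.evalCLM ℂ s)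
    rw [zero_add] at h1
    have h2 := hH.hasSum (y := u s - c) (by
      rw [Metric.eball_ofReal, mem_ball_zero_iff]
      exact mem_ball_iff_norm.1 (hu s))
    rw [add_sub_cancel] at h2
    exact h1.unique h2

open MeasureTheory in
/-- Integration over an interval is a continuous linear functional on continuous functions. -/
theorem exists_intervalIntegralCLM {a b : ℝ} (hab : a ≤ b) :
    ∃ L : C(Set.Icc a b, ℂ) →L[ℂ] ℂ, ∀ (φ : C(Set.Icc a b, ℂ)) (g : ℝ → ℂ),
      (∀ θ, φ θ = g θ) → L φ = ∫ θ in a..b, g θ := by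
  let μ : Measure (Set.Icc a b) := volume.comap Subtype.val
  have : IsFiniteMeasure μ := by
    refine ⟨?_⟩
    rw [(MeasurableEmbedding.subtype_coe measurableSet_Icc).comap_apply]
    exact (measure_mono (Set.image_subset_iff.2 fun x _ => x.2)).trans_lt
      (measure_Icc_lt_top (a := a) (b := b))
  refine ⟨(L1.integralCLM' ℂ).comp (ContinuousMap.toLp 1 μ ℂ),
    fun φ g hφ => ?_⟩
  rw [ContinuousLinearMap.comp_apply, ← L1.integral_eq', L1.integral_eq_integral,
    integral_congr_ae (ContinuousMap.coeFn_toLp μ φ),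
    intervalIntegral.integral_of_le hab, ← integral_Icc_eq_integral_Ioc,
    ← integral_subtype_comap measurableSet_Icc]
  exact integral_congr_ae (Eventually.of_forall hφ)

/-- Averages over circles of a quotient of analytic functions depend analytically on the center. -/
theorem analyticAt_circleAverage_div {G H : X → ℂ} {pG pH : FormalMultilinearSeries ℂ X ℂ} {c : X}
    {R : ℝ} (hG : HasFPowerSeriesOnBall G pG c (ENNReal.ofReal R))
    (hH : HasFPowerSeriesOnBall H pH c (ENNReal.ofReal R)) {v y₀ : X}
    (hmem : ∀ s : ℂ, ‖s‖ = 1 → y₀ + s • v ∈ Metric.ball c R)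
    (hne : ∀ s : ℂ, ‖s‖ = 1 → H (y₀ + s • v) ≠ 0) :
    AnalyticAt ℂ (fun y => Real.circleAverage (fun s => G (y + s • v) / H (y + s • v)) 0 1) y₀ := by
  -- The average is a composite of analytic maps of Banach spaces: send `y` to the translated
  -- circle, superpose `G` and `H`, invert in the algebra of continuous functions, and apply a
  -- continuous linear functional.
  obtain ⟨L, hL⟩ := exists_intervalIntegralCLM Real.two_pi_pos.le
  obtain ⟨SG, hSG⟩ := exists_analyticAt_superposition (Set.Icc (0 : ℝ) (2 * Real.pi)) hG
  obtain ⟨SH, hSH⟩ := exists_analyticAt_superposition (Set.Icc (0 : ℝ) (2 * Real.pi)) hH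
  let e : X → C(Set.Icc (0 : ℝ) (2 * Real.pi), X) := fun y =>
    ContinuousLinearMap.const ℂ (Set.Icc (0 : ℝ) (2 * Real.pi)) y +
      ⟨fun θ => circleMap 0 1 θ • v, by fun_prop⟩
  have he : ∀ y θ, e y θ = y + circleMap 0 1 θ • v := fun y θ => rfl
  have hec : AnalyticAt ℂ e y₀ := (ContinuousLinearMap.analyticAt _ y₀).add analyticAt_const
  have hu₀ : ∀ θ, e y₀ θ ∈ Metric.ball c R := fun θ => hmem _ (by simp)
  have hu : ∀ᶠ y in 𝓝 y₀, ∀ θ, e y θ ∈ Metric.ball c R := by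
    have h1 : IsOpen {u : C(Set.Icc (0 : ℝ) (2 * Real.pi), X) |
        Set.MapsTo u Set.univ (Metric.ball c R)} :=
      ContinuousMap.isOpen_setOfPred_mapsTo isCompact_univ Metric.isOpen_ball
    filter_upwards [hec.continuousAt.eventually (h1.mem_nhds fun θ _ => hu₀ θ)] with y hy θ
    exact hy (Set.mem_univ θ)
  have hunit : IsUnit (SH (e y₀)) := by
    rw [ContinuousMap.isUnit_iff_forall_ne_zero]
    intro θ
    rw [(hSH _ hu₀).2]
    exact hne _ (by simp)
  obtain ⟨U, hU⟩ := hunit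
  have hSHe : AnalyticAt ℂ (fun y => SH (e y)) y₀ := (hSH _ hu₀).1.comp hec
  have hinv : AnalyticAt ℂ (fun y => Ring.inverse (SH (e y))) y₀ :=
    (hU ▸ analyticAt_inverse U : AnalyticAt ℂ Ring.inverse (SH (e y₀))).comp_of_eq hSHe rfl
  have hquot : AnalyticAt ℂ (fun y => SG (e y) * Ring.inverse (SH (e y))) y₀ :=
    ((hSG _ hu₀).1.comp hec).mul hinv
  have hfin : AnalyticAt ℂ (fun y => (((2 * Real.pi)⁻¹ : ℝ) : ℂ) *
      L (SG (e y) * Ring.inverse (SH (e y)))) y₀ :=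
    analyticAt_const.mul ((L.analyticAt _).comp_of_eq hquot rfl)
  refine hfin.congr ?_
  have hun : ∀ᶠ y in 𝓝 y₀, IsUnit (SH (e y)) :=
    hSHe.continuousAt.eventually (Units.isOpen.mem_nhds ⟨U, hU⟩)
  filter_upwards [hu, hun] with y hy hyu
  rw [Real.circleAverage_def, Complex.real_smul, hL _ (fun θ => G (y + circleMap 0 1 θ • v) /
    H (y + circleMap 0 1 θ • v))]
  intro θ
  have h1 := DFunLike.congr_fun (Ring.mul_inverse_cancel _ hyu) θ
  rw [ContinuousMap.mul_apply, (hSH _ hy).2, he, ContinuousMap.one_apply] at h1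
  rw [ContinuousMap.mul_apply, (hSG _ hy).2, he, div_eq_mul_inv, eq_inv_of_mul_eq_one_right h1]

end Superposition

/-! ### The domain of a meromorphic function of several variables -/

/-- A nontrivial analytic function is nontrivial near all nearby points. -/
theorem eventually_not_eventually_eq_zero {X : Type*} [NormedAddCommGroup X] [NormedSpace ℂ X]
    {H : X → ℂ} {p : X} (hH : AnalyticAt ℂ H p) (h : ¬ ∀ᶠ x in 𝓝 p, H x = 0) :
    ∀ᶠ x in 𝓝 p, ¬ ∀ᶠ y in 𝓝 x, H y = 0 := by
  obtain ⟨r, hr, hball⟩ := Metric.eventually_nhds_iff_ball.1 hH.eventually_analyticAt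
  filter_upwards [Metric.ball_mem_nhds p hr] with x hx hcon
  refine h (mem_of_superset (Metric.ball_mem_nhds p hr) ?_)
  have hH' : AnalyticOnNhd ℂ H (Metric.ball p r) := hball
  exact hH'.eqOn_zero_of_preconnected_of_eventuallyEq_zero
    (convex_ball p r).isPreconnected hx hcon

/-- Two nontrivial analytic functions are simultaneously nonzero at points arbitrarily close to a
given one. -/
theorem frequently_ne_zero_and {X : Type*} [NormedAddCommGroup X] [NormedSpace ℂ X]
    {H₁ H₂ : X → ℂ} {p : X} (h₁ : AnalyticAt ℂ H₁ p) (h₂ : AnalyticAt ℂ H₂ p)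
    (hne₁ : ¬ ∀ᶠ x in 𝓝 p, H₁ x = 0) (hne₂ : ¬ ∀ᶠ x in 𝓝 p, H₂ x = 0) :
    ∃ᶠ x in 𝓝 p, H₁ x ≠ 0 ∧ H₂ x ≠ 0 := by
  intro hcon
  refine hne₁ ?_
  filter_upwards [eventually_not_eventually_eq_zero h₂ hne₂, h₁.eventually_analyticAt,
    eventually_eventually_nhds.2 hcon] with x hx hx₁ hx₂
  by_contra h0
  refine hx ?_
  filter_upwards [hx₁.continuousAt.eventually_ne h0, hx₂] with y hy hy'
  by_contra h3
  exact hy' ⟨hy, h3⟩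

theorem differentiableAt_comp_line {X : Type*} [NormedAddCommGroup X] [NormedSpace ℂ X]
    {H : X → ℂ} {y v : X} {s : ℂ} (hH : AnalyticAt ℂ H (y + s • v)) :
    DifferentiableAt ℂ (fun t : ℂ => H (y + t • v)) s := by
  have h1 : DifferentiableAt ℂ (fun t : ℂ => y + t • v) s := by fun_prop
  exact hH.differentiableAt.fun_comp' s h1

variable {n : ℕ} {F : (Fin n → ℂ) → ℂ}

/-- Continuous functions which agree at points arbitrarily close to `p` agree at `p`. -/
theorem eq_of_frequently {X : Type*} [TopologicalSpace X] {f g : X → ℂ} {p : X}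
    (hf : ContinuousAt f p) (hg : ContinuousAt g p) (h : ∃ᶠ x in 𝓝 p, f x = g x) : f p = g p := by
  by_contra hne
  exact h ((hf.sub hg).eventually_ne (sub_ne_zero.2 hne) |>.mono fun x hx => sub_ne_zero.1 hx)

/-- Both sides are continuous and agree where neither denominator vanishes; such points accumulate
at `p` even if `H p = 0`. -/
theorem HasMeromorphicValue.mul_eq {p : Fin n → ℂ} {c : ℂ} (h : HasMeromorphicValue F p c)
    {G H : (Fin n → ℂ) → ℂ} (hG : AnalyticAt ℂ G p) (hH : AnalyticAt ℂ H p)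
    (hne : ¬ ∀ᶠ x in 𝓝 p, H x = 0) (hF : ∀ᶠ x in 𝓝 p, H x ≠ 0 → F x = G x / H x) :
    c * H p = G p := by
  obtain ⟨G₀, H₀, hG₀, hH₀, hne₀, hF₀, rfl⟩ := h
  refine eq_of_frequently (f := fun x => G₀ x * H x) (hG₀.continuousAt.mul hH.continuousAt)
    hG.continuousAt ?_
  refine ((frequently_ne_zero_and hH₀ hH hne₀ hne).and_eventually (hF₀.and hF)).mono ?_
  rintro x ⟨⟨h1, h2⟩, h3, h4⟩
  rw [← h3 h1, h4 h2, div_mul_cancel₀ _ h2]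

theorem HasMeromorphicValue.unique {p : Fin n → ℂ} {c d : ℂ} (hc : HasMeromorphicValue F p c)
    (hd : HasMeromorphicValue F p d) : c = d := by
  obtain ⟨G₁, H₁, hG₁, hH₁, hne₁, hF₁, rfl⟩ := hc
  obtain ⟨G₂, H₂, hG₂, hH₂, hne₂, hF₂, rfl⟩ := hd
  refine eq_of_frequently hG₁.continuousAt hG₂.continuousAt ?_
  refine ((frequently_ne_zero_and hH₁ hH₂ hne₁ hne₂).and_eventually (hF₁.and hF₂)).mono ?_
  rintro x ⟨⟨h1, h2⟩, h3, h4⟩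
  rw [← h3 h1, h4 h2]

/-- The set of points where a meromorphic function is holomorphic. -/
def regularSet (F : (Fin n → ℂ) → ℂ) : Set (Fin n → ℂ) := {p | ∃ c, HasMeromorphicValue F p c}

open Classical in
/-- The value of a meromorphic function at a point where it is holomorphic. -/
def meromorphicValue (F : (Fin n → ℂ) → ℂ) (p : Fin n → ℂ) : ℂ :=
  if h : ∃ c, HasMeromorphicValue F p c then h.choose else 0

theorem hasMeromorphicValue_meromorphicValue {p : Fin n → ℂ} (h : p ∈ regularSet F) :
    HasMeromorphicValue F p (meromorphicValue F p) := by
  have h' : ∃ c, HasMeromorphicValue F p c := h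
  rw [meromorphicValue, dif_pos h']
  exact h'.choose_spec

theorem HasMeromorphicValue.meromorphicValue_eq {p : Fin n → ℂ} {c : ℂ}
    (h : HasMeromorphicValue F p c) : meromorphicValue F p = c :=
  (hasMeromorphicValue_meromorphicValue ⟨c, h⟩).unique h

theorem HasMeromorphicValue.exists_analyticAt {p : Fin n → ℂ} {c : ℂ}
    (h : HasMeromorphicValue F p c) :
    ∃ G, AnalyticAt ℂ G p ∧ ∀ᶠ x in 𝓝 p, HasMeromorphicValue F x (G x) := by
  obtain ⟨G, H, hG, hH, hne, hF, rfl⟩ := h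
  refine ⟨G, hG, ?_⟩
  filter_upwards [hG.eventually_analyticAt, hH.eventually_analyticAt,
    eventually_not_eventually_eq_zero hH hne, eventually_eventually_nhds.2 hF] with x h1 h2 h3 h4
  exact ⟨G, H, h1, h2, h3, h4, rfl⟩

theorem isOpen_regularSet : IsOpen (regularSet F) := by
  rw [isOpen_iff_mem_nhds]
  rintro p ⟨c, h⟩
  obtain ⟨G, -, hG⟩ := h.exists_analyticAt
  exact hG.mono fun x hx => ⟨_, hx⟩

theorem analyticAt_meromorphicValue {p : Fin n → ℂ} (h : p ∈ regularSet F) :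
    AnalyticAt ℂ (meromorphicValue F) p := by
  obtain ⟨c, h⟩ := h
  obtain ⟨G, hG, hG'⟩ := h.exists_analyticAt
  exact hG.congr (hG'.mono fun x hx => hx.meromorphicValue_eq.symm)

theorem hasMeromorphicValue_div {p : Fin n → ℂ} {G H : (Fin n → ℂ) → ℂ} (hG : AnalyticAt ℂ G p)
    (hH : AnalyticAt ℂ H p) (hF : ∀ᶠ x in 𝓝 p, H x ≠ 0 → F x = G x / H x) (h : H p ≠ 0) :
    HasMeromorphicValue F p (G p / H p) :=
  ⟨fun x => G x / H x, H, hG.div hH h, hH, fun hcon => h hcon.self_of_nhds, hF, rfl⟩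

/-- A criterion of holomorphy: if a translate of a circle does not meet the polar set, and nearby
there is a translate of the disc contained in the domain of holomorphy, then the center of the
circle is in the domain of holomorphy. -/
theorem mem_regularSet_of_disc {G H : (Fin n → ℂ) → ℂ}
    {pG pH : FormalMultilinearSeries ℂ (Fin n → ℂ) ℂ} {p : Fin n → ℂ} {R : ℝ}
    (hG : HasFPowerSeriesOnBall G pG p (ENNReal.ofReal R))
    (hH : HasFPowerSeriesOnBall H pH p (ENNReal.ofReal R))
    (hF : ∀ x ∈ Metric.ball p R, H x ≠ 0 → F x = G x / H x) {v y₀ : Fin n → ℂ}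
    (hmem : ∀ s : ℂ, ‖s‖ ≤ 1 → y₀ + s • v ∈ Metric.ball p R)
    (hne : ∀ s : ℂ, ‖s‖ = 1 → H (y₀ + s • v) ≠ 0)
    (hfreq : ∃ᶠ y in 𝓝 y₀, ∀ s : ℂ, ‖s‖ ≤ 1 → y + s • v ∈ regularSet F) :
    y₀ ∈ regularSet F := by
  have hGa : ∀ x ∈ Metric.ball p R, AnalyticAt ℂ G x := fun x hx =>
    hG.analyticAt_of_mem (by rwa [Metric.eball_ofReal])
  have hHa : ∀ x ∈ Metric.ball p R, AnalyticAt ℂ H x := fun x hx =>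
    hH.analyticAt_of_mem (by rwa [Metric.eball_ofReal])
  have hF' : ∀ x ∈ Metric.ball p R, ∀ᶠ y in 𝓝 x, H y ≠ 0 → F y = G y / H y := fun x hx =>
    mem_of_superset (Metric.isOpen_ball.mem_nhds hx) hF
  have hHne : ∀ x ∈ Metric.ball p R, ¬ ∀ᶠ y in 𝓝 x, H y = 0 := fun x hx hcon =>
    hne 1 (by simp) (AnalyticOnNhd.eqOn_zero_of_preconnected_of_eventuallyEq_zero
      (fun x hx => hHa x hx) (convex_ball p R).isPreconnected hx hcon (hmem 1 (by simp)))
  -- The candidate for the value of `F` near `y₀` is a circle average, which only uses points where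
  -- `H` does not vanish.
  set q : (Fin n → ℂ) → ℂ := fun y =>
    Real.circleAverage (fun s => G (y + s • v) / H (y + s • v)) 0 1 with hq_def
  have hq : AnalyticAt ℂ q y₀ :=
    analyticAt_circleAverage_div hG hH (fun s hs => hmem s hs.le) hne
  have hy₀ : y₀ ∈ Metric.ball p R := by simpa using hmem 0 (by simp)
  obtain ⟨r, hr, hball⟩ := Metric.eventually_nhds_iff_ball.1
    (hq.eventually_analyticAt.and (Metric.isOpen_ball.mem_nhds hy₀))
  have hK : IsCompact (Metric.closedBall (0 : ℂ) 1) := isCompact_closedBall 0 1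
  have hcont : ∀ (y : Fin n → ℂ) (s : ℂ), ContinuousAt
      (fun z : (Fin n → ℂ) × ℂ => z.1 + z.2 • v) (y, s) := fun y s => by fun_prop
  have hmem' : ∀ᶠ y in 𝓝 y₀, ∀ s ∈ Metric.closedBall (0 : ℂ) 1, y + s • v ∈ Metric.ball p R :=
    hK.eventually_forall_of_forall_eventually fun s hs =>
      (hcont y₀ s).eventually (Metric.isOpen_ball.mem_nhds (hmem s (by simpa using hs)))
  have hsph : ∀ᶠ y in 𝓝 y₀, ∀ s ∈ Metric.sphere (0 : ℂ) 1, H (y + s • v) ≠ 0 :=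
    (isCompact_sphere 0 1).eventually_forall_of_forall_eventually fun s hs => by
      have hs' : ‖s‖ = 1 := by simpa using hs
      exact (hcont y₀ s).eventually
        ((hHa _ (hmem s hs'.le)).continuousAt.eventually_ne (hne s hs'))
  obtain ⟨y₁, hy₁, hy₁r, hy₁m, hy₁s⟩ := (hfreq.and_eventually
    ((Metric.isOpen_ball.eventually_mem (Metric.mem_ball_self hr)).and
    ((eventually_eventually_nhds.2 hmem').and (eventually_eventually_nhds.2 hsph)))).exists
  have hreg : ∀ᶠ y in 𝓝 y₁, ∀ s ∈ Metric.closedBall (0 : ℂ) 1, y + s • v ∈ regularSet F :=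
    hK.eventually_forall_of_forall_eventually fun s hs =>
      (hcont y₁ s).eventually (isOpen_regularSet.mem_nhds (hy₁ s (by simpa using hs)))
  -- Near `y₁` the full translated disc lies in the domain of holomorphy, so the mean value property
  -- identifies `q` with the value of `F`. The identity principle then carries `q * H = G` to `y₀`.
  have hqG : ∀ᶠ y in 𝓝 y₁, q y * H y = G y := by
    filter_upwards [hreg, hy₁m, hy₁s] with y h1 h2 h3
    have h4 : q y = meromorphicValue F y := by
      have h5 : DiffContOnCl ℂ (fun s : ℂ => meromorphicValue F (y + s • v))
          (Metric.ball 0 |1|) := by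
        refine DifferentiableOn.diffContOnCl fun s hs => ?_
        rw [abs_one, closure_ball _ one_ne_zero] at hs
        exact (differentiableAt_comp_line
          (analyticAt_meromorphicValue (h1 s hs))).differentiableWithinAt
      have h6 := h5.circleAverage
      simp only [zero_smul, add_zero] at h6
      rw [← h6, hq_def]
      refine Real.circleAverage_congr_sphere fun s hs => ?_
      rw [abs_one] at hs
      have hs' := h2 s (Metric.sphere_subset_closedBall hs)
      exact (hasMeromorphicValue_div (hGa _ hs') (hHa _ hs') (hF' _ hs')
        (h3 s hs)).meromorphicValue_eq.symm
    have h0 : y ∈ Metric.ball p R := by simpa using h2 0 (by simp)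
    rw [h4]
    exact (hasMeromorphicValue_meromorphicValue (by simpa using h1 0 (by simp))).mul_eq
      (hGa y h0) (hHa y h0) (hHne y h0) (hF' y h0)
  have hqG' : Set.EqOn (fun y => q y * H y) G (Metric.ball y₀ r) :=
    AnalyticOnNhd.eqOn_of_preconnected_of_eventuallyEq
      (fun y hy => (hball y hy).1.mul (hHa y (hball y hy).2)) (fun y hy => hGa y (hball y hy).2)
      (convex_ball y₀ r).isPreconnected hy₁r hqG
  refine ⟨q y₀, q, H, hq, hHa y₀ hy₀, hHne y₀ hy₀, ?_, rfl⟩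
  filter_upwards [Metric.ball_mem_nhds y₀ hr, hF' y₀ hy₀] with y hy hyF hyH
  rw [hyF hyH, ← hqG' hy, mul_div_cancel_right₀ _ hyH]

/-! ### Regular points of a meromorphic function on an analytic curve -/

/-- Functions vanishing to a given order at the origin have no other zeros in a disc whose radius
depends only on bounds for the functions and their derivatives. -/
theorem exists_forall_ne_zero_of_order {r₀ M α : ℝ} (hr₀ : 0 < r₀) (hM : 0 ≤ M) (hα : 0 < α)
    (d : ℕ) : ∃ r > 0, r < r₀ ∧ ∀ g : ℂ → ℂ, DiffContOnCl ℂ g (Metric.ball 0 r₀) →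
      (∀ s ∈ Metric.sphere (0 : ℂ) r₀, ‖g s‖ ≤ M) → (∀ j < d, iteratedDeriv j g 0 = 0) →
      α ≤ ‖iteratedDeriv d g 0‖ → ∀ s, s ≠ 0 → ‖s‖ ≤ r → g s ≠ 0 := by
  have hfac : (0 : ℝ) < d.factorial := by exact_mod_cast d.factorial_pos
  set β : ℝ := α * r₀ ^ (d + 1) / d.factorial with hβ_def
  have hβ : 0 < β := by positivity
  -- At a zero `s ≠ 0` the Taylor term of order `d` is cancelled by the tail, which Cauchy's
  -- estimates bound by `2 * M * (‖s‖ / r₀) ^ (d + 1)` when `‖s‖ ≤ r₀ / 2`. This forces `β ≤ 2 * M *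
  -- ‖s‖`; the added `1` contradicts it and covers `M = 0`.
  refine ⟨min (r₀ / 2) (β / (2 * M + 1)), by positivity,
    (min_le_left _ _).trans_lt (by linarith), ?_⟩
  intro g hg hgM hj hα' s hs0 hs hgs
  have hs1 : ‖s‖ ≤ r₀ / 2 := hs.trans (min_le_left _ _)
  have hs2 : ‖s‖ ≤ β / (2 * M + 1) := hs.trans (min_le_right _ _)
  have hspos : 0 < ‖s‖ := norm_pos_iff.2 hs0
  let a : ℕ → ℂ := fun j => ((j.factorial : ℂ))⁻¹ • (s - 0) ^ j • iteratedDeriv j g 0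
  have hsum : HasSum a (g s) := Complex.hasSum_taylorSeries_on_ball hg.differentiableOn
    (by rw [mem_ball_zero_iff]; linarith)
  have ha : ∀ j, ‖a j‖ ≤ M * (‖s‖ / r₀) ^ j := by
    intro j
    have h1 := Complex.norm_iteratedDeriv_le_of_forall_mem_sphere_norm_le j hr₀ hg hgM
    have hjf : (0 : ℝ) < j.factorial := by exact_mod_cast j.factorial_pos
    simp only [a, norm_smul, norm_inv, norm_pow, sub_zero, Complex.norm_natCast]
    calc (j.factorial : ℝ)⁻¹ * (‖s‖ ^ j * ‖iteratedDeriv j g 0‖)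
        ≤ (j.factorial : ℝ)⁻¹ * (‖s‖ ^ j * (j.factorial * M / r₀ ^ j)) := by gcongr
      _ = M * (‖s‖ / r₀) ^ j := by rw [div_pow]; field_simp
  have had : ‖a d‖ = ‖s‖ ^ d * ‖iteratedDeriv d g 0‖ / d.factorial := by
    simp only [a, norm_smul, norm_inv, norm_pow, sub_zero, Complex.norm_natCast]
    field_simp
  have htail : HasSum (fun i => a (i + (d + 1))) (- a d) := by
    have h1 := (hasSum_nat_add_iff' (f := a) (d + 1)).2 hsum
    rw [hgs, Finset.sum_range_succ, Finset.sum_eq_zero, zero_add, zero_sub] at h1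
    · exact h1
    · intro j hjd
      simp [a, hj j (Finset.mem_range.1 hjd)]
  set x := ‖s‖ / r₀ with hx_def
  have hx : x ≤ 1 / 2 := by rw [hx_def, div_le_iff₀ hr₀]; linarith
  have hx0 : 0 < x := by positivity
  have hgeo : HasSum (fun i : ℕ => M * x ^ (d + 1) * x ^ i) (M * x ^ (d + 1) * (1 - x)⁻¹) :=
    (hasSum_geometric_of_lt_one hx0.le (by linarith)).mul_left _
  have hle : ‖a d‖ ≤ M * x ^ (d + 1) * (1 - x)⁻¹ := by
    rw [← norm_neg, ← htail.tsum_eq]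
    refine tsum_of_norm_bounded hgeo fun i => (ha _).trans (le_of_eq ?_)
    rw [pow_add, mul_assoc, mul_comm (x ^ i)]
  have hinv : (1 - x)⁻¹ ≤ 2 := by
    rw [inv_le_comm₀ (by linarith) (by norm_num)]
    linarith
  have hle2 : ‖s‖ ^ d * α / d.factorial ≤ M * x ^ (d + 1) * 2 := by
    refine le_trans ?_ (hle.trans (by gcongr))
    rw [had]
    gcongr
  have hsx : ‖s‖ = x * r₀ := by rw [hx_def]; field_simp
  have hle3 : β ≤ 2 * M * ‖s‖ := by
    have h1 : x ^ d * β ≤ x ^ d * (2 * M * ‖s‖) := by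
      calc x ^ d * β = ‖s‖ ^ d * α / d.factorial * r₀ := by rw [hβ_def, hsx]; ring
        _ ≤ M * x ^ (d + 1) * 2 * r₀ := by gcongr
        _ = x ^ d * (2 * M * ‖s‖) := by rw [hsx]; ring
    exact le_of_mul_le_mul_left h1 (by positivity)
  rw [le_div_iff₀ (by positivity)] at hs2
  linarith

section DirectionalDerivative

variable {X : Type*} [NormedAddCommGroup X] [NormedSpace ℂ X]

/-- The iterated derivative in a given direction. -/
def iteratedDirDeriv (v : X) (H : X → ℂ) (j : ℕ) : X → ℂ := (fun K y => fderiv ℂ K y v)^[j] H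

theorem iteratedDirDeriv_succ (v : X) (H : X → ℂ) (j : ℕ) (y : X) :
    iteratedDirDeriv v H (j + 1) y = fderiv ℂ (iteratedDirDeriv v H j) y v := by
  rw [iteratedDirDeriv, Function.iterate_succ_apply']
  rfl

theorem analyticAt_iteratedDirDeriv {H : X → ℂ} {y : X} (hH : AnalyticAt ℂ H y) (v : X) (j : ℕ) :
    AnalyticAt ℂ (iteratedDirDeriv v H j) y := by
  induction j with
  | zero => exact hH
  | succ j ih =>
    have h1 : iteratedDirDeriv v H (j + 1) = fun y => fderiv ℂ (iteratedDirDeriv v H j) y v :=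
      funext (iteratedDirDeriv_succ v H j)
    rw [h1]
    exact ((ContinuousLinearMap.apply ℂ ℂ v).analyticAt _).comp_of_eq ih.fderiv rfl

theorem iteratedDeriv_comp_line {H : X → ℂ} {N : Set X} (hN : IsOpen N)
    (hH : ∀ y ∈ N, AnalyticAt ℂ H y) (v y : X) (j : ℕ) (s : ℂ) (hs : y + s • v ∈ N) :
    iteratedDeriv j (fun s : ℂ => H (y + s • v)) s = iteratedDirDeriv v H j (y + s • v) := by
  induction j generalizing s with
  | zero => rw [iteratedDeriv_zero]; rfl
  | succ j ih =>
    have h1 : iteratedDeriv j (fun s : ℂ => H (y + s • v)) =ᶠ[𝓝 s]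
        fun s => iteratedDirDeriv v H j (y + s • v) := by
      have hc : ContinuousAt (fun s : ℂ => y + s • v) s := by fun_prop
      filter_upwards [hc.eventually (hN.mem_nhds hs)] with t ht
      exact ih t ht
    rw [iteratedDeriv_succ, h1.deriv_eq, iteratedDirDeriv_succ]
    have h2 : HasDerivAt (fun s : ℂ => y + s • v) v s := by
      simpa using ((hasDerivAt_id s).smul_const v).const_add y
    exact ((analyticAt_iteratedDirDeriv (hH _ hs) v j).differentiableAt.hasFDerivAt.comp_hasDerivAt
      s h2).deriv

end DirectionalDerivative

theorem eventually_ofReal_le {r : ENNReal} (hr : 0 < r) :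
    ∀ᶠ R in 𝓝[>] (0 : ℝ), ENNReal.ofReal R ≤ r := by
  have h := (ENNReal.continuous_ofReal.tendsto 0).eventually_lt_const
    (by rwa [ENNReal.ofReal_zero])
  exact (h.filter_mono nhdsWithin_le_nhds).mono fun _ h => h.le

theorem eventually_ball_subset {X : Type*} [PseudoMetricSpace X] {p : X} {S : Set X}
    (hS : S ∈ 𝓝 p) : ∀ᶠ R in 𝓝[>] (0 : ℝ), Metric.ball p R ⊆ S := by
  obtain ⟨ε, hε, h⟩ := Metric.mem_nhds_iff.1 hS
  filter_upwards [Ioc_mem_nhdsGT hε] with R hR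
  exact (Metric.ball_subset_ball hR.2).trans h

/-- Write `F = G / H` near the centre and choose a direction `v` in which `H` has constant order of
vanishing along the curve, away from `z₀`. Nearby translated discs in that direction then meet the
zeros of `H` at most at their centres. The disc criterion shows that regularity is a closed
condition on a punctured disc of parameters; it is also open, and the punctured disc is connected.
-/
theorem eventually_mem_regularSet_or {n : ℕ} {F : (Fin n → ℂ) → ℂ} (hF : IsMeromorphic F)
    {f : ℂ → Fin n → ℂ} {z₀ : ℂ} (hf : AnalyticAt ℂ f z₀) :
    (∀ᶠ z in 𝓝[≠] z₀, f z ∈ regularSet F) ∨ ∀ᶠ z in 𝓝[≠] z₀, f z ∉ regularSet F := by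
  set p := f z₀ with hp
  obtain ⟨G, H, ⟨pG, r₁, hG⟩, ⟨pH, r₂, hH⟩, hne, hFGH⟩ := hF p
  set M := ‖H p‖ + 1 with hM_def
  have hHM : ∀ᶠ x in 𝓝 p, ‖H x‖ ≤ M :=
    (hH.analyticAt.continuousAt.norm.eventually_lt_const (lt_add_one _)).mono fun _ h => h.le
  obtain ⟨R, hR1, hR2, hR3, hR⟩ := ((eventually_ofReal_le hG.r_pos).and
    ((eventually_ofReal_le hH.r_pos).and ((eventually_ball_subset (hFGH.and hHM)).and
      self_mem_nhdsWithin))).exists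
  have hR : 0 < R := hR
  replace hG := hG.mono (ENNReal.ofReal_pos.2 hR) hR1
  replace hH := hH.mono (ENNReal.ofReal_pos.2 hR) hR2
  have hGa : ∀ x ∈ Metric.ball p R, AnalyticAt ℂ G x := fun x hx =>
    hG.analyticAt_of_mem (by rwa [Metric.eball_ofReal])
  have hHa : ∀ x ∈ Metric.ball p R, AnalyticAt ℂ H x := fun x hx =>
    hH.analyticAt_of_mem (by rwa [Metric.eball_ofReal])
  have hFR : ∀ x ∈ Metric.ball p R, H x ≠ 0 → F x = G x / H x := fun x hx => (hR3 hx).1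
  have hreg : ∀ x ∈ Metric.ball p R, H x ≠ 0 → x ∈ regularSet F := fun x hx hx0 =>
    ⟨_, hasMeromorphicValue_div (hGa x hx) (hHa x hx)
      (mem_of_superset (Metric.isOpen_ball.mem_nhds hx) hFR) hx0⟩
  obtain ⟨x, hx, hxH⟩ : ∃ x ∈ Metric.ball p R, H x ≠ 0 := by
    by_contra! hcon
    exact hne (mem_of_superset (Metric.ball_mem_nhds p hR) hcon)
  set v := x - p with hv
  have hvR : ‖v‖ < R := mem_ball_iff_norm.1 hx
  have hline : ∀ y, iteratedDeriv y (fun s : ℂ => H (p + s • v)) 0 = iteratedDirDeriv v H y p := by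
    intro j
    have := iteratedDeriv_comp_line Metric.isOpen_ball hHa v p j 0
      (by rw [zero_smul, add_zero]; exact Metric.mem_ball_self hR)
    rwa [zero_smul, add_zero] at this
  -- Otherwise the Taylor series of `H` on the line through `p` and `x` would vanish and give `H x =
  -- 0`. The factor `t > 1` places the parameter `1` of `x` inside an open disc of convergence.
  have hd : ∃ d, ¬ ∀ᶠ z in 𝓝 z₀, iteratedDirDeriv v H d (f z) = 0 := by
    by_contra! hcon
    have h1 : ∀ᶠ t in 𝓝[>] (1 : ℝ), t * ‖v‖ < R :=
      ((continuous_id.mul continuous_const).continuousAt.eventually_lt_const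
        (by simpa using hvR)).filter_mono nhdsWithin_le_nhds
    obtain ⟨t, ht, ht1⟩ := (h1.and self_mem_nhdsWithin).exists
    have ht1 : 1 < t := ht1
    have h2 : DifferentiableOn ℂ (fun s : ℂ => H (p + s • v)) (Metric.ball 0 t) := by
      intro s hs
      have hs' : p + s • v ∈ Metric.ball p R := by
        rw [mem_ball_iff_norm, add_sub_cancel_left, norm_smul]
        refine lt_of_le_of_lt ?_ ht
        have := (mem_ball_zero_iff.1 hs).le
        gcongr
      exact (differentiableAt_comp_line (hHa _ hs')).differentiableWithinAt
    have h3 := Complex.hasSum_taylorSeries_on_ball h2 (z := 1) (by simpa using ht1)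
    have h4 : ∀ j, iteratedDirDeriv v H j p = 0 := fun j => (hcon j).self_of_nhds
    simp only [hline, h4, smul_zero] at h3
    have h5 := h3.unique hasSum_zero
    rw [one_smul, hv, add_sub_cancel] at h5
    exact hxH h5
  classical
  -- The least such `d` is the order at `s = 0` of `s ↦ H (f z + s • v)` for all `z ≠ z₀` near `z₀`.
  obtain ⟨d, hd, hlt⟩ : ∃ d, (¬ ∀ᶠ z in 𝓝 z₀, iteratedDirDeriv v H d (f z) = 0) ∧
      ∀ j < d, ∀ᶠ z in 𝓝 z₀, iteratedDirDeriv v H j (f z) = 0 :=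
    ⟨Nat.find hd, Nat.find_spec hd, fun j hj => not_not.1 (Nat.find_min hd hj)⟩
  have hdne : ∀ᶠ z in 𝓝[≠] z₀, iteratedDirDeriv v H d (f z) ≠ 0 :=
    ((analyticAt_iteratedDirDeriv (hHa p (Metric.mem_ball_self hR)) v d).comp_of_eq hf
      rfl).eventually_eq_zero_or_eventually_ne_zero.resolve_left hd
  have hQ : ∀ᶠ z in 𝓝[≠] z₀, AnalyticAt ℂ f z ∧ f z ∈ Metric.ball p (R / 2) ∧
      (∀ j < d, iteratedDirDeriv v H j (f z) = 0) ∧ iteratedDirDeriv v H d (f z) ≠ 0 := by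
    have h1 : ∀ᶠ z in 𝓝 z₀, ∀ j ∈ Finset.range d, iteratedDirDeriv v H j (f z) = 0 :=
      (Finset.eventually_all _).2 fun j hj => hlt j (Finset.mem_range.1 hj)
    filter_upwards [hdne, nhdsWithin_le_nhds hf.eventually_analyticAt, nhdsWithin_le_nhds h1,
      nhdsWithin_le_nhds (hf.continuousAt.eventually (Metric.ball_mem_nhds p (half_pos hR)))]
      with z h1 h2 h3 h4
    exact ⟨h2, h4, fun j hj => h3 j (Finset.mem_range.2 hj), h1⟩
  obtain ⟨δ, hδ, hball⟩ := Metric.eventually_nhds_iff_ball.1 (eventually_nhdsWithin_iff.1 hQ)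
  have hDo : IsOpen (Metric.ball z₀ δ \ {z₀}) := Metric.isOpen_ball.sdiff isClosed_singleton
  have hDc : IsPreconnected (Metric.ball z₀ δ \ {z₀}) :=
    (isPathConnected_ball_diff_countable (Set.countable_singleton z₀) z₀
      hδ).isConnected.isPreconnected
  have hDn : Metric.ball z₀ δ \ {z₀} ∈ 𝓝[≠] z₀ := by
    rw [Set.sdiff_eq, Set.inter_comm]
    exact inter_mem self_mem_nhdsWithin (nhdsWithin_le_nhds (Metric.ball_mem_nhds z₀ hδ))
  have hclosed : ∀ z₁ ∈ Metric.ball z₀ δ \ {z₀}, (∃ᶠ z in 𝓝 z₁, f z ∈ regularSet F) →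
      f z₁ ∈ regularSet F := by
    rintro z₁ hz₁ hfreq
    obtain ⟨hfz₁, hz₁R, -, hz₁d⟩ := hball z₁ hz₁.1 hz₁.2
    set α := ‖iteratedDirDeriv v H d (f z₁)‖ / 2 with hα_def
    have hα : 0 < α := half_pos (norm_pos_iff.2 hz₁d)
    have hHf : AnalyticAt ℂ H (f z₁) :=
      hHa _ (Metric.ball_subset_ball (by linarith) hz₁R)
    have hαe : ∀ᶠ z in 𝓝 z₁, α ≤ ‖iteratedDirDeriv v H d (f z)‖ := by
      have h1 : ContinuousAt (fun z => ‖iteratedDirDeriv v H d (f z)‖) z₁ :=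
        ((analyticAt_iteratedDirDeriv hHf v d).continuousAt.comp hfz₁.continuousAt).norm
      exact (h1.eventually_const_lt (half_lt_self (norm_pos_iff.2 hz₁d))).mono fun _ h => h.le
    -- With this radius, discs in direction `v` centred in the half ball stay in the full ball.
    set r₀ := R / (2 * (‖v‖ + 1)) with hr₀_def
    have hr₀ : 0 < r₀ := by positivity
    have hr₀v : r₀ * ‖v‖ < R / 2 := by
      rw [hr₀_def, div_mul_eq_mul_div, div_lt_div_iff₀ (by positivity) (by positivity)]
      nlinarith [norm_nonneg v]
    have hmem : ∀ y ∈ Metric.ball p (R / 2), ∀ s : ℂ, ‖s‖ ≤ r₀ → y + s • v ∈ Metric.ball p R := by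
      intro y hy s hs
      have h1 : ‖s • v‖ ≤ r₀ * ‖v‖ := by rw [norm_smul]; gcongr
      rw [mem_ball_iff_norm] at hy ⊢
      calc ‖y + s • v - p‖ = ‖(y - p) + s • v‖ := by congr 1; abel
        _ ≤ ‖y - p‖ + ‖s • v‖ := norm_add_le _ _
        _ < R := by linarith
    obtain ⟨r, hr, hrr₀, hne⟩ := exists_forall_ne_zero_of_order hr₀
      (M := M) (by positivity) hα d
    have hnz : ∀ᶠ z in 𝓝 z₁, ∀ s : ℂ, s ≠ 0 → ‖s‖ ≤ r →
        f z + s • v ∈ Metric.ball p R ∧ H (f z + s • v) ≠ 0 := by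
      filter_upwards [hαe, hDo.mem_nhds hz₁] with z hzα hzD s hs0 hsr
      obtain ⟨-, hzR, hz0, -⟩ := hball z hzD.1 hzD.2
      have hl : ∀ j, iteratedDeriv j (fun s : ℂ => H (f z + s • v)) 0 =
          iteratedDirDeriv v H j (f z) := by
        intro j
        have := iteratedDeriv_comp_line Metric.isOpen_ball hHa v (f z) j 0
          (hmem _ hzR 0 (by rw [norm_zero]; exact hr₀.le))
        rwa [zero_smul, add_zero] at this
      refine ⟨hmem _ hzR s (hsr.trans hrr₀.le),
        hne (fun s => H (f z + s • v)) ?_ ?_ ?_ ?_ s hs0 hsr⟩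
      · refine DifferentiableOn.diffContOnCl fun t ht => ?_
        rw [closure_ball _ hr₀.ne', mem_closedBall_zero_iff] at ht
        exact (differentiableAt_comp_line (hHa _ (hmem _ hzR t ht))).differentiableWithinAt
      · intro t ht
        exact (hR3 (hmem _ hzR t (mem_sphere_zero_iff_norm.1 ht).le)).2
      · intro j hj
        rw [hl, hz0 j hj]
      · rwa [hl]
    have hscale : ∀ s : ℂ, s • ((r : ℂ) • v) = (s * r) • v := fun s => smul_smul _ _ _
    have hsr : ∀ s : ℂ, ‖s‖ ≤ 1 → ‖s * r‖ ≤ r := by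
      intro s hs
      rw [norm_mul, Complex.norm_real, Real.norm_of_nonneg hr.le]
      nlinarith
    refine mem_regularSet_of_disc hG hH hFR (v := (r : ℂ) • v) ?_ ?_ ?_
    · intro s hs
      rw [hscale]
      exact hmem _ hz₁R _ ((hsr s hs).trans hrr₀.le)
    · intro s hs
      rw [hscale]
      refine (hnz.self_of_nhds _ ?_ (hsr s hs.le)).2
      have : s ≠ 0 := by rintro rfl; simp at hs
      exact mul_ne_zero this (by exact_mod_cast hr.ne')
    -- For a nearby parameter with regular centre the whole disc is regular: off the centre because
    -- `H` does not vanish, at the centre by assumption.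
    · refine hfz₁.continuousAt.tendsto.frequently ((hfreq.and_eventually hnz).mono ?_)
      rintro z ⟨h1, h2⟩ s hs
      rw [hscale]
      by_cases hs0 : s = 0
      · simpa [hs0] using h1
      · obtain ⟨h3, h4⟩ := h2 (s * r) (mul_ne_zero hs0 (by exact_mod_cast hr.ne')) (hsr s hs)
        exact hreg _ h3 h4
  have hU : IsOpen {z | z ∈ Metric.ball z₀ δ \ {z₀} ∧ f z ∈ regularSet F} := by
    rw [isOpen_iff_mem_nhds]
    rintro z ⟨hz, hzE⟩
    filter_upwards [hDo.mem_nhds hz, (hball z hz.1 hz.2).1.continuousAt.eventually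
      (isOpen_regularSet.mem_nhds hzE)] with w h1 h2
    exact ⟨h1, h2⟩
  have hV : IsOpen {z | z ∈ Metric.ball z₀ δ \ {z₀} ∧ f z ∉ regularSet F} := by
    rw [isOpen_iff_mem_nhds]
    rintro z ⟨hz, hzE⟩
    filter_upwards [hDo.mem_nhds hz, not_frequently.1 fun h => hzE (hclosed z hz h)] with w h1 h2
    exact ⟨h1, h2⟩
  have hdisj : Disjoint {z | z ∈ Metric.ball z₀ δ \ {z₀} ∧ f z ∈ regularSet F}
      {z | z ∈ Metric.ball z₀ δ \ {z₀} ∧ f z ∉ regularSet F} :=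
    Set.disjoint_left.2 fun z h1 h2 => h2.2 h1.2
  rcases hDc.subset_or_subset hU hV hdisj (fun z hz => by
    by_cases h : f z ∈ regularSet F
    · exact Or.inl ⟨hz, h⟩
    · exact Or.inr ⟨hz, h⟩) with h | h
  · exact Or.inl (mem_of_superset hDn fun z hz => (h hz).2)
  · exact Or.inr (mem_of_superset hDn fun z hz => (h hz).2)

/-! ### Meromorphic operations -/

theorem eventually_eventually_nhdsNE {X : Type*} [TopologicalSpace X] [T1Space X] {z : X}
    {Q : X → Prop} (h : ∀ᶠ w in 𝓝[≠] z, Q w) : ∀ᶠ w in 𝓝 z, ∀ᶠ u in 𝓝[≠] w, Q u := by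
  filter_upwards [eventually_eventually_nhds.2 (eventually_nhdsWithin_iff.1 h)] with w hw
  by_cases hwz : w = z
  · rwa [hwz]
  · filter_upwards [nhdsWithin_le_nhds hw, nhdsWithin_le_nhds (eventually_ne_nhds hwz)] with u h1 h2
    exact h1 h2

/-- This turns the dichotomy along a curve into the local constancy needed by `permanence`. -/
theorem eventually_mem_regularSet_or_of_holomorphicAt {n : ℕ} {F : (Fin n → ℂ) → ℂ}
    (hF : IsMeromorphic F) {f : Fin n → Sphere → ℂ} {z : Sphere}
    (hf : ∀ i, HolomorphicAt (f i) z) :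
    (∀ᶠ w in 𝓝 z, ∀ᶠ u in 𝓝[≠] w, (fun i => f i u) ∈ regularSet F) ∨
      ∀ᶠ w in 𝓝 z, ¬ ∀ᶠ u in 𝓝[≠] w, (fun i => f i u) ∈ regularSet F := by
  have h1 : AnalyticAt ℂ (fun w i => f i (chart z w)) 0 :=
    analyticAt_pi_iff.2 fun i => holomorphicAt_iff_chart.1 (hf i)
  rcases eventually_mem_regularSet_or hF h1 with h | h
  · exact Or.inl (eventually_eventually_nhdsNE (eventually_nhdsNE_iff_chart.2 h))
  · have h' : ∀ᶠ w in 𝓝[≠] z, (fun i => f i w) ∉ regularSet F := eventually_nhdsNE_iff_chart.2 h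
    refine Or.inr ((eventually_eventually_nhdsNE h').mono ?_)
    intro w hw hcon
    have := nhdsNE_sphere_neBot w
    obtain ⟨u, h2, h3⟩ := (hw.and hcon).exists
    exact h2 h3

/-- The germs must be continued jointly: an arbitrary combination of branches may run entirely
inside the polar set of `F`. For combinations reached from the given tuple, non-regular points are
isolated by permanence, hence countable in total. Off them the composite with the holomorphic value
of `F` continues. -/
theorem isSGerm_of_isMeromorphicImage {n : ℕ} {F : (Fin n → ℂ) → ℂ} (hF : IsMeromorphic F)
    {a : Sphere} {φ : Fin n → RegularGermAt a} {χ : RegularGermAt a}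
    (hφ : ∀ i, IsSGerm ⟨a, φ i⟩) (h : IsMeromorphicImage F φ χ) : IsSGerm ⟨a, χ⟩ := by
  obtain ⟨f, k, hφf, hχk, hval⟩ := h
  have hφR : ∀ i, Rep ⟨a, φ i⟩ (f i) := hφf
  have hχR : Rep ⟨a, χ⟩ k := hχk
  have hf : ∀ i, HolomorphicAt (f i) a := fun i => (hφR i).holomorphicAt
  have hk : HolomorphicAt k a := hχR.holomorphicAt
  have hφg : ∀ i, germAt (f i) a (hf i) = ⟨a, φ i⟩ := fun i => (hφR i).germAt_eq
  rw [← hχR.germAt_eq]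
  -- tuples of germs with a common base point, and those reached from the given one
  let S : Set (Sphere × (Fin n → RegularGerm)) := {x | ∀ i, (x.2 i).1 = x.1}
  let x₀ : Sphere × (Fin n → RegularGerm) := (a, fun i => germAt (f i) a (hf i))
  have hx₀ : x₀ ∈ S := fun i => rfl
  let C := connectedComponentIn S x₀
  have hCpre : IsPreconnected C := isPreconnected_connectedComponentIn
  have hCS : C ⊆ S := connectedComponentIn_subset S x₀
  have hx₀C : x₀ ∈ C := mem_connectedComponentIn hx₀
  have hreg : ∀ x ∈ C, ∀ᶠ w in 𝓝[≠] x.1, (fun i => rep (x.2 i) w) ∈ regularSet F := by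
    intro x hx
    refine permanence (γ := Prod.fst)
      (Φ := fun i (x : Sphere × (Fin n → RegularGerm)) => x.2 i) hCpre continuous_fst.continuousOn
      (fun i x hx => hCS hx i) (fun i => by fun_prop)
      (P := fun g z => ∀ᶠ w in 𝓝[≠] z, (fun i => g i w) ∈ regularSet F) ?_
      (fun g z hg => eventually_mem_regularSet_or_of_holomorphicAt hF hg) hx₀C hx ?_
    · intro g g' z hgg h
      filter_upwards [nhdsWithin_le_nhds (eventually_all.2 hgg), h] with w h1 h2
      simpa only [h1] using h2
    · filter_upwards [hval, nhdsWithin_le_nhds (eventually_all.2 fun i =>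
        rep_germAt_eventuallyEq (hf i))] with w h1 h2
      simp only [x₀, h2]
      exact ⟨_, h1⟩
  set B : Set Sphere := {z | ∃ g : Fin n → Sphere → ℂ,
    (∃ x ∈ C, x.1 = z ∧ ∀ i, Rep (x.2 i) (g i)) ∧ (fun i => g i z) ∉ regularSet F} with hB_def
  have hB : B.Countable := by
    refine countable_of_isolated_on_branches (φ := fun i => germAt (f i) a (hf i))
      (P := fun g z => (∃ x ∈ C, x.1 = z ∧ ∀ i, Rep (x.2 i) (g i)) ∧
        (fun i => g i z) ∉ regularSet F) ?_ ?_ ?_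
    · rintro g g' z hgg ⟨⟨x, hx, rfl, hr⟩, hn⟩
      refine ⟨⟨x, hx, rfl, fun i => (hr i).congr ?_⟩, ?_⟩
      · rw [hCS hx i]
        exact hgg i
      · simpa only [fun i => (hgg i).self_of_nhds] using hn
    · rintro g z ⟨⟨x, hx, rfl, hr⟩, -⟩ i
      refine ⟨x.2 i, ?_, hCS hx i, hr i⟩
      have hpr : Continuous fun x : Sphere × (Fin n → RegularGerm) => x.2 i := by fun_prop
      exact (hCpre.image _ hpr.continuousOn).subset_connectedComponent ⟨x₀, hx₀C, rfl⟩
        ⟨x, hx, rfl⟩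
    · rintro g z ⟨⟨x, hx, rfl, hr⟩, -⟩
      have h1 : ∀ i, rep (x.2 i) =ᶠ[𝓝 x.1] g i := fun i => by
        rw [← hCS hx i]
        exact (rep_spec _).eventuallyEq (hr i)
      filter_upwards [hreg x hx, nhdsWithin_le_nhds (eventually_all.2 h1)] with w h2 h3 h4
      refine h4.2 ?_
      simpa only [h3] using h2
  -- The point `a` is included because the relation between `k` and `F` is only given off `a`.
  set A : Set Sphere := insert a ((⋃ i, singularSet (germAt (f i) a (hf i))) ∪ B) with hA_def
  have hA : A.Countable :=
    ((Set.countable_iUnion fun i => by rw [hφg i]; exact hφ i).union hB).insert a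
  have hAf : ∀ i, singularSet (germAt (f i) a (hf i)) ⊆ A := fun i =>
    (Set.subset_iUnion (fun i => singularSet (germAt (f i) a (hf i))) i).trans
      (Set.subset_union_left.trans (Set.subset_insert _ _))
  have hnear : ∀ᶠ z in 𝓝 a, ∀ hz : ∀ i, HolomorphicAt (f i) z,
      ((z, fun i => germAt (f i) z (hz i)) : Sphere × (Fin n → RegularGerm)) ∈ C := by
    obtain ⟨ρ, hρ, hdisc⟩ := exists_disc_subset (eventually_all.2 fun i => (hf i).eventually)
    filter_upwards [disc_mem_nhds a hρ] with z hz hfz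
    have hcont : Continuous (fun w : disc a ρ =>
        ((w, fun i => germAt (f i) w (hdisc w.2 i)) : Sphere × (Fin n → RegularGerm))) :=
      continuous_subtype_val.prodMk
        (continuous_pi fun i => continuous_section (fun w hw => hdisc hw i))
    have := isPreconnected_iff_preconnectedSpace.1 (isPreconnected_disc a ρ)
    refine (isPreconnected_range hcont).subset_connectedComponentIn
      ⟨⟨a, mem_disc_self a hρ⟩, rfl⟩ ?_ ⟨⟨z, hz⟩, rfl⟩
    rintro _ ⟨w, rfl⟩ i
    rfl
  refine isSGerm_of_eventually _ hA ?_
  filter_upwards [eventually_all.2 fun i => eventually_avoiding (hf i) (hAf i),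
    eventually_all.2 fun i => (hf i).eventually, hnear,
    eventually_eventually_nhds.2 (eventually_nhdsWithin_iff.1 hval)]
    with z hz hfz hzC hzval hzA hkz γ hγ h0 hγA
  choose Φ hΦ using fun i => hz i (hfz i) γ hγ h0 hγA
  have hΦb : ∀ i t, (Φ i t).1 = γ t := fun i t => (hΦ i).base t unitInterval.le_one'
  have hΦC : ∀ t, ((γ t, fun i => Φ i t) : Sphere × (Fin n → RegularGerm)) ∈ C := by
    intro t
    have hcont : Continuous (fun t => ((γ t, fun i => Φ i t) :
        Sphere × (Fin n → RegularGerm))) :=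
      hγ.prodMk (continuous_pi fun i => (hΦ i).continuous hγ)
    have h1 : ((γ 0, fun i => Φ i 0) : Sphere × (Fin n → RegularGerm)) ∈ C := by
      simp only [h0, (hΦ _).start]
      exact hzC hfz
    have h2 := (isPreconnected_range hcont).subset_connectedComponentIn (F := S) ⟨0, rfl⟩
      (by rintro _ ⟨t, rfl⟩ i; exact hΦb i t) ⟨t, rfl⟩
    rwa [← connectedComponentIn_eq h1] at h2
  refine exists_continuation_op hγ hfz hΦ h0
    (Op := fun g w => meromorphicValue F fun i => g i w) ?_ ?_ hkz ?_
  · intro g g' w hgg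
    filter_upwards [eventually_all.2 hgg] with u hu
    simp only [hu]
  · intro t
    refine HolomorphicAt.comp_analyticAt (analyticAt_meromorphicValue ?_) fun i => ?_
    · by_contra hn
      exact hγA t (Or.inr (Or.inr ⟨fun i => rep (Φ i t),
        ⟨_, hΦC t, rfl, fun i => rep_spec _⟩, hn⟩))
    · rw [← hΦb i t]
      exact holomorphicAt_rep _
  · have hza : z ≠ a := fun hza => hzA (Or.inl hza)
    filter_upwards [hzval, eventually_ne_nhds hza] with w h1 h2
    exact (h1 h2).meromorphicValue_eq.symm

end SFun

end

/-! ### Stability under the six operations -/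

theorem theorem3 :
    (∀ f h : MultivaluedFunction, IsSFunction f → IsDerivativeOf h f → IsSFunction h) ∧
    (∀ f h : MultivaluedFunction, IsSFunction f → IsIntegralOf h f → IsSFunction h) ∧
    (∀ g f h : MultivaluedFunction, IsSFunction g → IsSFunction f →
      IsCompositionOf h g f → IsSFunction h) ∧
    (∀ (n : ℕ) (F : (Fin n → ℂ) → ℂ) (f : Fin n → MultivaluedFunction) (h : MultivaluedFunction),
      IsMeromorphic F → (∀ i, IsSFunction (f i)) →
      IsMeromorphicOperationOf h F f → IsSFunction h) ∧
    (∀ (n : ℕ) (f : Fin n → MultivaluedFunction) (h : MultivaluedFunction),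
      (∀ i, IsSFunction (f i)) → IsAlgebraicSolutionOf h f → IsSFunction h) ∧
    (∀ (n : ℕ) (f : Fin n → MultivaluedFunction) (h : MultivaluedFunction),
      (∀ i, IsSFunction (f i)) → IsLinearODESolutionOf h f → IsSFunction h) := by
  refine ⟨?_, ?_, ?_, ?_, ?_, ?_⟩
  · rintro f _ hf ⟨a, φ, hφ, rfl⟩
    exact isSFunction_generatedBy (isSGerm_derivGerm (hf _ hφ))
  · rintro f _ hf ⟨a, _, χ, hφ, rfl, rfl⟩
    exact isSFunction_generatedBy (isSGerm_of_derivGerm (hf _ hφ))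
  · rintro g f _ hg hf ⟨a, φ, ψ, hφ, hψ, rfl⟩
    exact isSFunction_generatedBy (isSGerm_compGerm (hf _ hφ) (hg _ hψ))
  · rintro n F f _ hF hf ⟨a, φ, χ, hφ, hχ, rfl⟩
    exact isSFunction_generatedBy
      (isSGerm_of_isMeromorphicImage hF (fun i => hf i _ (hφ i)) hχ)
  · rintro n f _ hf ⟨a, φ, χ, hφ, hχ, rfl⟩
    exact isSFunction_generatedBy (isSGerm_of_algebraic_equation (fun i => hf i _ (hφ i)) hχ)
  · rintro n f _ hf ⟨a, φ, χ, hφ, hχ, rfl⟩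
    exact isSFunction_generatedBy (isSGerm_of_linear_equation (fun i => hf i _ (hφ i)) hχ)
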